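/- **Setting.** Let $F$ be a 3-CNF formula (clauses with at most three literals, no clause containing a variable in both polarities) on a finite set $V$ of variables whose unique satisfying assignment is $(1,\dots,1)$. A *critical clause* of a variable $x$ is a clause whose only literal true under $(1,\dots,1)$ is $x$. For every variable $x$ fix a critical clause $C_x\in F$, the *canonical critical clause* of $x$. Fix a set $G\supseteq F$ of clauses with at most three literals (none containing a variable in both polarities), all logically implied by $F$ (the clauses of $F$ together with the derived clauses one takes into account, e.g. all resolvents of width at most three of two clauses of $F$), and let $\mathrm{TwoCC}$ be the set of variables that have at least two different critical clauses in $G$. **Critical clause trees.** Fix a height $h$. In the critical clause tree $T_x$ the root has variable label $x$. For a node $v$ let $\alpha_v$ be the assignment that is $0$ exactly on the variable labels of the path from the root to $v$. A node $v$ of depth less than $h$ with variable label $a$ has as clause label $C_a$ if $\alpha_v$ violates $C_a$, and otherwise an arbitrary (fixed) clause of $F$ violated by $\alpha_v$; it has one child, with variable label $y$, for each negative literal $\bar y$ of its clause label. Nodes of depth $h$ are leaves. A node $v$ is *canonical* if the clause label of every proper ancestor $u$ of $v$ is $C_{a}$, where $a$ is the variable label of $u$, and no node on the path from the root to $v$ has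 its variable label in $\mathrm{TwoCC}$. For a placement $\pi\in[0,1]^V$, the event $\mathrm{Cut}(T_x)$ is that every path from the root to a node of depth $h$ contains a non-root node with a variable label $y$ such that $\pi(y)<\pi(x)$. With $d(v)$ denoting the depth of $v$, define $$\mathrm{LabelDensity}(y,T_x)=\int_0^{1/2}\frac{(1-2r)^2}{(1-r)^3}\sum_{v\in T_x\text{ canonical with variable label }y} r^{d(v)+1}\,dr .$$ **The graph $H_{\rm low}$.** Let $H$ be the graph on $V$ whose edges are the pairs $\{y,z\}$, $y\neq z$, such that $C_x=(x\vee\bar y\vee\bar z)$ for some $x$. Let $H_{\rm free}$ be obtained from $H$ by deleting all edges incident to $\mathrm{TwoCC}$ and all edges $\{y,z\}$ with $C_x=(x\vee\bar y\vee\bar z)$ for some $x\in\mathrm{TwoCC}$. Let $\mathrm{Thr}\ge 0$, and let $H_{\rm low}$ be a subgraph of $H_{\rm free}$ of maximum degree at most $2$, with at most $23$ vertices in each connected component, such that $\mathrm{LabelDensity}(b,T_a)\le\mathrm{Thr}$ and $\mathrm{LabelDensity}(a,T_b)\le\mathrm{Thr}$ for every edge $\{a,b\}$ of $H_{\rm low}$.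 **The distribution $D$.** Let $0\le\epsilon\le 0.1$. On $[0,1/2]$ let $\gamma(r)=r(1-2r)^{3/2}$ and $\gamma_{\mathrm{TwoCC}}(r)=25\,r^3(1-2r)^2$; let both functions vanish for $r\ge 1/2$, and write $\phi=\gamma'$, $\phi_{\mathrm{TwoCC}}=\gamma_{\mathrm{TwoCC}}'$. Under $D$, the placement $\pi\in[0,1]^V$ has density $$\prod_{v\in\mathrm{TwoCC}}\bigl(1+\epsilon\,\phi_{\mathrm{TwoCC}}(\pi(v))\bigr)\;\prod_{C}\Bigl(1+\epsilon\sum_{\{u,v\}\in E(C)}\phi(\pi(u))\,\phi(\pi(v))\Bigr),$$ where $C$ ranges over the connected components of $H_{\rm low}$. **Statement.** Let $s_3=\int_0^1 Q_r\,dr=2-2\ln 2$, where $Q_r=\bigl(\tfrac{r}{1-r}\bigr)^2$ for $r<1/2$ and $Q_r=1$ for $r\ge 1/2$. There is a function $\mathrm{err}:\mathbb N\to\mathbb R$ with $\mathrm{err}(h)\to 0$ as $h\to\infty$ such that, for all choices of $V,F,G,(C_x)_x$, clause labels, $h$, $\epsilon$, $\mathrm{Thr}$ and $H_{\rm low}$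 as above and every variable $x\notin\mathrm{TwoCC}$, $$\Pr_{\pi\sim D}\bigl[\mathrm{Cut}(T_x)\bigr]\;\ge\; s_3-\mathrm{err}(h)-1.0302\,\epsilon\cdot\mathrm{Thr}.$$ -/

import Mathlib

namespace PPSZ

open scoped Classical

/-! ## Clauses and formulas -/

/-- A clause is a finite set of literals; `(v, true)` is the literal `v`, `(v, false)` its
negation. -/
abbrev Clause (V : Type) := Finset (V × Bool)

/-- The assignment `α` satisfies the clause `C`. -/
def ClauseSat {V : Type} (α : V → Bool) (C : Clause V) : Prop :=
  ∃ l ∈ C, α l.1 = l.2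

/-- The assignment `α` satisfies all clauses of the formula `F`. -/
def Satisfies {V : Type} (α : V → Bool) (F : Finset (Clause V)) : Prop :=
  ∀ C ∈ F, ClauseSat α C

/-- At most three literals, and no variable occurs in both polarities. -/
def IsThreeClause {V : Type} (C : Clause V) : Prop :=
  C.card ≤ 3 ∧ ∀ v, ¬ ((v, true) ∈ C ∧ (v, false) ∈ C)

/-- `F` is a 3-CNF formula. -/
def IsThreeCNF {V : Type} (F : Finset (Clause V)) : Prop :=
  ∀ C ∈ F, IsThreeClause C

/-- The all-ones assignment is the unique satisfying assignment of `F`. -/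
def UniquelySat {V : Type} (F : Finset (Clause V)) : Prop :=
  ∀ α : V → Bool, Satisfies α F ↔ α = fun _ => true

/-- `C` is a critical clause of `x`: the literal `x` is the only literal of `C` that is true under
the all-ones assignment. -/
def IsCritical {V : Type} (C : Clause V) (x : V) : Prop :=
  ∀ l : V × Bool, (l ∈ C ∧ l.2 = true) ↔ l = (x, true)

/-- `canon` selects, for every variable, one of its critical clauses in `F`: the canonical critical
clause of that variable. -/
def IsCanonicalChoice {V : Type} (F : Finset (Clause V)) (canon : V → Clause V) : Prop :=
  ∀ x, canon x ∈ F ∧ IsCritical (canon x) x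

/-! ## Derived clauses and the set `TwoCC` -/

/-- `G` consists of the clauses of `F` and of further ("derived") 3-clauses, all of them logically
implied by `F`. -/
def IsDerivedSet {V : Type} (F : Finset (Clause V)) (G : Set (Clause V)) : Prop :=
  (∀ C ∈ F, C ∈ G) ∧
    ∀ C ∈ G, IsThreeClause C ∧ ∀ α : V → Bool, Satisfies α F → ClauseSat α C

/-- The variables with at least two critical clauses in `G`. -/
def TwoCC {V : Type} (G : Set (Clause V)) : Set V :=
  {x | ∃ C ∈ G, ∃ D ∈ G, C ≠ D ∧ IsCritical C x ∧ IsCritical D x}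

/-- The clauses of `F` together with all 3-clauses obtained from two clauses of `F` by one
resolution step. -/
def withResolvents {V : Type} (F : Finset (Clause V)) : Set (Clause V) :=
  {E | E ∈ F ∨ (IsThreeClause E ∧ ∃ C ∈ F, ∃ D ∈ F, ∃ v : V, (v, true) ∈ C ∧ (v, false) ∈ D ∧
    E = C.erase (v, true) ∪ D.erase (v, false))}

/-- Adding the resolvents is one admissible choice of the derived clauses. -/
theorem isDerivedSet_withResolvents {V : Type} (F : Finset (Clause V)) (hF : IsThreeCNF F) :
    IsDerivedSet F (withResolvents F) := by
  refine ⟨fun C hC => Or.inl hC, ?_⟩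
  rintro E (hE | ⟨h3, C, hC, D, hD, v, -, -, rfl⟩)
  · exact ⟨hF E hE, fun α hα => hα E hE⟩
  · refine ⟨h3, fun α hα => ?_⟩
    obtain ⟨l, hl, hls⟩ := hα C hC
    obtain ⟨m, hm, hms⟩ := hα D hD
    by_cases h : l = (v, true)
    · refine ⟨m, ?_, hms⟩
      have : m ≠ (v, false) := by
        rintro rfl
        subst h
        simp_all
      simp [this, hm]
    · exact ⟨l, by simp [h, hl], hls⟩

/-! ## Critical clause trees -/

/-- A node of a tree is represented by the list of the variable labels on the path from that node
up to the root. Its assignment label sets exactly these variables to 0. -/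
noncomputable def nodeAssignment {V : Type} (p : List V) : V → Bool :=
  fun v => decide (v ∉ p)

/-- `pick` selects, for every node, a clause of `F` that is violated by the assignment label. -/
def IsClauseChoice {V : Type} (F : Finset (Clause V)) (pick : List V → Clause V) : Prop :=
  ∀ p, p ≠ [] → pick p ∈ F ∧ ¬ ClauseSat (nodeAssignment p) (pick p)

/-- The clause label of a node: the canonical critical clause of its variable label if the
assignment label violates it, and otherwise some violated clause of `F`. -/
noncomputable def clauseLabel {V : Type} (canon : V → Clause V) (pick : List V → Clause V) :
    List V → Clause V
  | [] => pick []
  | a :: q => if ClauseSat (nodeAssignment (a :: q)) (canon a) then pick (a :: q) else canon a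

/-- The nodes of depth `d` of the critical clause tree of `x`: the root has label `x`, and a node
has one child with label `y` for every negative literal of a variable `y` in its clause label. -/
noncomputable def level {V : Type} (canon : V → Clause V) (pick : List V → Clause V) (x : V) :
    ℕ → Finset (List V)
  | 0 => {[x]}
  | d + 1 => (level canon pick x d).biUnion fun p =>
      ((clauseLabel canon pick p).filter fun l => l.2 = false).image fun l => l.1 :: p

/-- The event `Cut(T_x)` for the tree of height `h`: every path from the root to a leaf of depth `h`
contains a non-root node whose variable is placed before `x`. -/
def Cut {V : Type} (canon : V → Clause V) (pick : List V → Clause V) (x : V) (h : ℕ)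
    (π : V → ℝ) : Prop :=
  ∀ p ∈ level canon pick x h, ∃ v ∈ p.dropLast, π v < π x

/-- A node is canonical if the clause label of each of its proper ancestors is the canonical
critical clause of the label of that ancestor, and no label on its path to the root is in `W`
(the set `TwoCC`). -/
def IsCanonical {V : Type} (canon : V → Clause V) (pick : List V → Clause V) (W : Set V)
    (p : List V) : Prop :=
  (∀ v ∈ p, v ∉ W) ∧
    ∀ a q, (a :: q) <:+ p → a :: q ≠ p → clauseLabel canon pick (a :: q) = canon a

/-- The canonical nodes of depth `d` with variable label `y` in the tree of `x`. -/
noncomputable def canonicalNodes {V : Type} (canon : V → Clause V) (pick : List V → Clause V)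
    (W : Set V) (x y : V) (d : ℕ) : Finset (List V) :=
  (level canon pick x d).filter fun p => IsCanonical canon pick W p ∧ p.head? = some y

/-- `LabelDensity(y, T_x, r)` for the tree `T_x` of height `h` (for `r ≤ 1/2`). -/
noncomputable def labelDensityAt {V : Type} (canon : V → Clause V) (pick : List V → Clause V)
    (W : Set V) (h : ℕ) (y x : V) (r : ℝ) : ℝ :=
  (1 - 2 * r) ^ 2 / (1 - r) ^ 3 *
    ∑ d ∈ Finset.range (h + 1), ∑ _p ∈ canonicalNodes canon pick W x y d, r ^ (d + 1)

/-- `LabelDensity(y, T_x)`. -/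
noncomputable def labelDensity {V : Type} (canon : V → Clause V) (pick : List V → Clause V)
    (W : Set V) (h : ℕ) (y x : V) : ℝ :=
  ∫ r in (0 : ℝ)..(1 / 2), labelDensityAt canon pick W h y x r

/-! ## The graph `H_low` -/

/-- The graph `H`: `y` and `z` are adjacent if `(x ∨ ¬y ∨ ¬z)` is the canonical critical clause of
some `x`. -/
def clauseGraph {V : Type} (canon : V → Clause V) : SimpleGraph V where
  Adj y z := y ≠ z ∧ ∃ x, canon x = {(x, true), (y, false), (z, false)}
  symm := ⟨by
    rintro y z ⟨hne, x, hx⟩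
    exact ⟨hne.symm, x, by rw [hx, Finset.pair_comm]⟩⟩
  loopless := ⟨fun _ h => h.1 rfl⟩

/-- The graph `H_free`: from `H`, remove all edges incident to a vertex in `W` and all edges
`{y, z}` such that `(x ∨ ¬y ∨ ¬z)` is the canonical critical clause of some `x` in `W`. -/
def freeGraph {V : Type} (canon : V → Clause V) (W : Set V) : SimpleGraph V where
  Adj y z := (clauseGraph canon).Adj y z ∧ y ∉ W ∧ z ∉ W ∧
    ∀ x, canon x = {(x, true), (y, false), (z, false)} → x ∉ W
  symm := ⟨by
    rintro y z ⟨hH, hy, hz, hx⟩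
    exact ⟨hH.symm, hz, hy, fun x h => hx x (by rw [h, Finset.pair_comm])⟩⟩
  loopless := ⟨fun _ h => h.1.1 rfl⟩

/-- `H` is a possible graph `H_low`: a subgraph of `H_free` of maximum degree at most 2 (so its
components are paths and cycles) with at most 23 vertices per component, all of whose edges have
label density at most `Thr` in both directions. -/
structure IsLowGraph {V : Type} (canon : V → Clause V) (pick : List V → Clause V) (W : Set V)
    (h : ℕ) (Thr : ℝ) (H : SimpleGraph V) : Prop where
  le_free : H ≤ freeGraph canon W
  degree_le : ∀ v, (H.neighborSet v).ncard ≤ 2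
  component_le : ∀ c : H.ConnectedComponent, c.supp.ncard ≤ 23
  density_le : ∀ a b, H.Adj a b → labelDensity canon pick W h b a ≤ Thr

/-! ## The distribution `D` -/

/-- `γ(r) = r (1 - 2r)^{3/2}` on `[0, 1/2]`, and `0` beyond. -/
noncomputable def gam (r : ℝ) : ℝ := if r < 1 / 2 then r * (1 - 2 * r) ^ (3 / 2 : ℝ) else 0

/-- `φ = γ'`. -/
noncomputable def phi (r : ℝ) : ℝ := if r < 1 / 2 then √(1 - 2 * r) * (1 - 5 * r) else 0

/-- `γ_TwoCC(r) = 25 r^3 (1 - 2r)^2` on `[0, 1/2]`, and `0` beyond. -/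
noncomputable def gamTwo (r : ℝ) : ℝ := if r < 1 / 2 then 25 * r ^ 3 * (1 - 2 * r) ^ 2 else 0

/-- The derivative of `γ_TwoCC`. -/
noncomputable def phiTwo (r : ℝ) : ℝ :=
  if r < 1 / 2 then 25 * r ^ 2 * (1 - 2 * r) * (3 - 10 * r) else 0

theorem hasDerivAt_glue (f g : ℝ → ℝ) (hf : ∀ r ≤ 1 / 2, HasDerivAt f (g r) r)
    (hf0 : f (1 / 2) = 0) (hg0 : g (1 / 2) = 0) (r : ℝ) :
    HasDerivAt (fun r => if r < 1 / 2 then f r else 0) (if r < 1 / 2 then g r else 0) r := by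
  rcases lt_trichotomy r (1 / 2) with h | h | h
  · rw [if_pos h]
    refine (hf r h.le).congr_of_eventuallyEq ?_
    filter_upwards [Iio_mem_nhds h] with s hs using if_pos hs
  · subst h
    rw [if_neg (lt_irrefl _)]
    rw [← hasDerivWithinAt_univ, ← Set.Iic_union_Ici (a := (1 / 2 : ℝ))]
    refine HasDerivWithinAt.union ?_ ?_
    · have h1 := (hf (1 / 2) le_rfl).hasDerivWithinAt (s := Set.Iic (1 / 2))
      rw [hg0] at h1
      refine h1.congr (fun s hs => ?_) (by rw [if_neg (lt_irrefl _), hf0])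
      rcases (Set.mem_Iic.1 hs).lt_or_eq with h | h
      · simp only [if_pos h]
      · subst h
        simp only [if_neg (lt_irrefl (1 / 2 : ℝ)), hf0]
    · refine (hasDerivWithinAt_const (1 / 2 : ℝ) _ (0 : ℝ)).congr (fun s hs => ?_) (by simp)
      exact if_neg (not_lt.2 hs)
  · rw [if_neg h.le.not_gt]
    refine (hasDerivAt_const r (0 : ℝ)).congr_of_eventuallyEq ?_
    filter_upwards [Ioi_mem_nhds h] with s hs using if_neg (not_lt.2 (le_of_lt hs))

theorem hasDerivAt_gam (r : ℝ) : HasDerivAt gam (phi r) r := by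
  refine hasDerivAt_glue (fun r => r * (1 - 2 * r) ^ (3 / 2 : ℝ))
    (fun r => √(1 - 2 * r) * (1 - 5 * r)) (fun s hs => ?_) (by norm_num) (by norm_num) r
  have h1 : HasDerivAt (fun r : ℝ => 1 - 2 * r) (-2) s := by
    simpa using ((hasDerivAt_id s).const_mul 2).const_sub 1
  have h2 := (hasDerivAt_id s).mul (h1.rpow_const (p := (3 / 2 : ℝ)) (Or.inr (by norm_num)))
  refine h2.congr_deriv ?_
  have h0 : 0 ≤ 1 - 2 * s := by linarith
  have h3 : (1 - 2 * s) ^ (3 / 2 : ℝ) = (1 - 2 * s) * √(1 - 2 * s) := by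
    rw [Real.sqrt_eq_rpow, show (3 / 2 : ℝ) = 1 + 1 / 2 by norm_num,
      Real.rpow_add_of_nonneg h0 (by norm_num) (by norm_num), Real.rpow_one]
  have h4 : (1 - 2 * s) ^ ((3 / 2 : ℝ) - 1) = √(1 - 2 * s) := by
    rw [Real.sqrt_eq_rpow]
    norm_num
  rw [h3, h4]
  simp only [id]
  ring

theorem hasDerivAt_gamTwo (r : ℝ) : HasDerivAt gamTwo (phiTwo r) r := by
  refine hasDerivAt_glue (fun r => 25 * r ^ 3 * (1 - 2 * r) ^ 2)
    (fun r => 25 * r ^ 2 * (1 - 2 * r) * (3 - 10 * r)) (fun s _ => ?_) (by norm_num) (by norm_num) r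
  have h1 : HasDerivAt (fun r : ℝ => 1 - 2 * r) (-2) s := by
    simpa using ((hasDerivAt_id s).const_mul 2).const_sub 1
  have h2 := (((hasDerivAt_id s).pow 3).const_mul 25).mul (h1.pow 2)
  refine h2.congr_deriv ?_
  simp only [id, Pi.pow_apply]
  norm_num
  ring

/-- The product `φ(π u) φ(π v)` over an edge `{u, v}`. -/
noncomputable def edgeTerm {V : Type} (π : V → ℝ) (e : Sym2 V) : ℝ :=
  Sym2.lift ⟨fun u v => phi (π u) * phi (π v), fun _ _ => mul_comm _ _⟩ e

/-- The density of `D` with respect to the uniform distribution on `[0,1]^V`. Every variable in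
`W` (the set `TwoCC`) has density `1 + ε φ_TwoCC`, every connected component `C` of `H` has joint
density `1 + ε ∑_{uv ∈ E(C)} φ(π u) φ(π v)`, and all of these are independent. -/
noncomputable def densityD {V : Type} [Fintype V] (ε : ℝ) (W : Set V) (H : SimpleGraph V)
    (π : V → ℝ) : ℝ :=
  (∏ v ∈ Finset.univ.filter (fun v => v ∈ W), (1 + ε * phiTwo (π v))) *
    ∏ c : H.ConnectedComponent,
      (1 + ε * ∑ e ∈ H.edgeFinset.filter (fun e => ∀ v ∈ e, v ∈ c.supp), edgeTerm π e)

/-- The distribution `D` on placements `π : V → [0,1]`. -/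
noncomputable def distD {V : Type} [Fintype V] (ε : ℝ) (W : Set V) (H : SimpleGraph V) :
    MeasureTheory.Measure (V → ℝ) :=
  (MeasureTheory.Measure.pi fun _ : V => MeasureTheory.volume.restrict (Set.Icc (0 : ℝ) 1)).withDensity
    fun π => ENNReal.ofReal (densityD ε W H π)

/-! ## The constant `s_3` -/

/-- `Q_r`, the probability that the infinite binary tree, all of whose nodes have independent
labels, is cut at `r`. -/
noncomputable def cutProb (r : ℝ) : ℝ := if r < 1 / 2 then (r / (1 - r)) ^ 2 else 1

/-- `s_3 = ∫_0^1 Q_r dr`, which equals `2 - 2 ln 2`. -/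
noncomputable def sThree : ℝ := ∫ r in (0 : ℝ)..1, cutProb r

theorem sThree_eq : sThree = 2 - 2 * Real.log 2 := by
  have hd : ∀ r ∈ Set.uIcc (0 : ℝ) (1 / 2),
      HasDerivAt (fun r : ℝ => r + 2 * Real.log (1 - r) + (1 - r)⁻¹) ((r / (1 - r)) ^ 2) r := by
    intro r hr
    rw [Set.uIcc_of_le (by norm_num)] at hr
    have hne : 1 - r ≠ 0 := by linarith [hr.2]
    have h1 : HasDerivAt (fun r : ℝ => 1 - r) (-1) r := by
      simpa using (hasDerivAt_id r).const_sub 1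
    refine (((hasDerivAt_id r).add ((h1.log hne).const_mul 2)).add (h1.inv hne)).congr_deriv ?_
    field_simp
    ring
  have hc : ContinuousOn (fun r : ℝ => (r / (1 - r)) ^ 2) (Set.uIcc (0 : ℝ) (1 / 2)) := by
    rw [Set.uIcc_of_le (by norm_num)]
    refine (continuousOn_id.div (by fun_prop) fun r hr => ?_).pow 2
    linarith [hr.2]
  have hi := hc.intervalIntegrable (μ := MeasureTheory.volume)
  have e1 : ∀ᵐ r : ℝ, r ∈ Set.uIoc (0 : ℝ) (1 / 2) → (r / (1 - r)) ^ 2 = cutProb r := by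
    filter_upwards with r hr
    rw [Set.uIoc_of_le (by norm_num)] at hr
    unfold cutProb
    split_ifs with h
    · rfl
    · have : r = 1 / 2 := le_antisymm hr.2 (not_lt.1 h)
      subst this
      norm_num
  have e2 : ∀ r ∈ Set.uIoc (1 / 2 : ℝ) 1, (1 : ℝ) = cutProb r := by
    intro r hr
    rw [Set.uIoc_of_le (by norm_num)] at hr
    exact (if_neg (not_lt.2 hr.1.le)).symm
  have i1 : IntervalIntegrable cutProb MeasureTheory.volume 0 (1 / 2) :=
    hi.congr_ae ((MeasureTheory.ae_restrict_iff' measurableSet_uIoc).2 e1)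
  have i2 : IntervalIntegrable cutProb MeasureTheory.volume (1 / 2) 1 :=
    (intervalIntegrable_const (μ := MeasureTheory.volume) (a := (1 / 2 : ℝ)) (b := 1)
      (c := (1 : ℝ))).congr e2
  have j2 : ∫ r in (1 / 2 : ℝ)..1, cutProb r = 1 / 2 := by
    rw [← intervalIntegral.integral_congr_ae (Filter.Eventually.of_forall e2)]
    norm_num
  rw [sThree, ← intervalIntegral.integral_add_adjacent_intervals i1 i2, j2,
    ← intervalIntegral.integral_congr_ae e1, intervalIntegral.integral_eq_sub_of_hasDerivAt hd hi]
  have : (1 : ℝ) - 1 / 2 = 2⁻¹ := by norm_num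
  rw [this, Real.log_inv]
  norm_num
  ring

end PPSZ

/-!
The placement `π` drawn from `D` is close to a uniform one, for which the cut probability, given
that the root `x` is placed at `r`, would be that of the infinite binary tree with independent
labels, namely `P ^ 2` with `P = r / (1 - r)` for `r < 1/2`. The proof conditions on the place `r`
of `x`, keeps only the pattern telling which variables are placed before `r`, and bounds what the
correlations of `D` can destroy.

*Patterns.* The density of `D` is multi-affine in the values `φ (π y)` and `φ_TwoCC (π y)`
(`densityD_eq`, `multiAffine_densPoly`). These may therefore be replaced by their conditional
expectations given the pattern (`integral_multiAffine`), which are `γ(r)/r` and `-γ(r)/(1-r)` since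
`φ = γ'`. The resulting law of the pattern is a `Slice`, and `exists_integral_le_distD` bounds the
probability of `Cut` by an integral over `r`.

*A recursion down the tree.* Suppose that the labels of the proper ancestors of a node are not
placed before `r`. Then the label of the node is placed before `r` with probability at least
`r + ε γ_TwoCC(r)` if it lies in `TwoCC`, and otherwise with probability at least `r - loss`, where
only neighbours of the label that are on the path, or are the root, contribute to the loss:
correlations with all other variables help, because being cut is a monotone event. This remains
true with an arbitrary monotone weight (`Slice.Valid.placed_of_mem`,
`Slice.Valid.placed_of_notMem`). Hence the cut events of the children of a node may be treated as
independent, and the cut probability dominates a recursively defined product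
(`Slice.expect_root_ge`).

*Only canonical nodes lose.* Below any node the losses sum to a bounded amount
(`Slice.Budget.cutBound_ge`). A label in `TwoCC` gains more than everything lost below it, and so
does a node with at most one child. A canonical node whose clause label is not the canonical
critical clause of its variable has at most one child (`card_children_le_one`). So up to a term
that, for fixed `r`, decays exponentially with the height, the loss at the root is the sum over the
canonical nodes (`Slice.Budget.root_ge`).

*Label densities.* A canonical path between two adjacent labels `b` and `a`, read in the tree of
`x`, is a canonical path from the root to a node with label `b` in the tree of `a`
(`canonical_transplant`). The total loss is therefore a combination of the label densities at `r`
of adjacent labels, the pairs whose upper label has depth `d` in the tree of `x` entering with a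
weight of at most `17/14 * ε * 2 ^ (-d) * lossCoeff d` (`prod_cutBound_ge_of_lt_half`). There are
at most `2 ^ d` such upper labels with two neighbours each, so after integration the loss is at most
`17/14 * 2 * (∑ lossCoeff d) * ε * Thr`, and the constant is less than `1.0302`. For `r > 1/2` there
are no correlations, and the cut probability tends to `1` with growing height.
-/

namespace PPSZ

open scoped Classical
open MeasureTheory

/-! ### Combinatorics of critical clause trees -/

/-- The children of a node of a critical clause tree. -/
noncomputable def children {V : Type} (canon : V → Clause V) (pick : List V → Clause V)
    (p : List V) : Finset (List V) :=
  ((clauseLabel canon pick p).filter fun l => l.2 = false).image fun l => l.1 :: p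

theorem mem_children {V : Type} {canon : V → Clause V} {pick : List V → Clause V}
    {p w : List V} :
    w ∈ children canon pick p ↔ ∃ y, (y, false) ∈ clauseLabel canon pick p ∧ w = y :: p := by
  simp only [children, Finset.mem_image, Finset.mem_filter, Prod.exists]
  constructor
  · rintro ⟨a, b, ⟨h1, rfl⟩, rfl⟩
    exact ⟨a, h1, rfl⟩
  · rintro ⟨y, h, rfl⟩
    exact ⟨y, false, ⟨h, rfl⟩, rfl⟩

theorem level_succ {V : Type} (canon : V → Clause V) (pick : List V → Clause V) (x : V) (d : ℕ) :
    level canon pick x (d + 1) = (level canon pick x d).biUnion (children canon pick) := rfl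

theorem length_of_mem_level {V : Type} {canon : V → Clause V} {pick : List V → Clause V} {x : V}
    {d : ℕ} {p : List V} (hp : p ∈ level canon pick x d) : p.length = d + 1 := by
  induction d generalizing p with
  | zero => simp only [level, Finset.mem_singleton] at hp; simp [hp]
  | succ d ih =>
    rw [level_succ, Finset.mem_biUnion] at hp
    obtain ⟨q, hq, hp⟩ := hp
    obtain ⟨y, -, rfl⟩ := mem_children.1 hp
    simp [ih hq]

theorem clauseSat_nodeAssignment_iff {V : Type} {p : List V} {C : Clause V} :
    ¬ ClauseSat (nodeAssignment p) C ↔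
      (∀ v, (v, true) ∈ C → v ∈ p) ∧ ∀ v, (v, false) ∈ C → v ∉ p := by
  constructor
  · intro h
    refine ⟨fun v hv => ?_, fun v hv hp => h ⟨_, hv, ?_⟩⟩
    · by_contra hp
      exact h ⟨_, hv, by simp [nodeAssignment, hp]⟩
    · simp [nodeAssignment, hp]
  · rintro ⟨h1, h2⟩ ⟨⟨v, b⟩, hl, hs⟩
    cases b
    · exact h2 v hl (by simpa [nodeAssignment] using hs)
    · have := h1 v hl
      simp [nodeAssignment, this] at hs

theorem clauseLabel_spec {V : Type} {F : Finset (Clause V)} {canon : V → Clause V}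
    {pick : List V → Clause V} (hcanon : IsCanonicalChoice F canon) (hpick : IsClauseChoice F pick)
    {p : List V} (hp : p ≠ []) :
    clauseLabel canon pick p ∈ F ∧
      ¬ ClauseSat (nodeAssignment p) (clauseLabel canon pick p) := by
  cases p with
  | nil => exact absurd rfl hp
  | cons a q =>
    simp only [clauseLabel]
    split_ifs with h
    · exact hpick _ hp
    · exact ⟨(hcanon a).1, h⟩

theorem notMem_of_mem_children {V : Type} {F : Finset (Clause V)} {canon : V → Clause V}
    {pick : List V → Clause V} (hcanon : IsCanonicalChoice F canon) (hpick : IsClauseChoice F pick)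
    {p w : List V} (hp : p ≠ []) (hw : w ∈ children canon pick p) :
    ∃ y, y ∉ p ∧ w = y :: p := by
  obtain ⟨y, hy, rfl⟩ := mem_children.1 hw
  exact ⟨y, (clauseSat_nodeAssignment_iff.1 (clauseLabel_spec hcanon hpick hp).2).2 y hy, rfl⟩

theorem exists_pos_literal {V : Type} {F : Finset (Clause V)} (hF : UniquelySat F) {C : Clause V}
    (hC : C ∈ F) : ∃ y, (y, true) ∈ C := by
  obtain ⟨⟨y, b⟩, hl, hs⟩ := (hF fun _ => true).2 rfl C hC
  simp only at hs
  subst hs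
  exact ⟨y, hl⟩

theorem card_children {V : Type} (canon : V → Clause V) (pick : List V → Clause V) (p : List V) :
    (children canon pick p).card =
      ((clauseLabel canon pick p).filter fun l => l.2 = false).card := by
  refine Finset.card_image_of_injOn ?_
  rintro ⟨a, b⟩ h1 ⟨c, d⟩ h2 h
  simp only [Finset.coe_filter, Set.mem_ofPred_eq] at h1 h2
  simp only [List.cons.injEq, and_true] at h
  simp [h, h1.2, h2.2]

theorem card_children_le_two {V : Type} {F : Finset (Clause V)} {canon : V → Clause V}
    {pick : List V → Clause V} (h3 : IsThreeCNF F) (hF : UniquelySat F)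
    (hcanon : IsCanonicalChoice F canon) (hpick : IsClauseChoice F pick)
    {p : List V} (hp : p ≠ []) : (children canon pick p).card ≤ 2 := by
  have hC := (clauseLabel_spec hcanon hpick hp).1
  obtain ⟨y, hy⟩ := exists_pos_literal hF hC
  rw [card_children]
  have h1 : ((clauseLabel canon pick p).filter fun l => l.2 = false) ⊆
      (clauseLabel canon pick p).erase (y, true) := by
    intro l hl
    rw [Finset.mem_filter] at hl
    refine Finset.mem_erase.2 ⟨?_, hl.1⟩
    rintro rfl
    simp at hl
  have h2 := Finset.card_le_card h1
  rw [Finset.card_erase_of_mem hy] at h2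
  have := (h3 _ hC).1
  omega

theorem disjoint_children {V : Type} {canon : V → Clause V} {pick : List V → Clause V}
    {p q : List V} (h : p ≠ q) : Disjoint (children canon pick p) (children canon pick q) := by
  rw [Finset.disjoint_left]
  intro w hp hq
  obtain ⟨y, -, rfl⟩ := mem_children.1 hp
  obtain ⟨z, -, hz⟩ := mem_children.1 hq
  exact h (List.cons.inj hz).2

theorem sum_level_succ {V : Type} (canon : V → Clause V) (pick : List V → Clause V) (x : V) (d : ℕ)
    (f : List V → ℝ) :
    ∑ p ∈ level canon pick x (d + 1), f p =
      ∑ p ∈ level canon pick x d, ∑ w ∈ children canon pick p, f w := by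
  rw [level_succ, Finset.sum_biUnion]
  intro p _ q _ h
  exact disjoint_children h

theorem card_level_le {V : Type} {F : Finset (Clause V)} {canon : V → Clause V}
    {pick : List V → Clause V} (h3 : IsThreeCNF F) (hF : UniquelySat F)
    (hcanon : IsCanonicalChoice F canon) (hpick : IsClauseChoice F pick) (x : V) (d : ℕ) :
    (level canon pick x d).card ≤ 2 ^ d := by
  induction d with
  | zero => simp [level]
  | succ d ih =>
    rw [level_succ]
    refine (Finset.card_biUnion_le_card_mul _ _ 2 fun p hp => ?_).trans ?_
    · refine card_children_le_two h3 hF hcanon hpick ?_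
      rintro rfl
      simpa using length_of_mem_level hp
    · rw [pow_succ]
      omega

/-- The labels on a path of a critical clause tree are distinct. -/
theorem nodup_of_mem_level {V : Type} {F : Finset (Clause V)} {canon : V → Clause V}
    {pick : List V → Clause V} (hcanon : IsCanonicalChoice F canon) (hpick : IsClauseChoice F pick)
    {x : V} {d : ℕ} {p : List V} (hp : p ∈ level canon pick x d) : p.Nodup := by
  induction d generalizing p with
  | zero => simp only [level, Finset.mem_singleton] at hp; simp [hp]
  | succ d ih =>
    rw [level_succ, Finset.mem_biUnion] at hp
    obtain ⟨q, hq, hp⟩ := hp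
    have hq0 : q ≠ [] := by
      rintro rfl
      simpa using length_of_mem_level hq
    obtain ⟨y, hy, rfl⟩ := notMem_of_mem_children hcanon hpick hq0 hp
    exact List.nodup_cons.2 ⟨hy, ih hq⟩

theorem getLast?_of_mem_level {V : Type} {canon : V → Clause V} {pick : List V → Clause V} {x : V}
    {d : ℕ} {p : List V} (hp : p ∈ level canon pick x d) : p.getLast? = some x := by
  induction d generalizing p with
  | zero => simp only [level, Finset.mem_singleton] at hp; simp [hp]
  | succ d ih =>
    rw [level_succ, Finset.mem_biUnion] at hp
    obtain ⟨q, hq, hp⟩ := hp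
    obtain ⟨y, -, rfl⟩ := mem_children.1 hp
    have := ih hq
    rw [List.getLast?_cons, this]
    rfl

theorem root_notMem_dropLast {V : Type} {F : Finset (Clause V)} {canon : V → Clause V}
    {pick : List V → Clause V} (hcanon : IsCanonicalChoice F canon) (hpick : IsClauseChoice F pick)
    {x : V} {d : ℕ} {p : List V} (hp : p ∈ level canon pick x d) : x ∉ p.dropLast := by
  have h1 := nodup_of_mem_level hcanon hpick hp
  have h2 := getLast?_of_mem_level hp
  have h3 := List.dropLast_append_getLast? x h2
  rw [← h3] at h1
  intro hx
  exact (List.nodup_append.1 h1).2.2 x hx x (by simp) rfl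

/-- All ancestors of a node are nodes. -/
theorem drop_mem_level {V : Type} {canon : V → Clause V} {pick : List V → Clause V} {x : V}
    {d j : ℕ} {p : List V} (hp : p ∈ level canon pick x (d + j)) :
    p.drop j ∈ level canon pick x d := by
  induction j generalizing p with
  | zero => simpa using hp
  | succ j ih =>
    rw [← add_assoc, level_succ, Finset.mem_biUnion] at hp
    obtain ⟨q, hq, hp⟩ := hp
    obtain ⟨y, -, rfl⟩ := mem_children.1 hp
    simpa using ih hq

/-- A node all of whose proper ancestors carry their canonical clause, on a path that avoids
`TwoCC`, has at most one child if its own clause label is not the canonical one: if it had two,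
the clause label would be critical for some variable of the path, hence the canonical clause of
that variable, and one of its negative literals would occur on the path. -/
theorem card_children_le_one {V : Type} {F : Finset (Clause V)} {G : Set (Clause V)}
    {canon : V → Clause V}
    {pick : List V → Clause V} (h3 : IsThreeCNF F) (hF : UniquelySat F) (hG : IsDerivedSet F G)
    (hcanon : IsCanonicalChoice F canon) (hpick : IsClauseChoice F pick)
    {x : V} {d : ℕ} {a : V} {q : List V} (hp : a :: q ∈ level canon pick x d)
    (hc : IsCanonical canon pick (TwoCC G) (a :: q))
    (hne : clauseLabel canon pick (a :: q) ≠ canon a) :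
    (children canon pick (a :: q)).card ≤ 1 := by
  obtain ⟨hC, hv⟩ := clauseLabel_spec hcanon hpick (p := a :: q) (by simp)
  rw [clauseSat_nodeAssignment_iff] at hv
  set D := clauseLabel canon pick (a :: q) with hD
  by_contra! hlt
  rw [card_children, ← hD] at hlt
  obtain ⟨y, hy⟩ := exists_pos_literal hF hC
  have hcrit : IsCritical D y := by
    rintro ⟨z, b⟩
    constructor
    · rintro ⟨hz, hb⟩
      simp only at hb
      subst hb
      by_contra hzy
      have h1 : ((D.filter fun l => l.2 = false)) ⊆ (D.erase (y, true)).erase (z, true) := by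
        intro l hl
        rw [Finset.mem_filter] at hl
        simp only [Finset.mem_erase]
        refine ⟨?_, ?_, hl.1⟩ <;>
        · rintro rfl
          simp at hl
      have h2 := Finset.card_le_card h1
      rw [Finset.card_erase_of_mem (Finset.mem_erase.2 ⟨hzy, hz⟩), Finset.card_erase_of_mem hy]
        at h2
      have := (h3 _ hC).1
      omega
    · intro h
      cases h
      exact ⟨hy, rfl⟩
  have hyp := hv.1 y hy
  have hyW := hc.1 y hyp
  have hDy : D = canon y := by
    by_contra h
    exact hyW ⟨D, hG.1 _ hC, canon y, hG.1 _ (hcanon y).1, h, hcrit, (hcanon y).2⟩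
  have hya : y ≠ a := by
    rintro rfl
    exact hne hDy
  have hyq : y ∈ q := by simpa [hya] using hyp
  obtain ⟨s, t, hst⟩ := List.append_of_mem hyp
  rcases List.eq_nil_or_concat s with rfl | ⟨s', z, rfl⟩
  · simp at hst
    exact hya hst.1.symm
  have hsuf : (y :: t) <:+ (a :: q) := ⟨_, hst.symm⟩
  have hlab := hc.2 y t hsuf (by
    intro h
    rw [← h] at hst
    have := congrArg List.length hst
    simp at this
    omega)
  have hdrop : z :: y :: t ∈ level canon pick x ((y :: t).length) := by
    have hlen := length_of_mem_level hp
    rw [hst] at hlen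
    have hlen' : d = (y :: t).length + s'.length := by simp at hlen ⊢; omega
    rw [hlen'] at hp
    have := drop_mem_level hp
    rw [hst] at this
    simpa using this
  have : z :: y :: t ∈ children canon pick (y :: t) := by
    rw [List.length_cons, level_succ, Finset.mem_biUnion] at hdrop
    obtain ⟨u, hu, hz⟩ := hdrop
    obtain ⟨z', -, hz'⟩ := mem_children.1 hz
    rw [(List.cons.inj hz').2]
    rwa [← (List.cons.inj hz').2] at hz ⊢
  obtain ⟨z', hz', hzz⟩ := mem_children.1 this
  rw [(List.cons.inj hzz).1.symm, hlab, ← hDy] at hz'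
  exact hv.2 z hz' (by rw [hst]; simp)

theorem IsCanonical.of_suffix {V : Type} {canon : V → Clause V} {pick : List V → Clause V}
    {W : Set V} {p t : List V} (hp : IsCanonical canon pick W p) (ht : t <:+ p) :
    IsCanonical canon pick W t := by
  refine ⟨fun v hv => hp.1 v (ht.subset hv), fun a q hq hne => hp.2 a q (hq.trans ht) ?_⟩
  rintro rfl
  exact hne (hq.eq_of_length (le_antisymm hq.length_le ht.length_le))

theorem isCanonical_cons {V : Type} {canon : V → Clause V} {pick : List V → Clause V}
    {W : Set V} {a y : V} {q : List V} (hp : IsCanonical canon pick W (a :: q))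
    (hlab : clauseLabel canon pick (a :: q) = canon a) (hy : y ∉ W) :
    IsCanonical canon pick W (y :: a :: q) := by
  refine ⟨?_, fun b t ht hne => ?_⟩
  · intro v hv
    rcases List.mem_cons.1 hv with rfl | hv
    · exact hy
    · exact hp.1 v hv
  · rcases List.suffix_cons_iff.1 ht with h | h
    · exact absurd h hne
    · by_cases hb : b :: t = a :: q
      · cases hb
        exact hlab
      · exact hp.2 b t h hb

/-- The part of a canonical path below a node with label `a` is a canonical path of the critical
clause tree of `a`. -/
theorem canonical_transplant {V : Type} {F : Finset (Clause V)} {canon : V → Clause V}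
    {pick : List V → Clause V} (hcanon : IsCanonicalChoice F canon) (hpick : IsClauseChoice F pick)
    {W : Set V} {x a : V} {q : List V} {d : ℕ} (s : List V)
    (hp : s ++ a :: q ∈ level canon pick x d) (hc : IsCanonical canon pick W (s ++ a :: q)) :
    s ++ [a] ∈ level canon pick a s.length ∧ IsCanonical canon pick W (s ++ [a]) := by
  have key : ∀ b t q', b ∈ t → clauseLabel canon pick (t ++ q') = canon b → t.head? = some b →
      clauseLabel canon pick t = canon b := by
    intro b t q' hb hlab hhead
    obtain ⟨b', t, rfl⟩ := List.exists_cons_of_ne_nil (List.ne_nil_of_mem hb)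
    simp only [List.head?_cons, Option.some.injEq] at hhead
    subst hhead
    have h1 := (clauseLabel_spec hcanon hpick (p := b' :: t ++ q') (by simp)).2
    rw [hlab, clauseSat_nodeAssignment_iff] at h1
    have h2 : ¬ ClauseSat (nodeAssignment (b' :: t)) (canon b') := by
      rw [clauseSat_nodeAssignment_iff]
      refine ⟨fun v hv => ?_, fun v hv h => h1.2 v hv (by simp at h ⊢; tauto)⟩
      have := ((hcanon b').2 (v, true)).1 ⟨hv, rfl⟩
      cases this
      simp
    simp [clauseLabel, h2]
  induction s generalizing d with
  | nil =>
    refine ⟨by simp [level], fun v hv => hc.1 v (by simp at hv ⊢; tauto), fun b t ht hne => ?_⟩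
    rcases List.suffix_cons_iff.1 ht with h | h
    · exact absurd h (by simpa using hne)
    · simp at h
  | cons y s ih =>
    obtain ⟨e, rfl⟩ : ∃ e, d = e + 1 := by
      have := length_of_mem_level hp
      simp at this
      exact ⟨d - 1, by omega⟩
    rw [level_succ, Finset.mem_biUnion] at hp
    obtain ⟨u, hu, hz⟩ := hp
    obtain ⟨z', hz1, hz'⟩ := mem_children.1 hz
    obtain ⟨rfl, rfl⟩ := List.cons.inj hz'
    obtain ⟨ih1, ih2⟩ := ih hu (hc.of_suffix (List.suffix_cons _ _))
    obtain ⟨b, t, hbt⟩ : ∃ b t, s ++ [a] = b :: t := by cases s <;> simp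
    have hbt' : s ++ a :: q = b :: (t ++ q) := by
      rw [← List.cons_append, ← hbt]
      simp
    have hl1 : clauseLabel canon pick (s ++ a :: q) = canon b := by
      rw [hbt']
      refine hc.2 b (t ++ q) ?_ ?_
      · rw [← hbt']
        exact List.suffix_cons _ _
      · rw [← hbt']
        intro h
        have := congrArg List.length h
        simp at this
    have hl2 : clauseLabel canon pick (s ++ [a]) = canon b := by
      refine key b (s ++ [a]) q (by simp [hbt]) (by simpa using hl1) (by simp [hbt])
    refine ⟨?_, ?_⟩
    · rw [List.length_cons, level_succ, Finset.mem_biUnion]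
      exact ⟨_, ih1, mem_children.2 ⟨y, by rw [hl2, ← hl1]; exact hz1, rfl⟩⟩
    · rw [List.cons_append, hbt]
      rw [hbt] at ih2 hl2
      exact isCanonical_cons ih2 hl2 (hc.1 y (by simp))

/-! ### Uniform placements and their threshold patterns -/

/-- The uniform distribution on `[0,1]`. -/
noncomputable def unif : Measure ℝ := volume.restrict (Set.Icc (0 : ℝ) 1)

instance : IsProbabilityMeasure unif := ⟨by simp [unif]⟩

/-- The uniform distribution on `[0,1]^V`. -/
noncomputable def cube (V : Type) [Fintype V] : Measure (V → ℝ) := Measure.pi fun _ => unif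

instance (V : Type) [Fintype V] : IsProbabilityMeasure (cube V) := by
  unfold cube; infer_instance

/-- The set of variables placed before `r`, as an indicator function. -/
noncomputable def pat {V : Type} (r : ℝ) (π : V → ℝ) : V → Bool := fun v => decide (π v < r)

/-- The expectation, under a uniform placement, of a function of the pattern at threshold `r`. -/
noncomputable def expect {V : Type} [Fintype V] (r : ℝ) (F : (V → Bool) → ℝ) : ℝ :=
  ∫ π, F (pat r π) ∂cube V

theorem measurePreserving_update {V : Type} [Fintype V] (y : V) :
    MeasurePreserving (fun p : (V → ℝ) × ℝ => Function.update p.1 y p.2)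
      ((cube V).prod unif) (cube V) := by
  have hm : Measurable (fun p : (V → ℝ) × ℝ => Function.update p.1 y p.2) := by
    rw [measurable_pi_iff]
    intro v
    by_cases h : v = y
    · subst h
      simpa using measurable_snd
    · simp only [Function.update_of_ne h]
      fun_prop
  refine ⟨hm, ?_⟩
  symm
  refine Measure.pi_eq fun s hs => ?_
  rw [Measure.map_apply hm (MeasurableSet.univ_pi hs)]
  have : (fun p : (V → ℝ) × ℝ => Function.update p.1 y p.2) ⁻¹' Set.pi Set.univ s =
      (Set.pi Set.univ (Function.update s y Set.univ)) ×ˢ (s y) := by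
    ext ⟨π, t⟩
    simp only [Set.mem_preimage, Set.mem_univ_pi, Set.mem_prod]
    constructor
    · intro h
      refine ⟨fun v => ?_, by simpa using h y⟩
      by_cases hv : v = y
      · subst hv; simp
      · simpa [Function.update_of_ne hv] using h v
    · rintro ⟨h1, h2⟩ v
      by_cases hv : v = y
      · subst hv; simpa using h2
      · simpa [Function.update_of_ne hv] using h1 v
  rw [this, Measure.prod_prod, cube, Measure.pi_pi, ← Finset.mul_prod_erase _ _ (Finset.mem_univ y),
    ← Finset.mul_prod_erase _ (fun i => unif (s i)) (Finset.mem_univ y)]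
  simp only [Function.update_self, measure_univ, one_mul]
  rw [mul_comm]
  congr 1
  refine Finset.prod_congr rfl fun v hv => ?_
  rw [Function.update_of_ne (Finset.ne_of_mem_erase hv)]

theorem integral_resample {V : Type} [Fintype V] (y : V) {f : (V → ℝ) → ℝ}
    (hf : Integrable f (cube V)) :
    ∫ π, f π ∂cube V = ∫ π, ∫ t, f (Function.update π y t) ∂unif ∂cube V := by
  have h := measurePreserving_update (V := V) y
  have hi : Integrable (fun p : (V → ℝ) × ℝ => f (Function.update p.1 y p.2))
      ((cube V).prod unif) := h.integrable_comp_of_integrable hf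
  rw [← integral_prod _ hi]
  conv_lhs => rw [← h.map_eq]
  rw [integral_map h.measurable.aemeasurable]
  rw [h.map_eq]
  exact hf.aestronglyMeasurable

theorem integral_resample' {V : Type} [Fintype V] (y : V) {f : (V → ℝ) → ℝ}
    (hf : Integrable f (cube V)) :
    Integrable (fun t => ∫ π, f (Function.update π y t) ∂cube V) unif ∧
    ∫ π, f π ∂cube V = ∫ t, ∫ π, f (Function.update π y t) ∂cube V ∂unif := by
  have h := measurePreserving_update (V := V) y
  have hi : Integrable (fun p : (V → ℝ) × ℝ => f (Function.update p.1 y p.2))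
      ((cube V).prod unif) := h.integrable_comp_of_integrable hf
  refine ⟨hi.integral_prod_right, ?_⟩
  rw [← integral_prod_symm _ hi]
  conv_lhs => rw [← h.map_eq]
  rw [integral_map h.measurable.aemeasurable]
  rw [h.map_eq]
  exact hf.aestronglyMeasurable

theorem ae_unif : ∀ᵐ t ∂unif, t ∈ Set.Icc (0 : ℝ) 1 := ae_restrict_mem measurableSet_Icc

theorem ae_cube (V : Type) [Fintype V] : ∀ᵐ π ∂cube V, ∀ v, π v ∈ Set.Icc (0 : ℝ) 1 := by
  rw [ae_all_iff]
  intro v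
  have := (measurePreserving_eval (fun _ : V => unif) v).quasiMeasurePreserving.ae ae_unif
  exact this

theorem integrable_cube {V : Type} [Fintype V] {f : (V → ℝ) → ℝ} (hf : Measurable f) (C : ℝ)
    (hC : ∀ π : V → ℝ, (∀ v, π v ∈ Set.Icc (0 : ℝ) 1) → |f π| ≤ C) : Integrable f (cube V) := by
  refine Integrable.of_bound hf.aestronglyMeasurable C ?_
  filter_upwards [ae_cube V] with π hπ
  exact hC π hπ

theorem measurable_pat {V : Type} (r : ℝ) : Measurable (pat r : (V → ℝ) → V → Bool) := by
  rw [measurable_pi_iff]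
  intro v
  have : (fun π : V → ℝ => pat r π v) = fun π => if π v < r then true else false := by
    ext π
    simp [pat]
  rw [this]
  exact Measurable.ite (measurableSet_lt (measurable_pi_apply v) measurable_const)
    measurable_const measurable_const

theorem measurable_comp_pat {V : Type} [Fintype V] (r : ℝ) {β : Type*} [MeasurableSpace β]
    (F : (V → Bool) → β) :
    Measurable fun π : V → ℝ => F (pat r π) :=
  (measurable_of_finite F).comp (measurable_pat r)

theorem integrable_comp_pat {V : Type} [Fintype V] (r : ℝ) (F : (V → Bool) → ℝ) :
    Integrable (fun π : V → ℝ => F (pat r π)) (cube V) :=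
  integrable_cube (measurable_comp_pat r F) (∑ A, |F A|) fun _ _ =>
    Finset.single_le_sum (f := fun A => |F A|) (fun _ _ => abs_nonneg _) (Finset.mem_univ _)

theorem expect_add {V : Type} [Fintype V] (r : ℝ) (F G : (V → Bool) → ℝ) :
    expect r (fun A => F A + G A) = expect r F + expect r G :=
  integral_add (integrable_comp_pat r F) (integrable_comp_pat r G)

theorem expect_sub {V : Type} [Fintype V] (r : ℝ) (F G : (V → Bool) → ℝ) :
    expect r (fun A => F A - G A) = expect r F - expect r G :=
  integral_sub (integrable_comp_pat r F) (integrable_comp_pat r G)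

theorem expect_const_mul {V : Type} [Fintype V] (r c : ℝ) (F : (V → Bool) → ℝ) :
    expect r (fun A => c * F A) = c * expect r F :=
  integral_const_mul c _

theorem expect_sum {V : Type} [Fintype V] {ι : Type*} (r : ℝ) (s : Finset ι)
    (F : ι → (V → Bool) → ℝ) :
    expect r (fun A => ∑ i ∈ s, F i A) = ∑ i ∈ s, expect r (F i) :=
  integral_finsetSum s fun i _ => integrable_comp_pat r (F i)

theorem expect_mono {V : Type} [Fintype V] (r : ℝ) {F G : (V → Bool) → ℝ} (h : ∀ A, F A ≤ G A) :
    expect r F ≤ expect r G :=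
  integral_mono (integrable_comp_pat r F) (integrable_comp_pat r G) fun _ => h _

theorem expect_nonneg {V : Type} [Fintype V] (r : ℝ) {F : (V → Bool) → ℝ} (h : ∀ A, 0 ≤ F A) :
    0 ≤ expect r F :=
  integral_nonneg fun _ => h _

theorem expect_const {V : Type} [Fintype V] (r c : ℝ) : expect (V := V) r (fun _ => c) = c := by
  simp [expect]

theorem integral_unif_ite {r : ℝ} (h0 : 0 ≤ r) (h1 : r ≤ 1) {u v : ℝ → ℝ} (hu : Continuous u)
    (hv : Continuous v) :
    ∫ t, (if t < r then u t else v t) ∂unif = (∫ t in (0 : ℝ)..r, u t) + ∫ t in r..1, v t := by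
  have e : ∫ t, (if t < r then u t else v t) ∂unif =
      ∫ t in (0 : ℝ)..1, (if t < r then u t else v t) := by
    rw [unif, intervalIntegral.integral_of_le zero_le_one, integral_Icc_eq_integral_Ioc]
  have hne : ∀ᵐ t : ℝ, t ≠ r := by
    simp [ae_iff]
  have c1 : ∀ᵐ t : ℝ, t ∈ Set.uIoc 0 r → u t = (if t < r then u t else v t) := by
    filter_upwards [hne] with t ht hr
    rw [Set.uIoc_of_le h0] at hr
    rw [if_pos (lt_of_le_of_ne hr.2 ht)]
  have c2 : ∀ t ∈ Set.uIoc r 1, v t = (if t < r then u t else v t) := by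
    intro t ht
    rw [Set.uIoc_of_le h1] at ht
    rw [if_neg (not_lt.2 ht.1.le)]
  rw [e, ← intervalIntegral.integral_add_adjacent_intervals (b := r),
    ← intervalIntegral.integral_congr_ae c1,
    ← intervalIntegral.integral_congr_ae (Filter.Eventually.of_forall c2)]
  · exact (hu.intervalIntegrable 0 r).congr_ae ((ae_restrict_iff' measurableSet_uIoc).2 c1)
  · exact (hv.intervalIntegrable r 1).congr c2

theorem pat_update {V : Type} (r : ℝ) (π : V → ℝ) (y : V) (t : ℝ) :
    pat r (Function.update π y t) = Function.update (pat r π) y (decide (t < r)) := by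
  ext v
  by_cases h : v = y
  · subst h; simp [pat]
  · simp [pat, Function.update_of_ne h]

theorem expect_resample {V : Type} [Fintype V] {r : ℝ} (h0 : 0 ≤ r) (h1 : r ≤ 1) (y : V)
    (F : (V → Bool) → ℝ) :
    expect r F = expect r fun A =>
      r * F (Function.update A y true) + (1 - r) * F (Function.update A y false) := by
  unfold expect
  rw [integral_resample y (integrable_comp_pat r F)]
  refine integral_congr_ae (Filter.Eventually.of_forall fun π => ?_)
  simp only
  have : ∀ t, F (pat r (Function.update π y t)) = if t < r then
      F (Function.update (pat r π) y true) else F (Function.update (pat r π) y false) := by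
    intro t
    rw [pat_update]
    split_ifs with h <;> simp [h]
  simp only [this]
  rw [integral_unif_ite h0 h1 continuous_const continuous_const]
  simp

/-- A function of real variables that is affine in each of them. -/
def MultiAffine {V : Type} (Q : (V → ℝ) → ℝ) : Prop :=
  ∀ z y t, Q (Function.update z y t) =
    Q (Function.update z y 0) + t * (Q (Function.update z y 1) - Q (Function.update z y 0))

/-- In the expectation of a multi-affine function of independent quantities `ψ y (π y)`, weighted by
a function of the pattern, each of these quantities may be replaced by its conditional expectation
given the pattern. -/
theorem integral_multiAffine {V : Type} [Fintype V] {r : ℝ} (h0 : 0 ≤ r) (h1 : r ≤ 1)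
    {Q : (V → ℝ) → ℝ} (hQ : MultiAffine Q) (hQc : Continuous Q) (ψ : V → ℝ → ℝ)
    (hψ : ∀ y, Continuous (ψ y)) (g : V → Bool → ℝ)
    (hg1 : ∀ y, ∫ t in (0 : ℝ)..r, ψ y t = r * g y true)
    (hg0 : ∀ y, ∫ t in r..1, ψ y t = (1 - r) * g y false) (F : (V → Bool) → ℝ) :
    ∫ π, Q (fun y => ψ y (π y)) * F (pat r π) ∂cube V =
      expect r fun A => Q (fun y => g y (A y)) * F A := by
  let ζ : Finset V → (V → ℝ) → V → ℝ := fun S π y => if y ∈ S then g y (pat r π y) else ψ y (π y)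
  have hζm : ∀ S, Measurable (ζ S) := by
    intro S
    rw [measurable_pi_iff]
    intro y
    by_cases hy : y ∈ S
    · simp only [ζ, if_pos hy]
      exact measurable_comp_pat r fun A => g y (A y)
    · simp only [ζ, if_neg hy]
      exact (hψ y).measurable.comp (measurable_pi_apply y)
  have hM : ∃ M : ℝ, ∀ y, (∀ b, |g y b| ≤ M) ∧ ∀ t ∈ Set.Icc (0 : ℝ) 1, |ψ y t| ≤ M := by
    have : ∀ y, ∃ M : ℝ, (∀ b, |g y b| ≤ M) ∧ ∀ t ∈ Set.Icc (0 : ℝ) 1, |ψ y t| ≤ M := by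
      intro y
      obtain ⟨C, hC⟩ := isCompact_Icc.exists_bound_of_continuousOn
        ((hψ y).continuousOn (s := Set.Icc (0 : ℝ) 1))
      refine ⟨max (max |g y true| |g y false|) C, ?_,
        fun t ht => (hC t ht).trans (le_max_right _ _)⟩
      intro b
      refine le_trans ?_ (le_max_left _ _)
      cases b
      · exact le_max_right _ _
      · exact le_max_left _ _
    choose M hM using this
    refine ⟨∑ y, |M y|, fun y => ?_⟩
    have hy : M y ≤ ∑ y, |M y| := (le_abs_self _).trans
      (Finset.single_le_sum (f := fun y => |M y|) (fun _ _ => abs_nonneg _) (Finset.mem_univ y))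
    exact ⟨fun b => ((hM y).1 b).trans hy, fun t ht => ((hM y).2 t ht).trans hy⟩
  obtain ⟨M, hM⟩ := hM
  obtain ⟨C, hC⟩ := (isCompact_univ_pi fun _ : V => isCompact_Icc (a := -M) (b := M)
    ).exists_bound_of_continuousOn hQc.continuousOn
  have hint : ∀ S, Integrable (fun π => Q (ζ S π) * F (pat r π)) (cube V) := by
    intro S
    refine integrable_cube ((hQc.measurable.comp (hζm S)).mul (measurable_comp_pat r F))
      (C * ∑ A, |F A|) fun π hπ => ?_
    rw [abs_mul]
    have hQC : |Q (ζ S π)| ≤ C := by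
      refine hC _ fun y _ => ?_
      rw [Set.mem_Icc, ← abs_le]
      by_cases hy : y ∈ S
      · simp only [ζ, if_pos hy]
        exact (hM y).1 _
      · simp only [ζ, if_neg hy]
        exact (hM y).2 _ (hπ y)
    exact mul_le_mul hQC (Finset.single_le_sum (f := fun A => |F A|) (fun _ _ => abs_nonneg _)
      (Finset.mem_univ _)) (abs_nonneg _) ((abs_nonneg _).trans hQC)
  have main : ∀ S, ∫ π, Q (ζ ∅ π) * F (pat r π) ∂cube V = ∫ π, Q (ζ S π) * F (pat r π) ∂cube V := by
    intro S
    induction S using Finset.induction_on with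
    | empty => rfl
    | insert y S hy ih =>
      rw [ih, integral_resample y (hint S), integral_resample y (hint (insert y S))]
      refine integral_congr_ae (Filter.Eventually.of_forall fun π => ?_)
      simp only
      have e1 : ∀ t, ζ S (Function.update π y t) = Function.update (ζ S π) y (ψ y t) := by
        intro t
        ext v
        by_cases hv : v = y
        · subst hv
          simp [ζ, hy]
        · simp [ζ, pat, Function.update_of_ne hv]
      have e2 : ∀ t, ζ (insert y S) (Function.update π y t) =
          Function.update (ζ S π) y (g y (decide (t < r))) := by
        intro t
        ext v
        by_cases hv : v = y
        · subst hv
          simp [ζ, pat]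
        · simp [ζ, pat, hv]
      set α := Q (Function.update (ζ S π) y 0) with hα
      set β := Q (Function.update (ζ S π) y 1) - Q (Function.update (ζ S π) y 0) with hβ
      set F1 := F (Function.update (pat r π) y true) with hF1
      set F0 := F (Function.update (pat r π) y false) with hF0
      have e3 : ∀ t, Q (ζ S (Function.update π y t)) * F (pat r (Function.update π y t)) =
          if t < r then (α + ψ y t * β) * F1 else (α + ψ y t * β) * F0 := by
        intro t
        rw [e1, pat_update, hQ]
        split_ifs with h <;> simp [h, α, β, F1, F0]
      have e4 : ∀ t, Q (ζ (insert y S) (Function.update π y t)) *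
          F (pat r (Function.update π y t)) =
          if t < r then (α + g y true * β) * F1 else (α + g y false * β) * F0 := by
        intro t
        rw [e2, pat_update, hQ]
        split_ifs with h <;> simp [h, α, β, F1, F0]
      simp only [e3, e4]
      have hc := hψ y
      rw [integral_unif_ite h0 h1 (by fun_prop) (by fun_prop),
        integral_unif_ite h0 h1 (by fun_prop) (by fun_prop)]
      have i1 : ∀ a b : ℝ, IntervalIntegrable (fun t => ψ y t * β) volume a b := fun a b =>
        (hc.mul continuous_const).intervalIntegrable a b
      simp only [intervalIntegral.integral_mul_const]
      rw [intervalIntegral.integral_add intervalIntegrable_const (i1 _ _),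
        intervalIntegral.integral_add intervalIntegrable_const (i1 _ _)]
      simp only [intervalIntegral.integral_mul_const, hg1, hg0, intervalIntegral.integral_const,
        smul_eq_mul]
      ring
  have := main Finset.univ
  simpa [ζ, expect] using this

/-! ### The density as a multi-affine polynomial -/

/-- The product of the values of `z` at the two endpoints of an edge. -/
noncomputable def edgeProd {V : Type} (z : V → ℝ) (e : Sym2 V) : ℝ :=
  Sym2.lift ⟨fun u v => z u * z v, fun _ _ => mul_comm _ _⟩ e

/-- The sum of the edge products over the edges of a connected component. -/
noncomputable def compSum {V : Type} [Fintype V] (H : SimpleGraph V) (c : H.ConnectedComponent)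
    (z : V → ℝ) : ℝ :=
  ∑ e ∈ H.edgeFinset.filter (fun e => ∀ v ∈ e, v ∈ c.supp), edgeProd z e

/-- The sum of `z` over the neighbours of a vertex. -/
noncomputable def nbrSum {V : Type} [Fintype V] (H : SimpleGraph V) (z : V → ℝ) (a : V) : ℝ :=
  ∑ y, if H.Adj a y then z y else 0

/-- The density of `D` as a polynomial in the values of `φ` and `φ_TwoCC` at the placements. -/
noncomputable def densPoly {V : Type} [Fintype V] (ε : ℝ) (W : Set V) (H : SimpleGraph V)
    (z : V → ℝ) : ℝ :=
  (∏ v ∈ Finset.univ.filter (fun v => v ∈ W), (1 + ε * z v)) *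
    ∏ c : H.ConnectedComponent, (1 + ε * compSum H c z)

theorem sum_ordered_pairs {V : Type} [Fintype V] (H : SimpleGraph V) (c : H.ConnectedComponent)
    (z : V → ℝ) :
    ∑ u, ∑ y, (if u ∈ c.supp ∧ H.Adj u y then z u * z y else 0) = 2 * compSum H c z := by
  rw [← Finset.sum_product', ← Finset.sum_filter, compSum, Finset.mul_sum]
  have hmaps : ∀ p ∈ (Finset.univ ×ˢ Finset.univ : Finset (V × V)).filter
      (fun p => p.1 ∈ c.supp ∧ H.Adj p.1 p.2),
      s(p.1, p.2) ∈ H.edgeFinset.filter (fun e => ∀ v ∈ e, v ∈ c.supp) := by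
    rintro ⟨u, y⟩ h
    simp only [Finset.mem_filter] at h
    have hy : y ∈ c.supp := by
      have h1 := h.2.1
      rw [SimpleGraph.ConnectedComponent.mem_supp_iff] at h1 ⊢
      rw [← h1, SimpleGraph.ConnectedComponent.eq]
      exact h.2.2.symm.reachable
    simp only [Finset.mem_filter, SimpleGraph.mem_edgeFinset, SimpleGraph.mem_edgeSet]
    refine ⟨h.2.2, fun v hv => ?_⟩
    rcases Sym2.mem_iff.1 hv with rfl | rfl
    · exact h.2.1
    · exact hy
  rw [← Finset.sum_fiberwise_of_maps_to hmaps]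
  refine Finset.sum_congr rfl fun e he => ?_
  induction e with
  | _ u y =>
  simp only [Finset.mem_filter, SimpleGraph.mem_edgeFinset, SimpleGraph.mem_edgeSet] at he
  have hne := he.1.ne
  have hset : ((Finset.univ ×ˢ Finset.univ : Finset (V × V)).filter
      (fun p => p.1 ∈ c.supp ∧ H.Adj p.1 p.2)).filter (fun p => s(p.1, p.2) = s(u, y)) =
      {(u, y), (y, u)} := by
    ext ⟨a, b⟩
    simp only [Finset.mem_filter, Finset.mem_product, Finset.mem_univ, Sym2.eq_iff,
      Finset.mem_insert, Finset.mem_singleton, Prod.mk.injEq, true_and]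
    constructor
    · exact fun h => h.2
    · rintro (⟨rfl, rfl⟩ | ⟨rfl, rfl⟩)
      · exact ⟨⟨he.2 _ (Sym2.mem_mk_left _ _), he.1⟩, Or.inl ⟨rfl, rfl⟩⟩
      · exact ⟨⟨he.2 _ (Sym2.mem_mk_right _ _), he.1.symm⟩, Or.inr ⟨rfl, rfl⟩⟩
  rw [hset, Finset.sum_pair (by simp [hne])]
  simp only [edgeProd, Sym2.lift_mk]
  ring

theorem compSum_eq {V : Type} [Fintype V] (H : SimpleGraph V) (c : H.ConnectedComponent)
    (z : V → ℝ) :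
    compSum H c z = 1 / 2 * ∑ u, ∑ y, (if u ∈ c.supp ∧ H.Adj u y then z u * z y else 0) := by
  rw [sum_ordered_pairs]
  ring

theorem mem_supp_of_adj {V : Type} {H : SimpleGraph V} {c : H.ConnectedComponent} {u y : V}
    (h : H.Adj u y) : u ∈ c.supp ↔ y ∈ c.supp := by
  rw [SimpleGraph.ConnectedComponent.mem_supp_iff, SimpleGraph.ConnectedComponent.mem_supp_iff,
    SimpleGraph.ConnectedComponent.eq.2 h.reachable]

theorem compSum_update {V : Type} [Fintype V] (H : SimpleGraph V) (c : H.ConnectedComponent)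
    (z : V → ℝ) (a : V) (t : ℝ) :
    compSum H c (Function.update z a t) = compSum H c (Function.update z a 0) +
      if a ∈ c.supp then t * nbrSum H z a else 0 := by
  set z0 := Function.update z a 0 with hz0
  have hz0a : z0 a = 0 := by simp [z0]
  have hz : ∀ u, Function.update z a t u = z0 u + if u = a then t else 0 := by
    intro u
    by_cases h : u = a
    · subst h; simp [z0]
    · simp [z0, h]
  have hn : nbrSum H z a = ∑ y, if H.Adj a y then z0 y else 0 := by
    refine Finset.sum_congr rfl fun y _ => ?_
    split_ifs with h
    · rw [hz0, Function.update_of_ne h.ne']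
    · rfl
  have key : ∀ u y, (if u ∈ c.supp ∧ H.Adj u y then
      Function.update z a t u * Function.update z a t y else 0) =
      (if u ∈ c.supp ∧ H.Adj u y then z0 u * z0 y else 0) +
      ((if u = a then (if a ∈ c.supp ∧ H.Adj a y then t * z0 y else 0) else 0) +
      (if y = a then (if a ∈ c.supp ∧ H.Adj a u then t * z0 u else 0) else 0)) := by
    intro u y
    by_cases h : u ∈ c.supp ∧ H.Adj u y
    · rw [if_pos h, if_pos h, hz, hz]
      have h' := (mem_supp_of_adj (c := c) h.2).1 h.1
      have hne := h.2.ne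
      by_cases hu : u = a
      · subst hu
        rw [if_pos rfl, if_pos rfl, if_neg (Ne.symm hne), if_neg (Ne.symm hne), if_pos h, hz0a]
        ring
      · by_cases hy : y = a
        · subst hy
          rw [if_pos rfl, if_pos rfl, if_neg hu, if_neg hu, if_pos ⟨h', h.2.symm⟩, hz0a]
          ring
        · simp [hu, hy]
    · rw [if_neg h, if_neg h]
      by_cases hu : u = a
      · subst hu
        rw [if_pos rfl, if_neg h]
        by_cases hy : y = u
        · subst hy
          simp
        · simp [hy]
      · by_cases hy : y = a
        · subst hy
          have : ¬ (y ∈ c.supp ∧ H.Adj y u) := fun h' =>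
            h ⟨(mem_supp_of_adj h'.2).1 h'.1, h'.2.symm⟩
          rw [if_neg hu, if_pos rfl, if_neg this]
          simp
        · simp [hu, hy]
  rw [compSum_eq, compSum_eq]
  simp only [key, Finset.sum_add_distrib]
  have s1 : ∑ u, ∑ y, (if u = a then (if a ∈ c.supp ∧ H.Adj a y then t * z0 y else 0) else 0) =
      ∑ y, (if a ∈ c.supp ∧ H.Adj a y then t * z0 y else 0) := by
    rw [Finset.sum_comm]
    simp
  have s2 : ∑ u, ∑ y, (if y = a then (if a ∈ c.supp ∧ H.Adj a u then t * z0 u else 0) else 0) =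
      ∑ y, (if a ∈ c.supp ∧ H.Adj a y then t * z0 y else 0) := by
    simp
  have s3 : ∑ y, (if a ∈ c.supp ∧ H.Adj a y then t * z0 y else 0) =
      if a ∈ c.supp then t * nbrSum H z a else 0 := by
    by_cases ha : a ∈ c.supp
    · simp only [ha, true_and, if_true, hn, Finset.mul_sum, mul_ite, mul_zero]
    · simp [ha]
  rw [s1, s2, s3]
  ring

theorem compSum_update_of_notMem {V : Type} [Fintype V] {H : SimpleGraph V}
    {c : H.ConnectedComponent} {a : V} (ha : a ∉ c.supp) (z : V → ℝ) (t : ℝ) :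
    compSum H c (Function.update z a t) = compSum H c z := by
  have h1 := compSum_update H c z a t
  have h2 := compSum_update H c z a (z a)
  rw [Function.update_eq_self] at h2
  rw [h1, h2, if_neg ha, if_neg ha]

theorem nbrSum_eq_zero {V : Type} [Fintype V] {W : Set V} {H : SimpleGraph V}
    (hW : ∀ u y, H.Adj u y → u ∉ W) {a : V} (ha : a ∈ W) (z : V → ℝ) : nbrSum H z a = 0 :=
  Finset.sum_eq_zero fun y _ => if_neg fun h => hW a y h ha

/-- The factors of the density that do not involve a variable `a` in `W`. -/
noncomputable def restW {V : Type} [Fintype V] (ε : ℝ) (W : Set V) (H : SimpleGraph V) (a : V)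
    (z : V → ℝ) : ℝ :=
  (∏ v ∈ (Finset.univ.filter (fun v => v ∈ W)).erase a, (1 + ε * z v)) *
    ∏ c : H.ConnectedComponent, (1 + ε * compSum H c z)

/-- The factors of the density that do not involve the connected component of `a`. -/
noncomputable def restC {V : Type} [Fintype V] (ε : ℝ) (W : Set V) (H : SimpleGraph V) (a : V)
    (z : V → ℝ) : ℝ :=
  (∏ v ∈ Finset.univ.filter (fun v => v ∈ W), (1 + ε * z v)) *
    ∏ c ∈ Finset.univ.erase (H.connectedComponentMk a), (1 + ε * compSum H c z)

theorem densPoly_update_of_mem {V : Type} [Fintype V] {ε : ℝ} {W : Set V} {H : SimpleGraph V}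
    (hW : ∀ u y, H.Adj u y → u ∉ W) {a : V} (ha : a ∈ W) (z : V → ℝ) (t : ℝ) :
    densPoly ε W H (Function.update z a t) = (1 + ε * t) * restW ε W H a z := by
  have h2 : ∀ c, compSum H c (Function.update z a t) = compSum H c z := by
    intro c
    have h1 := compSum_update H c z a t
    have h2 := compSum_update H c z a (z a)
    rw [Function.update_eq_self] at h2
    rw [h1, h2]
    simp [nbrSum_eq_zero hW ha]
  rw [densPoly, restW, ← Finset.mul_prod_erase _ _ (by simpa using ha : a ∈ Finset.univ.filter _),
    Function.update_self, mul_assoc]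
  simp only [h2]
  congr 2
  refine Finset.prod_congr rfl fun v hv => ?_
  rw [Function.update_of_ne (Finset.ne_of_mem_erase hv)]

theorem prod_W_update {V : Type} [Fintype V] {ε : ℝ} {W : Set V} {a : V} (ha : a ∉ W)
    (z : V → ℝ) (t : ℝ) :
    ∏ v ∈ Finset.univ.filter (fun v => v ∈ W), (1 + ε * Function.update z a t v) =
      ∏ v ∈ Finset.univ.filter (fun v => v ∈ W), (1 + ε * z v) := by
  refine Finset.prod_congr rfl fun v hv => ?_
  rw [Function.update_of_ne]
  rintro rfl
  exact ha (Finset.mem_filter.1 hv).2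

theorem restC_update {V : Type} [Fintype V] {ε : ℝ} {W : Set V} {H : SimpleGraph V}
    {a y : V} (hy : y ∉ W) (hya : y ∈ (H.connectedComponentMk a).supp) (z : V → ℝ) (t : ℝ) :
    restC ε W H a (Function.update z y t) = restC ε W H a z := by
  unfold restC
  rw [prod_W_update hy]
  congr 1
  refine Finset.prod_congr rfl fun c hc => ?_
  rw [compSum_update_of_notMem]
  intro h
  rw [SimpleGraph.ConnectedComponent.mem_supp_iff] at h hya
  exact Finset.ne_of_mem_erase hc (h.symm.trans hya)

theorem densPoly_eq_restC {V : Type} [Fintype V] (ε : ℝ) (W : Set V) (H : SimpleGraph V)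
    (a : V) (z : V → ℝ) :
    densPoly ε W H z = restC ε W H a z * (1 + ε * compSum H (H.connectedComponentMk a) z) := by
  rw [densPoly, restC, ← Finset.mul_prod_erase _ _ (Finset.mem_univ (H.connectedComponentMk a))]
  ring

theorem densPoly_update_of_notMem {V : Type} [Fintype V] {ε : ℝ} {W : Set V} {H : SimpleGraph V}
    {a : V} (ha : a ∉ W) (z : V → ℝ) (t : ℝ) :
    densPoly ε W H (Function.update z a t) = restC ε W H a z *
      (1 + ε * compSum H (H.connectedComponentMk a) (Function.update z a 0) +
        ε * (t * nbrSum H z a)) := by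
  rw [densPoly_eq_restC ε W H a, restC_update ha (by simp), compSum_update,
    if_pos (by simp)]
  ring

theorem multiAffine_densPoly {V : Type} [Fintype V] {ε : ℝ} {W : Set V} {H : SimpleGraph V}
    (hW : ∀ u y, H.Adj u y → u ∉ W) : MultiAffine (densPoly ε W H) := by
  intro z y t
  by_cases hy : y ∈ W
  · simp only [densPoly_update_of_mem hW hy]
    ring
  · simp only [densPoly_update_of_notMem hy]
    ring

theorem continuous_densPoly {V : Type} [Fintype V] (ε : ℝ) (W : Set V) (H : SimpleGraph V) :
    Continuous (densPoly ε W H) := by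
  unfold densPoly
  simp only [compSum_eq]
  refine Continuous.mul (by fun_prop) ?_
  refine continuous_finsetProd _ fun c _ => ?_
  refine continuous_const.add (continuous_const.mul (continuous_const.mul ?_))
  refine continuous_finsetSum _ fun u _ => continuous_finsetSum _ fun y _ => ?_
  split_ifs <;> fun_prop

theorem densityD_eq {V : Type} [Fintype V] {ε : ℝ} {W : Set V} {H : SimpleGraph V}
    (hW : ∀ u y, H.Adj u y → u ∉ W) (π : V → ℝ) :
    densityD ε W H π =
      densPoly ε W H fun v => if v ∈ W then phiTwo (π v) else phi (π v) := by
  unfold densityD densPoly compSum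
  congr 1
  · refine Finset.prod_congr rfl fun v hv => ?_
    simp only [if_pos (Finset.mem_filter.1 hv).2]
  · refine Finset.prod_congr rfl fun c _ => ?_
    congr 2
    refine Finset.sum_congr rfl fun e he => ?_
    induction e with
    | _ u y =>
    simp only [Finset.mem_filter, SimpleGraph.mem_edgeFinset, SimpleGraph.mem_edgeSet] at he
    simp only [edgeTerm, edgeProd, Sym2.lift_mk, if_neg (hW _ _ he.1), if_neg (hW _ _ he.1.symm)]

theorem sum_adj_le {V : Type} [Fintype V] {H : SimpleGraph V}
    (hdeg : ∀ v, (H.neighborSet v).ncard ≤ 2) (v : V) {B : ℝ} (hB : 0 ≤ B) :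
    ∑ y, (if H.Adj v y then B else 0) ≤ 2 * B := by
  rw [← Finset.sum_filter, Finset.sum_const, nsmul_eq_mul]
  have : ((Finset.univ.filter (H.Adj v)).card : ℝ) ≤ 2 := by
    have h := hdeg v
    rw [Set.ncard_eq_toFinset_card'] at h
    have e : (H.neighborSet v).toFinset = Finset.univ.filter (H.Adj v) := by ext; simp
    rw [e] at h
    exact_mod_cast h
  exact mul_le_mul_of_nonneg_right this hB

/-- A lower bound on the edge sum of a component, in which the value at the vertex `x` may be
larger than the other ones. -/
theorem compSum_ge {V : Type} [Fintype V] {H : SimpleGraph V}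
    (hdeg : ∀ v, (H.neighborSet v).ncard ≤ 2) {c : H.ConnectedComponent}
    (hc : c.supp.ncard ≤ 23) {z : V → ℝ} {x : V} {B₁ B₂ : ℝ} (h1 : 0 ≤ B₁) (h2 : 0 ≤ B₂)
    (hz1 : ∀ u y, H.Adj u y → u ≠ x → y ≠ x → -B₁ ≤ z u * z y)
    (hz2 : ∀ y, H.Adj x y → -B₂ ≤ z x * z y) :
    -(23 * B₁ + 2 * B₂) ≤ compSum H c z := by
  rw [compSum_eq]
  have key : ∀ u y, -((if u ∈ c.supp then (if H.Adj u y then B₁ else 0) else 0) +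
      ((if u = x then (if H.Adj x y then B₂ else 0) else 0) +
       (if y = x then (if H.Adj x u then B₂ else 0) else 0))) ≤
      if u ∈ c.supp ∧ H.Adj u y then z u * z y else 0 := by
    intro u y
    by_cases h : u ∈ c.supp ∧ H.Adj u y
    · rw [if_pos h, if_pos h.1, if_pos h.2]
      by_cases hu : u = x
      · subst hu
        have := hz2 y h.2
        rw [if_pos rfl, if_pos h.2, if_neg h.2.ne']
        linarith
      · by_cases hy : y = x
        · subst hy
          have := hz2 u h.2.symm
          rw [if_neg hu, if_pos rfl, if_pos h.2.symm]
          linarith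
        · have := hz1 u y h.2 hu hy
          rw [if_neg hu, if_neg hy]
          linarith
    · rw [if_neg h, neg_nonpos]
      refine add_nonneg ?_ (add_nonneg ?_ ?_) <;> split_ifs <;> first | exact h1 | exact h2 | rfl
  have hsum := Finset.sum_le_sum fun u (_ : u ∈ Finset.univ) =>
    Finset.sum_le_sum fun y (_ : y ∈ Finset.univ) => key u y
  simp only [Finset.sum_neg_distrib, Finset.sum_add_distrib] at hsum
  have b1 : ∑ u, ∑ y, (if u ∈ c.supp then (if H.Adj u y then B₁ else 0) else 0) ≤
      23 * (2 * B₁) := by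
    calc ∑ u, ∑ y, (if u ∈ c.supp then (if H.Adj u y then B₁ else 0) else 0)
        ≤ ∑ u, (if u ∈ c.supp then 2 * B₁ else 0) := by
          refine Finset.sum_le_sum fun u _ => ?_
          split_ifs
          · exact sum_adj_le hdeg u h1
          · simp
      _ = c.supp.ncard * (2 * B₁) := by
          rw [← Finset.sum_filter, Finset.sum_const, nsmul_eq_mul, Set.ncard_eq_toFinset_card']
          congr 3
          ext
          simp
      _ ≤ 23 * (2 * B₁) := by
          refine mul_le_mul_of_nonneg_right ?_ (by positivity)
          exact_mod_cast hc
  have b2 : ∑ u, ∑ y, (if u = x then (if H.Adj x y then B₂ else 0) else 0) ≤ 2 * B₂ := by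
    rw [Finset.sum_comm]
    simpa using sum_adj_le hdeg x h2
  have b3 : ∑ u, ∑ y, (if y = x then (if H.Adj x u then B₂ else 0) else 0) ≤ 2 * B₂ := by
    simpa using sum_adj_le hdeg x h2
  linarith

/-! ### The law of the pattern when one variable is placed at `r` -/

/-- The data that determine the law of the pattern of a placement drawn from `D`, conditional on
`x` being placed at `r`: `φx`, `γ` and `γ₂` stand for the values at `r` of `φ`, `γ` and
`γ_TwoCC`, and `w` is a lower bound on the density of a component. -/
structure Slice (V : Type) where
  /-- the strength of the correlations -/
  ε : ℝ
  /-- the place of `x` -/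
  r : ℝ
  /-- the value of `φ` at `r` -/
  φx : ℝ
  /-- the value of `γ` at `r` -/
  γ : ℝ
  /-- the value of `γ_TwoCC` at `r` -/
  γ₂ : ℝ
  /-- a lower bound on the conditional density of a component -/
  w : ℝ
  /-- the set `TwoCC` -/
  W : Set V
  /-- the graph `H_low` -/
  H : SimpleGraph V
  /-- the root variable -/
  x : V

namespace Slice

variable {V : Type}

/-- The conditional expectation of `φ (π y)` (or `φ_TwoCC (π y)`), given whether `y` is placed
before `r`. -/
noncomputable def val (D : Slice V) (y : V) (b : Bool) : ℝ :=
  if y = D.x then D.φx else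
    if b then (if y ∈ D.W then D.γ₂ else D.γ) / D.r
    else -((if y ∈ D.W then D.γ₂ else D.γ) / (1 - D.r))

/-- The conditional expectations for all variables, given the pattern. -/
noncomputable def z (D : Slice V) (A : V → Bool) : V → ℝ := fun y => D.val y (A y)

/-- The density of the pattern with respect to the uniform placement. -/
noncomputable def wt [Fintype V] (D : Slice V) (A : V → Bool) : ℝ := densPoly D.ε D.W D.H (D.z A)

/-- The loss in the probability that `a` is placed before `r`, given that the variables on the
path `q` are not. -/
noncomputable def loss (D : Slice V) (a : V) (q : List V) : ℝ :=
  D.ε * D.γ * ((q.toFinset.filter fun u => u ≠ D.x ∧ D.H.Adj a u).card * (D.γ / (1 - D.r)) +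
    if D.H.Adj a D.x then max 0 (-D.φx) else 0) / D.w

/-- A lower bound on the probability that the label of a node is placed before `r`, given that the
labels of its proper ancestors are not. -/
noncomputable def pr (D : Slice V) : List V → ℝ
  | [] => 0
  | a :: q => if a ∈ D.W then D.r + D.ε * D.γ₂ else D.r - D.loss a q

/-- The properties of the data that are used. -/
structure Valid [Fintype V] (D : Slice V) : Prop where
  r_pos : 0 < D.r
  r_lt_one : D.r < 1
  ε_nonneg : 0 ≤ D.ε
  γ_nonneg : 0 ≤ D.γ
  γ₂_nonneg : 0 ≤ D.γ₂
  w_pos : 0 < D.w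
  root_notMem : D.x ∉ D.W
  notMem_of_adj : ∀ u y, D.H.Adj u y → u ∉ D.W
  γ₂_le : D.ε * D.γ₂ ≤ 1 - D.r
  le_comp : ∀ c A, D.w ≤ 1 + D.ε * compSum D.H c (D.z A)
  le_comp_update : ∀ c A a, D.w ≤ 1 + D.ε * compSum D.H c (Function.update (D.z A) a 0)

end Slice

/-- The indicator function of the event that all labels on a path, apart from the root variable
`x`, are not placed before `r`. -/
noncomputable def unplaced {V : Type} (x : V) (q : List V) (A : V → Bool) : ℝ :=
  if ∀ v ∈ q, v ≠ x → A v = false then 1 else 0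

theorem unplaced_nonneg {V : Type} (x : V) (q : List V) (A : V → Bool) : 0 ≤ unplaced x q A := by
  unfold unplaced; split_ifs <;> simp

theorem unplaced_update {V : Type} {x y : V} {q : List V} (hy : y ∉ q) (A : V → Bool) (b : Bool) :
    unplaced x q (Function.update A y b) = unplaced x q A := by
  have h : ∀ v ∈ q, v ≠ y := fun v hv => by rintro rfl; exact hy hv
  unfold unplaced
  congr 1
  refine propext (forall₂_congr fun v hv => ?_)
  rw [Function.update_of_ne (h v hv)]

theorem update_false_le_true {V : Type} (A : V → Bool) (y : V) :
    Function.update A y false ≤ Function.update A y true := by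
  intro v
  by_cases h : v = y
  · subst h; simp
  · simp [h]

/-- The indicator function of a variable being placed before `r`. -/
noncomputable def placed {V : Type} (a : V) (A : V → Bool) : ℝ := if A a then 1 else 0

namespace Slice

variable {V : Type}

theorem z_update (D : Slice V) (A : V → Bool) (y : V) (b : Bool) :
    D.z (Function.update A y b) = Function.update (D.z A) y (D.val y b) := by
  ext v
  by_cases h : v = y
  · subst h; simp [z]
  · simp [z, h]

variable [Fintype V] {D : Slice V}

theorem Valid.factor_nonneg (hD : D.Valid) {v : V} (hv : v ∈ D.W) (A : V → Bool) :
    0 ≤ 1 + D.ε * D.z A v := by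
  have hvx : v ≠ D.x := by
    rintro rfl
    exact hD.root_notMem hv
  have h1 : 0 < 1 - D.r := by linarith [hD.r_lt_one]
  simp only [z, val, if_neg hvx, if_pos hv]
  split_ifs
  · have := div_nonneg hD.γ₂_nonneg hD.r_pos.le
    have := mul_nonneg hD.ε_nonneg this
    linarith
  · have : D.ε * D.γ₂ / (1 - D.r) ≤ 1 := (div_le_one h1).2 hD.γ₂_le
    have e : D.ε * -(D.γ₂ / (1 - D.r)) = -(D.ε * D.γ₂ / (1 - D.r)) := by ring
    rw [e]
    linarith

theorem Valid.restC_nonneg (hD : D.Valid) (a : V) (A : V → Bool) :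
    0 ≤ restC D.ε D.W D.H a (D.z A) :=
  mul_nonneg (Finset.prod_nonneg fun _ hv => hD.factor_nonneg (Finset.mem_filter.1 hv).2 A)
    (Finset.prod_nonneg fun c _ => hD.w_pos.le.trans (hD.le_comp c A))

theorem Valid.restW_nonneg (hD : D.Valid) (a : V) (A : V → Bool) :
    0 ≤ restW D.ε D.W D.H a (D.z A) :=
  mul_nonneg (Finset.prod_nonneg fun _ hv =>
      hD.factor_nonneg (Finset.mem_filter.1 (Finset.mem_of_mem_erase hv)).2 A)
    (Finset.prod_nonneg fun c _ => hD.w_pos.le.trans (hD.le_comp c A))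

theorem Valid.wt_nonneg (hD : D.Valid) (A : V → Bool) : 0 ≤ D.wt A := by
  rw [wt, densPoly_eq_restC _ _ _ D.x]
  exact mul_nonneg (hD.restC_nonneg _ A) (hD.w_pos.le.trans (hD.le_comp _ A))

/-- A variable of `TwoCC` is placed before `r` with probability at least `r + ε γ_TwoCC(r)`,
independently of everything else. -/
theorem Valid.placed_of_mem (hD : D.Valid) {a : V} {q : List V} (ha : a ∈ D.W) (haq : a ∉ q)
    {Φ : (V → Bool) → ℝ} (hΦ : Monotone Φ) :
    (D.r + D.ε * D.γ₂) * expect D.r (fun A => unplaced D.x q A * Φ A * D.wt A) ≤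
      expect D.r (fun A => unplaced D.x q A * Φ A * D.wt A * placed a A) := by
  have hax : a ≠ D.x := by
    rintro rfl
    exact hD.root_notMem ha
  have h1 : 0 < 1 - D.r := by linarith [hD.r_lt_one]
  set p := D.r + D.ε * D.γ₂ with hp
  have hp0 : 0 ≤ p := add_nonneg hD.r_pos.le (mul_nonneg hD.ε_nonneg hD.γ₂_nonneg)
  have hp1 : 0 ≤ 1 - p := by linarith [hD.γ₂_le]
  rw [← expect_const_mul, ← sub_nonneg, ← expect_sub,
    expect_resample hD.r_pos.le hD.r_lt_one.le a]
  refine expect_nonneg _ fun A => ?_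
  have hv1 : D.val a true = D.γ₂ / D.r := by simp [val, hax, ha]
  have hv0 : D.val a false = -(D.γ₂ / (1 - D.r)) := by simp [val, hax, ha]
  simp only [unplaced_update haq, wt, z_update, densPoly_update_of_mem hD.notMem_of_adj ha, hv1,
    hv0, placed, Function.update_self]
  simp only [if_true, Bool.false_eq_true, if_false]
  set R := restW D.ε D.W D.H a (D.z A)
  have hR : 0 ≤ R := hD.restW_nonneg a A
  have hU := unplaced_nonneg D.x q A
  have hm := hΦ (update_false_le_true A a)
  set U := unplaced D.x q A
  set Φ1 := Φ (Function.update A a true)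
  set Φ0 := Φ (Function.update A a false)
  have e1 : D.r * (1 + D.ε * (D.γ₂ / D.r)) = p := by
    have := hD.r_pos.ne'
    rw [hp]; field_simp
  have e0 : (1 - D.r) * (1 + D.ε * (-(D.γ₂ / (1 - D.r)))) = 1 - p := by
    have := h1.ne'
    rw [hp]; field_simp; ring
  have : D.r * (U * Φ1 * ((1 + D.ε * (D.γ₂ / D.r)) * R) * 1 -
        p * (U * Φ1 * ((1 + D.ε * (D.γ₂ / D.r)) * R))) +
      (1 - D.r) * (U * Φ0 * ((1 + D.ε * (-(D.γ₂ / (1 - D.r)))) * R) * 0 -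
        p * (U * Φ0 * ((1 + D.ε * (-(D.γ₂ / (1 - D.r)))) * R))) =
      p * (1 - p) * (U * R) * (Φ1 - Φ0) := by
    linear_combination (U * R * Φ1 * (1 - p)) * e1 - (p * U * Φ0 * R) * e0
  rw [this]
  exact mul_nonneg (mul_nonneg (mul_nonneg hp0 hp1) (mul_nonneg hU hR)) (sub_nonneg.2 hm)

/-- The correlation with a neighbour that is not on the path can only help: the event under
consideration is monotone in that neighbour. -/
theorem Valid.expect_neighbour_nonneg (hD : D.Valid) {a y : V} {q : List V} (hay : D.H.Adj a y)
    (hyq : y ∉ q) (hyx : y ≠ D.x) {Φ : (V → Bool) → ℝ} (hΦ : Monotone Φ) :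
    0 ≤ expect D.r (fun A => unplaced D.x q A * Φ (Function.update A a false) *
      restC D.ε D.W D.H a (D.z A) * D.z A y) := by
  have hyW : y ∉ D.W := hD.notMem_of_adj y a hay.symm
  have h1 : 0 < 1 - D.r := by linarith [hD.r_lt_one]
  have hys : y ∈ (D.H.connectedComponentMk a).supp := by
    rw [← mem_supp_of_adj hay]
    simp
  rw [expect_resample hD.r_pos.le hD.r_lt_one.le y]
  refine expect_nonneg _ fun A => ?_
  have hv1 : D.val y true = D.γ / D.r := by simp [val, hyx, hyW]
  have hv0 : D.val y false = -(D.γ / (1 - D.r)) := by simp [val, hyx, hyW]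
  simp only [unplaced_update hyq, z_update, restC_update hyW hys, Function.update_self, hv1, hv0]
  have hR := hD.restC_nonneg a A
  have hU := unplaced_nonneg D.x q A
  set R := restC D.ε D.W D.H a (D.z A)
  set U := unplaced D.x q A
  have hm : Φ (Function.update (Function.update A y false) a false) ≤
      Φ (Function.update (Function.update A y true) a false) := by
    refine hΦ ?_
    rw [Function.update_comm hay.ne', Function.update_comm hay.ne']
    exact update_false_le_true _ _
  set Φ1 := Φ (Function.update (Function.update A y true) a false)
  set Φ0 := Φ (Function.update (Function.update A y false) a false)
  have e1 : D.r * (D.γ / D.r) = D.γ := mul_div_cancel₀ _ hD.r_pos.ne'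
  have e0 : (1 - D.r) * (D.γ / (1 - D.r)) = D.γ := mul_div_cancel₀ _ h1.ne'
  have : D.r * (U * Φ1 * R * (D.γ / D.r)) + (1 - D.r) * (U * Φ0 * R * -(D.γ / (1 - D.r))) =
      U * R * D.γ * (Φ1 - Φ0) := by
    linear_combination (U * R * Φ1) * e1 - (U * R * Φ0) * e0
  rw [this]
  exact mul_nonneg (mul_nonneg (mul_nonneg hU hR) hD.γ_nonneg) (sub_nonneg.2 hm)

/-- The neighbours of `a` that lie on the path, or are the root, cost at most `loss`; the others
are kept. -/
theorem Valid.nbrSum_ge (hD : D.Valid) (a : V) {q : List V} {A : V → Bool}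
    (hA : ∀ v ∈ q, v ≠ D.x → A v = false) :
    -(D.loss a q * D.w) + D.ε * D.γ * ∑ y ∈ Finset.univ.filter
        (fun y => D.H.Adj a y ∧ y ∉ q ∧ y ≠ D.x), D.z A y ≤
      D.ε * D.γ * nbrSum D.H (D.z A) a := by
  have hl : D.loss a q * D.w = D.ε * D.γ *
      ((q.toFinset.filter fun u => u ≠ D.x ∧ D.H.Adj a u).card * (D.γ / (1 - D.r)) +
        if D.H.Adj a D.x then max 0 (-D.φx) else 0) := by
    rw [loss, div_mul_cancel₀ _ hD.w_pos.ne']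
  rw [hl, ← mul_neg, ← mul_add]
  refine mul_le_mul_of_nonneg_left ?_ (mul_nonneg hD.ε_nonneg hD.γ_nonneg)
  have e1 : (q.toFinset.filter fun u => u ≠ D.x ∧ D.H.Adj a u) =
      Finset.univ.filter (fun y => D.H.Adj a y ∧ y ∈ q ∧ y ≠ D.x) := by
    ext y
    simp only [Finset.mem_filter, List.mem_toFinset, Finset.mem_univ, true_and]
    tauto
  have e2 : ∑ y ∈ Finset.univ.filter (fun y => D.H.Adj a y ∧ y ∈ q ∧ y ≠ D.x), D.z A y =
      -((Finset.univ.filter (fun y => D.H.Adj a y ∧ y ∈ q ∧ y ≠ D.x)).card *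
        (D.γ / (1 - D.r))) := by
    rw [Finset.sum_congr rfl (g := fun _ => -(D.γ / (1 - D.r)))]
    · rw [Finset.sum_const, nsmul_eq_mul]
      ring
    · intro y hy
      have hy := (Finset.mem_filter.1 hy).2
      simp [z, val, hy.2.2, hA y hy.2.1 hy.2.2, hD.notMem_of_adj y a hy.1.symm]
  have e3 : nbrSum D.H (D.z A) a = (if D.H.Adj a D.x then D.φx else 0) +
      (∑ y ∈ Finset.univ.filter (fun y => D.H.Adj a y ∧ y ∈ q ∧ y ≠ D.x), D.z A y +
       ∑ y ∈ Finset.univ.filter (fun y => D.H.Adj a y ∧ y ∉ q ∧ y ≠ D.x), D.z A y) := by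
    have : (if D.H.Adj a D.x then D.φx else 0) =
        ∑ y, if y = D.x then (if D.H.Adj a D.x then D.φx else 0) else 0 := by simp
    rw [nbrSum, this, Finset.sum_filter, Finset.sum_filter, ← Finset.sum_add_distrib,
      ← Finset.sum_add_distrib]
    refine Finset.sum_congr rfl fun y _ => ?_
    by_cases hyx : y = D.x
    · rw [hyx]
      simp [z, val]
    · by_cases hy : D.H.Adj a y <;> by_cases hq : y ∈ q <;> simp [hyx, hy, hq]
  rw [e3, e2, e1]
  have : -(if D.H.Adj a D.x then max 0 (-D.φx) else 0) ≤ if D.H.Adj a D.x then D.φx else 0 := by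
    split_ifs
    · have := le_max_right 0 (-D.φx)
      linarith
    · simp
  linarith

/-- Given that the labels on the path are not placed before `r`, a variable outside `TwoCC` is
placed before `r` with probability at least `r - loss`, even when weighted with a monotone
function. -/
theorem Valid.placed_of_notMem (hD : D.Valid) {a : V} {q : List V} (ha : a ∉ D.W) (haq : a ∉ q)
    (hax : a ≠ D.x) {Φ : (V → Bool) → ℝ} (hΦ : Monotone Φ) (hΦ0 : ∀ A, 0 ≤ Φ A)
    (hl0 : 0 ≤ D.loss a q) :
    (D.r - D.loss a q) * expect D.r (fun A => unplaced D.x q A * Φ A * D.wt A) ≤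
      expect D.r (fun A => unplaced D.x q A * Φ A * D.wt A * placed a A) := by
  have h1 : 0 < 1 - D.r := by linarith [hD.r_lt_one]
  set δ := D.loss a q with hδ
  rw [← expect_const_mul, ← sub_nonneg, ← expect_sub,
    expect_resample hD.r_pos.le hD.r_lt_one.le a]
  have hv1 : D.val a true = D.γ / D.r := by simp [val, hax, ha]
  have hv0 : D.val a false = -(D.γ / (1 - D.r)) := by simp [val, hax, ha]
  simp only [unplaced_update haq, wt, z_update, densPoly_update_of_notMem ha, hv1,
    hv0, placed, Function.update_self]
  simp only [if_true, Bool.false_eq_true, if_false]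
  have hnb : 0 ≤ expect D.r (fun A => D.ε * D.γ * ∑ y ∈ Finset.univ.filter
      (fun y => D.H.Adj a y ∧ y ∉ q ∧ y ≠ D.x), unplaced D.x q A *
        Φ (Function.update A a false) * restC D.ε D.W D.H a (D.z A) * D.z A y) := by
    rw [expect_const_mul, expect_sum]
    refine mul_nonneg (mul_nonneg hD.ε_nonneg hD.γ_nonneg) (Finset.sum_nonneg fun y hy => ?_)
    have hy := (Finset.mem_filter.1 hy).2
    exact hD.expect_neighbour_nonneg hy.1 hy.2.1 hy.2.2 hΦ
  refine hnb.trans (expect_mono _ fun A => ?_)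
  rw [← Finset.mul_sum]
  have hR : 0 ≤ restC D.ε D.W D.H a (D.z A) := hD.restC_nonneg a A
  have hm := hΦ (update_false_le_true A a)
  have hΦ0' := hΦ0 (Function.update A a false)
  have hw := hD.le_comp_update (D.H.connectedComponentMk a) A a
  have hw1 := hD.le_comp (D.H.connectedComponentMk a) (Function.update A a true)
  rw [z_update, compSum_update, if_pos (by simp), hv1] at hw1
  set R := restC D.ε D.W D.H a (D.z A)
  set Φ1 := Φ (Function.update A a true)
  set Φ0 := Φ (Function.update A a false)
  set s := nbrSum D.H (D.z A) a with hs
  set S := compSum D.H (D.H.connectedComponentMk a) (Function.update (D.z A) a 0)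
  by_cases hA : ∀ v ∈ q, v ≠ D.x → A v = false
  · have hU : unplaced D.x q A = 1 := if_pos hA
    have hn := hD.nbrSum_ge a hA
    rw [hU]
    set N := ∑ y ∈ Finset.univ.filter (fun y => D.H.Adj a y ∧ y ∉ q ∧ y ≠ D.x), D.z A y
    have e1 : D.r * (D.γ / D.r) = D.γ := mul_div_cancel₀ _ hD.r_pos.ne'
    have e0 : (1 - D.r) * (D.γ / (1 - D.r)) = D.γ := mul_div_cancel₀ _ h1.ne'
    have hX : 0 ≤ D.r * (1 + D.ε * S) + D.ε * D.γ * s := by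
      have : D.r * (1 + D.ε * S) + D.ε * D.γ * s =
          D.r * (1 + D.ε * (S + D.γ / D.r * s)) := by linear_combination (-D.ε * s) * e1
      rw [this]
      exact mul_nonneg hD.r_pos.le (hD.w_pos.le.trans hw1)
    have hlow : D.ε * D.γ * N ≤ δ * (1 + D.ε * S) + D.ε * D.γ * s := by
      have := mul_le_mul_of_nonneg_left hw hl0
      linarith
    have hmain : D.r * (1 * Φ1 * (R * (1 + D.ε * S + D.ε * (D.γ / D.r * s))) * 1 -
          (D.r - δ) * (1 * Φ1 * (R * (1 + D.ε * S + D.ε * (D.γ / D.r * s))))) +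
        (1 - D.r) * (1 * Φ0 * (R * (1 + D.ε * S + D.ε * (-(D.γ / (1 - D.r)) * s))) * 0 -
          (D.r - δ) * (1 * Φ0 * (R * (1 + D.ε * S + D.ε * (-(D.γ / (1 - D.r)) * s))))) =
        R * Φ0 * (δ * (1 + D.ε * S) + D.ε * D.γ * s) +
          R * (Φ1 - Φ0) * (1 - (D.r - δ)) * (D.r * (1 + D.ε * S) + D.ε * D.γ * s) := by
      linear_combination (R * Φ1 * (1 - (D.r - δ)) * D.ε * s) * e1 +
        (R * Φ0 * (D.r - δ) * D.ε * s) * e0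
    rw [hmain]
    have t1 : 0 ≤ R * (Φ1 - Φ0) * (1 - (D.r - δ)) *
        (D.r * (1 + D.ε * S) + D.ε * D.γ * s) :=
      mul_nonneg (mul_nonneg (mul_nonneg hR (sub_nonneg.2 hm)) (by linarith)) hX
    have t2 := mul_le_mul_of_nonneg_left hlow (mul_nonneg hR hΦ0')
    linarith
  · have hU : unplaced D.x q A = 0 := if_neg hA
    rw [hU]
    simp

/-- The pattern density integrates to one. -/
theorem Valid.expect_wt (hD : D.Valid) : expect D.r D.wt = 1 := by
  have h1 : 0 < 1 - D.r := by linarith [hD.r_lt_one]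
  set m : V → ℝ := fun y => if y = D.x then D.φx else 0 with hm
  have hval : ∀ y, D.r * D.val y true + (1 - D.r) * D.val y false = m y := by
    intro y
    by_cases hyx : y = D.x
    · simp only [val, hm, if_pos hyx]
      ring
    · simp only [val, hm, if_neg hyx, if_true, Bool.false_eq_true, if_false]
      set c := if y ∈ D.W then D.γ₂ else D.γ
      linear_combination mul_div_cancel₀ c hD.r_pos.ne' - mul_div_cancel₀ c h1.ne'
  have key : ∀ S : Finset V, expect D.r (fun A => densPoly D.ε D.W D.H
      (fun y => if y ∈ S then m y else D.z A y)) = expect D.r D.wt := by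
    intro S
    induction S using Finset.induction_on with
    | empty => simp only [Finset.notMem_empty, if_false]; rfl
    | insert y S hy ih =>
      rw [← ih, expect_resample hD.r_pos.le hD.r_lt_one.le y, eq_comm,
        expect_resample hD.r_pos.le hD.r_lt_one.le y]
      congr 1
      ext A
      have e1 : ∀ b, (fun v => if v ∈ S then m v else D.z (Function.update A y b) v) =
          Function.update (fun v => if v ∈ S then m v else D.z A v) y (D.val y b) := by
        intro b
        ext v
        by_cases hv : v = y
        · subst hv; simp [hy, z]
        · simp [z, hv]
      have e2 : ∀ b, (fun v => if v ∈ insert y S then m v else D.z (Function.update A y b) v) =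
          Function.update (fun v => if v ∈ S then m v else D.z A v) y (m y) := by
        intro b
        ext v
        by_cases hv : v = y
        · subst hv; simp
        · simp [z, hv]
      rw [e1, e1, e2, e2]
      have hQ := multiAffine_densPoly (ε := D.ε) hD.notMem_of_adj
      rw [hQ _ y (D.val y true), hQ _ y (D.val y false), hQ _ y (m y), ← hval y]
      ring
  rw [← key Finset.univ]
  have hz : (fun A : V → Bool => densPoly D.ε D.W D.H
      (fun y => if y ∈ (Finset.univ : Finset V) then m y else D.z A y)) = fun _ => 1 := by
    ext A
    simp only [Finset.mem_univ, if_true]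
    have hc : ∀ c, compSum D.H c m = 0 := by
      intro c
      rw [compSum_eq]
      simp only [mul_eq_zero]
      right
      refine Finset.sum_eq_zero fun u _ => Finset.sum_eq_zero fun y _ => ?_
      split_ifs with h
      · have := h.2.ne
        by_cases hu : u = D.x
        · have : y ≠ D.x := fun h' => this (hu.trans h'.symm)
          simp [m, this]
        · simp [m, hu]
      · rfl
    rw [densPoly]
    simp only [hc, mul_zero, add_zero, Finset.prod_const_one, mul_one]
    refine Finset.prod_eq_one fun v hv => ?_
    have : v ≠ D.x := by
      rintro rfl
      exact hD.root_notMem (Finset.mem_filter.1 hv).2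
    simp [m, this]
  rw [hz, expect_const]

end Slice

/-! ### The recursive lower bound for the cut probability -/

/-- The indicator function of the event that the label of a node is placed before `r`. -/
noncomputable def headPlaced {V : Type} : List V → (V → Bool) → ℝ
  | [], _ => 0
  | a :: _, A => placed a A

/-- The indicator function of the event that every path of length `k` down from a node meets a
variable placed before `r` (the label of the node itself counts). -/
noncomputable def cutInd {V : Type} (ch : List V → Finset (List V)) :
    ℕ → List V → (V → Bool) → ℝ
  | 0, p, A => headPlaced p A
  | k + 1, p, A => headPlaced p A + (1 - headPlaced p A) * ∏ w ∈ ch p, cutInd ch k w A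

/-- The probability of `cutInd` if all nodes had independent labels, the label of a node `p` being
placed before `r` with probability `D.pr p`. -/
noncomputable def Slice.cutBound {V : Type} (D : Slice V) (ch : List V → Finset (List V)) :
    ℕ → List V → ℝ
  | 0, p => D.pr p
  | k + 1, p => D.pr p + (1 - D.pr p) * ∏ w ∈ ch p, D.cutBound ch k w

section

variable {V : Type}

theorem headPlaced_mem (p : List V) (A : V → Bool) : headPlaced p A = 0 ∨ headPlaced p A = 1 := by
  cases p with
  | nil => exact Or.inl rfl
  | cons a q =>
    simp only [headPlaced, placed]
    split_ifs <;> simp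

theorem headPlaced_mono (p : List V) : Monotone (headPlaced p) := by
  intro A B h
  cases p with
  | nil => exact le_rfl
  | cons a q =>
    simp only [headPlaced, placed]
    have := h a
    cases hA : A a
    · rw [if_neg Bool.false_ne_true]
      split_ifs <;> simp
    · rw [hA] at this
      simp [Bool.eq_true_of_true_le this]

theorem cutInd_mem (ch : List V → Finset (List V)) (k : ℕ) (p : List V) (A : V → Bool) :
    0 ≤ cutInd ch k p A ∧ cutInd ch k p A ≤ 1 := by
  induction k generalizing p with
  | zero => rcases headPlaced_mem p A with h | h <;> simp [cutInd, h]
  | succ k ih =>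
    have h0 : 0 ≤ ∏ w ∈ ch p, cutInd ch k w A := Finset.prod_nonneg fun w _ => (ih w).1
    have h1 : ∏ w ∈ ch p, cutInd ch k w A ≤ 1 :=
      Finset.prod_le_one (fun w _ => (ih w).1) fun w _ => (ih w).2
    rcases headPlaced_mem p A with h | h <;> simp [cutInd, h, h0, h1]

theorem cutInd_mono (ch : List V → Finset (List V)) (k : ℕ) (p : List V) :
    Monotone (cutInd ch k p) := by
  induction k generalizing p with
  | zero => exact headPlaced_mono p
  | succ k ih =>
    intro A B h
    have hp := headPlaced_mono p h
    have hm : ∏ w ∈ ch p, cutInd ch k w A ≤ ∏ w ∈ ch p, cutInd ch k w B :=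
      Finset.prod_le_prod (fun w _ => (cutInd_mem ch k w A).1) fun w _ => ih w h
    have h1 : ∏ w ∈ ch p, cutInd ch k w A ≤ 1 :=
      Finset.prod_le_one (fun w _ => (cutInd_mem ch k w A).1) fun w _ => (cutInd_mem ch k w A).2
    simp only [cutInd]
    rcases headPlaced_mem p A with ha | ha <;> rcases headPlaced_mem p B with hb | hb <;>
      rw [ha, hb] at hp ⊢ <;> linarith

end

namespace Slice

variable {V : Type} {D : Slice V} {ch : List V → Finset (List V)} {T : List V → Prop}

theorem cutBound_mem (hT : ∀ p, T p → ∀ w ∈ ch p, T w)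
    (hpr : ∀ p, T p → 0 ≤ D.pr p ∧ D.pr p ≤ 1) (k : ℕ) {p : List V} (hp : T p) :
    0 ≤ D.cutBound ch k p ∧ D.cutBound ch k p ≤ 1 := by
  induction k generalizing p with
  | zero => exact hpr p hp
  | succ k ih =>
    have h0 : 0 ≤ ∏ w ∈ ch p, D.cutBound ch k w :=
      Finset.prod_nonneg fun w hw => (ih (hT p hp w hw)).1
    have h1 : ∏ w ∈ ch p, D.cutBound ch k w ≤ 1 :=
      Finset.prod_le_one (fun w hw => (ih (hT p hp w hw)).1) fun w hw => (ih (hT p hp w hw)).2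
    obtain ⟨p0, p1⟩ := hpr p hp
    simp only [cutBound]
    constructor <;> nlinarith

theorem Valid.loss_nonneg [Fintype V] (hD : D.Valid) (a : V) (q : List V) : 0 ≤ D.loss a q := by
  have h1 : 0 ≤ 1 - D.r := by linarith [hD.r_lt_one]
  refine div_nonneg (mul_nonneg (mul_nonneg hD.ε_nonneg hD.γ_nonneg) (add_nonneg
    (mul_nonneg (Nat.cast_nonneg _) (div_nonneg hD.γ_nonneg h1)) ?_)) hD.w_pos.le
  split_ifs
  · exact le_max_left _ _
  · exact le_rfl

theorem Valid.head_placed [Fintype V] (hD : D.Valid) {a : V} {q : List V} (haq : a ∉ q)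
    (hax : a ≠ D.x) {Φ : (V → Bool) → ℝ} (hΦ : Monotone Φ) (hΦ0 : ∀ A, 0 ≤ Φ A) :
    D.pr (a :: q) * expect D.r (fun A => unplaced D.x q A * Φ A * D.wt A) ≤
      expect D.r (fun A => unplaced D.x q A * Φ A * D.wt A * placed a A) := by
  simp only [pr]
  split_ifs with ha
  · exact hD.placed_of_mem ha haq hΦ
  · exact hD.placed_of_notMem ha haq hax hΦ hΦ0 (hD.loss_nonneg a q)

theorem expect_prod_ge [Fintype V] {k : ℕ} {p : List V} (s : Finset (List V))
    (hs : ∀ w ∈ s, ∃ y, w = y :: p)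
    (hs0 : ∀ w ∈ s, 0 ≤ D.cutBound ch k w)
    (ih : ∀ y, y :: p ∈ s → ∀ Φ : (V → Bool) → ℝ, Monotone Φ → (∀ A, 0 ≤ Φ A) →
      D.cutBound ch k (y :: p) * expect D.r (fun A => unplaced D.x p A * Φ A * D.wt A) ≤
      expect D.r (fun A => unplaced D.x p A * Φ A * D.wt A * cutInd ch k (y :: p) A))
    {Φ : (V → Bool) → ℝ} (hΦ : Monotone Φ) (hΦ0 : ∀ A, 0 ≤ Φ A) :
    (∏ w ∈ s, D.cutBound ch k w) * expect D.r (fun A => unplaced D.x p A * Φ A * D.wt A) ≤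
      expect D.r (fun A => unplaced D.x p A * Φ A * D.wt A * ∏ w ∈ s, cutInd ch k w A) := by
  induction s using Finset.induction_on with
  | empty => simp
  | insert w s hw ihs =>
    obtain ⟨y, rfl⟩ := hs w (Finset.mem_insert_self _ _)
    have h1 := ihs (fun w h => hs w (Finset.mem_insert_of_mem h))
      (fun w h => hs0 w (Finset.mem_insert_of_mem h))
      (fun y h => ih y (Finset.mem_insert_of_mem h))
    have hmono : Monotone fun A => Φ A * ∏ w ∈ s, cutInd ch k w A := by
      intro A B h
      refine mul_le_mul (hΦ h) (Finset.prod_le_prod (fun w _ => (cutInd_mem ch k w A).1)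
        fun w _ => cutInd_mono ch k w h) (Finset.prod_nonneg fun w _ => (cutInd_mem ch k w A).1)
        (hΦ0 B)
    have h2 := ih y (Finset.mem_insert_self _ _) _ hmono fun A =>
      mul_nonneg (hΦ0 A) (Finset.prod_nonneg fun w _ => (cutInd_mem ch k w A).1)
    have h3 := mul_le_mul_of_nonneg_left h1 (hs0 _ (Finset.mem_insert_self _ _))
    rw [Finset.prod_insert hw, mul_assoc]
    refine h3.trans ?_
    refine le_trans (le_of_eq ?_) (h2.trans (le_of_eq ?_))
    · congr 1
      congr 1
      ext A
      ring
    · congr 1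
      ext A
      rw [Finset.prod_insert hw]
      ring

/-- Conditional on the labels of the proper ancestors not being placed before `r`, the part of the
tree below a node is cut at least as often as in a tree with independent labels, even when
weighted with a monotone function. -/
theorem expect_cutInd_ge [Fintype V] (hD : D.Valid)
    (hT : ∀ p, T p → ∀ w ∈ ch p, T w)
    (hpr : ∀ p, T p → 0 ≤ D.pr p ∧ D.pr p ≤ 1)
    (hT1 : ∀ p, T p → ∃ a q, p = a :: q ∧ a ∉ q ∧ a ≠ D.x)
    (hch : ∀ p, T p → ∀ w ∈ ch p, ∃ y, w = y :: p)
    (k : ℕ) {a : V} {q : List V} (hp : T (a :: q)) {Φ : (V → Bool) → ℝ} (hΦ : Monotone Φ)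
    (hΦ0 : ∀ A, 0 ≤ Φ A) :
    D.cutBound ch k (a :: q) * expect D.r (fun A => unplaced D.x q A * Φ A * D.wt A) ≤
      expect D.r (fun A => unplaced D.x q A * Φ A * D.wt A * cutInd ch k (a :: q) A) := by
  induction k generalizing a q Φ with
  | zero =>
    obtain ⟨a', q', he, h1, h2⟩ := hT1 _ hp
    cases he
    exact hD.head_placed h1 h2 hΦ hΦ0
  | succ k ih =>
    obtain ⟨a', q', he, haq, hax⟩ := hT1 _ hp
    cases he
    have hhead := hD.head_placed haq hax hΦ hΦ0
    have hprod := expect_prod_ge (D := D) (ch := ch) (k := k) (p := a :: q) (ch (a :: q))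
      (hch _ hp)
      (fun w hw => (cutBound_mem hT hpr k (hT _ hp w hw)).1)
      (fun y hy Ψ hΨ hΨ0 => ih (hT _ hp _ hy) hΨ hΨ0) hΦ hΦ0
    set ℓ := ∏ w ∈ ch (a :: q), D.cutBound ch k w with hℓ
    have hℓ1 : ℓ ≤ 1 := Finset.prod_le_one
      (fun w hw => (cutBound_mem hT hpr k (hT _ hp w hw)).1)
      (fun w hw => (cutBound_mem hT hpr k (hT _ hp w hw)).2)
    have hun : ∀ A, unplaced D.x (a :: q) A = unplaced D.x q A * (1 - placed a A) := by
      intro A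
      simp only [unplaced, placed, List.forall_mem_cons]
      by_cases h1 : ∀ v ∈ q, v ≠ D.x → A v = false
      · cases hA : A a
        · rw [if_pos ⟨fun _ => rfl, h1⟩, if_pos h1]; simp
        · rw [if_neg fun h => by simpa using h.1 hax]; simp
      · rw [if_neg fun h => h1 h.2, if_neg h1]; simp
    have e1 : expect D.r (fun A => unplaced D.x (a :: q) A * Φ A * D.wt A) =
        expect D.r (fun A => unplaced D.x q A * Φ A * D.wt A) -
        expect D.r (fun A => unplaced D.x q A * Φ A * D.wt A * placed a A) := by
      rw [← expect_sub]
      congr 1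
      ext A
      rw [hun]
      ring
    have e2 : expect D.r (fun A => unplaced D.x q A * Φ A * D.wt A *
          cutInd ch (k + 1) (a :: q) A) =
        expect D.r (fun A => unplaced D.x q A * Φ A * D.wt A * placed a A) +
        expect D.r (fun A => unplaced D.x (a :: q) A * Φ A * D.wt A *
          ∏ w ∈ ch (a :: q), cutInd ch k w A) := by
      rw [← expect_add]
      congr 1
      ext A
      rw [hun]
      simp only [cutInd, headPlaced]
      ring
    rw [e2]
    rw [e1] at hprod
    have e3 : D.cutBound ch (k + 1) (a :: q) = D.pr (a :: q) + (1 - D.pr (a :: q)) * ℓ := rfl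
    rw [e3]
    have := mul_le_mul_of_nonneg_left hhead (sub_nonneg.2 hℓ1)
    linarith

/-- The lower bound at the root. -/
theorem expect_root_ge [Fintype V] (hD : D.Valid)
    (hT : ∀ p, T p → ∀ w ∈ ch p, T w)
    (hpr : ∀ p, T p → 0 ≤ D.pr p ∧ D.pr p ≤ 1)
    (hT1 : ∀ p, T p → ∃ a q, p = a :: q ∧ a ∉ q ∧ a ≠ D.x)
    (hch : ∀ p, T p → ∀ w ∈ ch p, ∃ y, w = y :: p)
    (hroot : ∀ w ∈ ch [D.x], T w ∧ ∃ y, w = [y, D.x]) (k : ℕ) :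
    ∏ w ∈ ch [D.x], D.cutBound ch k w ≤
      expect D.r (fun A => D.wt A * ∏ w ∈ ch [D.x], cutInd ch k w A) := by
  have hprod := expect_prod_ge (D := D) (ch := ch) (k := k) (p := [D.x]) (ch [D.x])
      (fun w hw => (hroot w hw).2)
      (fun w hw => (cutBound_mem hT hpr k (hroot w hw).1).1)
      (fun y hy Ψ hΨ hΨ0 => expect_cutInd_ge hD hT hpr hT1 hch k (hroot _ hy).1 hΨ hΨ0)
      (Φ := fun _ => 1) monotone_const (fun _ => zero_le_one)
  have hun : ∀ A, unplaced D.x [D.x] A = 1 := by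
    intro A
    simp [unplaced]
  simp only [hun, one_mul] at hprod
  have := hD.expect_wt
  rw [show expect D.r (fun A => D.wt A) = 1 from this, mul_one] at hprod
  exact hprod

end Slice

/-- If no path variable of a node is placed before `r` and the part of the tree below it is not cut,
then the part of the tree below the root is not cut. -/
theorem prod_cutInd_eq_zero {V : Type} {canon : V → Clause V} {pick : List V → Clause V} {x : V}
    {A : V → Bool} {d k : ℕ} {p : List V} (hp : p ∈ level canon pick x (d + 1))
    (hA : ∀ v ∈ p.dropLast, A v = false) (h0 : cutInd (children canon pick) k p A = 0) :
    ∏ w ∈ children canon pick [x], cutInd (children canon pick) (k + d) w A = 0 := by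
  induction d generalizing k p with
  | zero =>
    rw [level_succ, Finset.mem_biUnion] at hp
    obtain ⟨q, hq, hp⟩ := hp
    rw [level, Finset.mem_singleton] at hq
    subst hq
    exact Finset.prod_eq_zero hp h0
  | succ d ih =>
    rw [level_succ, Finset.mem_biUnion] at hp
    obtain ⟨q, hq, hp⟩ := hp
    obtain ⟨y, -, rfl⟩ := mem_children.1 hp
    have hlen := length_of_mem_level hq
    obtain ⟨a, b, q, rfl⟩ : ∃ a b t, q = a :: b :: t := by
      rcases q with _ | ⟨a, _ | ⟨b, t⟩⟩
      · simp at hlen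
      · simp at hlen
      · exact ⟨a, b, t, rfl⟩
    have := ih (k := k + 1) hq (fun v hv => hA v (by simp at hv ⊢; tauto)) (by
      have hAa : A a = false := hA a (by simp)
      have hz : ∏ w ∈ children canon pick (a :: b :: q), cutInd (children canon pick) k w A = 0 :=
        Finset.prod_eq_zero (f := fun w => cutInd (children canon pick) k w A) hp h0
      simp [cutInd, headPlaced, placed, hAa, hz])
    rwa [show k + (d + 1) = k + 1 + d by omega]

/-! ### Comparison with the infinite binary tree with independent labels -/

namespace Slice

variable {V : Type}

/-- The loss caused by one pair of adjacent labels on a path, neither of them the root. -/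
noncomputable def pairLoss (D : Slice V) : ℝ := D.ε * D.γ * (D.γ / (1 - D.r)) / D.w

/-- The loss caused by a label adjacent to the root variable. -/
noncomputable def rootLoss (D : Slice V) : ℝ := D.ε * D.γ * max 0 (-D.φx) / D.w

theorem loss_eq (D : Slice V) (a : V) (q : List V) :
    D.loss a q = (q.toFinset.filter fun u => u ≠ D.x ∧ D.H.Adj a u).card * D.pairLoss +
      if D.H.Adj a D.x then D.rootLoss else 0 := by
  unfold loss pairLoss rootLoss
  split_ifs <;> ring

/-- The estimates on a slice with `r < 1/2` behind the comparison with the infinite binary tree.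
There, a node is placed before `r` or has both its subtrees cut with probability `P`. The number
`E₁` bounds the total loss below a node caused by adjacent labels other than the root, `E₂` the
loss caused by one neighbour of the root, and `ρ` is the rate at which the influence of the
leaves decays. The factor `51/50` absorbs the second-order terms. -/
structure Budget (D : Slice V) (P E₁ E₂ ρ : ℝ) : Prop where
  P_eq : (1 - D.r) * P = D.r
  P_pos : 0 < P
  P_le : P ≤ 1
  r_pos : 0 < D.r
  E₁_nonneg : 0 ≤ E₁
  E₂_nonneg : 0 ≤ E₂
  pairLoss_nonneg : 0 ≤ D.pairLoss
  rootLoss_nonneg : 0 ≤ D.rootLoss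
  two_r_le : 2 * D.r ≤ 1
  pair_le : 2 * D.pairLoss * ((1 - P ^ 2) * (51 / 50)) + 2 * D.r * E₁ ≤ E₁
  root_le : D.rootLoss * ((1 - P ^ 2) * (51 / 50)) ≤ E₂
  gain : 2 * D.r * (E₁ + 2 * E₂) ≤ D.ε * D.γ₂ * (1 - P ^ 2)
  gain_nonneg : 0 ≤ D.ε * D.γ₂
  gain_le : D.r + D.ε * D.γ₂ ≤ 1
  second_order : 2 * P * (E₁ + 2 * E₂) ≤ 1 / 50 * (1 - P ^ 2)
  small : 2 * (E₁ + 2 * E₂) ≤ P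
  small' : 2 * (E₁ + 2 * E₂) ≤ 1 - P
  rate : 2 * (D.r + (2 * D.pairLoss + D.rootLoss) * P) ≤ ρ
  loss_le : 2 * D.pairLoss + D.rootLoss ≤ D.r

end Slice

section

variable {V : Type} {D : Slice V} {P E₁ E₂ ρ : ℝ}

theorem prod_ge_of_card_eq_two {ι : Type*} {s : Finset ι} (hs : s.card = 2) {L e : ι → ℝ}
    {P Λ : ℝ} (hP : 0 ≤ P) (hΛ : 0 ≤ Λ) (he : ∀ i ∈ s, 0 ≤ e i) (hL : ∀ i ∈ s, 0 ≤ L i)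
    (h : ∀ i ∈ s, P - e i - Λ ≤ L i) :
    P ^ 2 - P * ∑ i ∈ s, e i - 2 * P * Λ ≤ ∏ i ∈ s, L i := by
  obtain ⟨i, j, hij, rfl⟩ := Finset.card_eq_two.1 hs
  rw [Finset.sum_pair hij, Finset.prod_pair hij]
  have hi := h i (by simp)
  have hj := h j (by simp)
  have ei := he i (by simp)
  have ej := he j (by simp)
  have Li := hL i (by simp)
  have Lj := hL j (by simp)
  by_cases h1 : P - e i - Λ ≤ 0
  · have h2 := mul_nonneg hP (sub_nonneg.2 h1)
    have h3 := mul_nonneg hP (add_nonneg ej hΛ)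
    have h4 := mul_nonneg Li Lj
    nlinarith
  · by_cases h2 : P - e j - Λ ≤ 0
    · have h2 := mul_nonneg hP (sub_nonneg.2 h2)
      have h3 := mul_nonneg hP (add_nonneg ei hΛ)
      have h4 := mul_nonneg Li Lj
      nlinarith
    · push Not at h1 h2
      have h3 := mul_le_mul hi hj h2.le Li
      have h4 := mul_nonneg (add_nonneg ei hΛ) (add_nonneg ej hΛ)
      nlinarith

/-- A node with at most one child is cut with a probability that exceeds the one for two children
by more than any loss. -/
theorem prod_ge_of_card_le_one {ι : Type*} {s : Finset ι} (hs : s.card ≤ 1) {L : ι → ℝ}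
    {P E Λ : ℝ} (hP : 0 ≤ P) (hP1 : P ≤ 1) (hΛ : 0 ≤ Λ) (hE : 2 * E ≤ P)
    (hE' : 2 * E ≤ 1 - P) (hL : ∀ i ∈ s, 0 ≤ L i) (h : ∀ i ∈ s, P - E - Λ ≤ L i) :
    P ^ 2 - 2 * P * Λ ≤ ∏ i ∈ s, L i := by
  rcases Nat.le_one_iff_eq_zero_or_eq_one.1 hs with h0 | h1
  · rw [Finset.card_eq_zero] at h0
    subst h0
    rw [Finset.prod_empty]
    nlinarith [mul_nonneg hP hΛ]
  · obtain ⟨i, rfl⟩ := Finset.card_eq_one.1 h1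
    rw [Finset.prod_singleton]
    have hi := h i (by simp)
    have Li := hL i (by simp)
    by_cases h2 : P ≤ 2 * Λ
    · nlinarith
    · push Not at h2
      by_cases h3 : 1 ≤ 2 * P
      · nlinarith [mul_nonneg hΛ (sub_nonneg.2 h3), mul_nonneg (sub_nonneg.2 h3) (sub_nonneg.2 hP1)]
      · push Not at h3
        nlinarith [mul_nonneg (sub_nonneg.2 h2.le) (sub_nonneg.2 h3.le)]

theorem Slice.Budget.fixed (hB : D.Budget P E₁ E₂ ρ) : D.r + (1 - D.r) * P ^ 2 = P := by
  linear_combination (P - 1) * hB.P_eq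

theorem Slice.Budget.total_nonneg (hB : D.Budget P E₁ E₂ ρ) : 0 ≤ E₁ + 2 * E₂ := by
  linarith [hB.E₁_nonneg, hB.E₂_nonneg]

theorem Slice.Budget.one_sub_nonneg (hB : D.Budget P E₁ E₂ ρ) : 0 ≤ 1 - P ^ 2 := by
  nlinarith [hB.P_pos, hB.P_le]

/-- The cut bound at a node outside `TwoCC`. -/
theorem Slice.Budget.node_loss (hB : D.Budget P E₁ E₂ ρ) {δ ℓ X Λ : ℝ} (hδ : 0 ≤ δ)
    (hδ' : δ ≤ 2 * D.pairLoss + D.rootLoss)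
    (hΛ : 0 ≤ Λ) (h1 : P ^ 2 - P * X - 2 * P * Λ ≤ ℓ)
    (h2 : P ^ 2 - P * (2 * (E₁ + 2 * E₂)) - 2 * P * Λ ≤ ℓ) :
    P - (δ * ((1 - P ^ 2) * (51 / 50)) + D.r * X) - ρ * Λ ≤
      (D.r - δ) + (1 - (D.r - δ)) * ℓ := by
  have hr1 : 0 ≤ 1 - D.r := by linarith [hB.two_r_le, hB.r_pos]
  have e1 := mul_le_mul_of_nonneg_left h1 hr1
  have e2 := mul_le_mul_of_nonneg_left h2 hδ
  have e3 := mul_le_mul_of_nonneg_left hB.second_order hδ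
  have e4 := mul_le_mul_of_nonneg_right hB.rate hΛ
  have e5 := mul_le_mul_of_nonneg_right (mul_le_mul_of_nonneg_right hδ' hB.P_pos.le) hΛ
  have e6 : (1 - D.r) * (P ^ 2 - P * X - 2 * P * Λ) = P - D.r - D.r * X - 2 * D.r * Λ := by
    linear_combination hB.fixed - (X + 2 * Λ) * hB.P_eq
  nlinarith

/-- The gain at a variable of `TwoCC` makes up for all losses below it. -/
theorem Slice.Budget.node_gain (hB : D.Budget P E₁ E₂ ρ) {ℓ Λ : ℝ}
    (hΛ : 0 ≤ Λ) (h2 : P ^ 2 - P * (2 * (E₁ + 2 * E₂)) - 2 * P * Λ ≤ ℓ) :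
    P - ρ * Λ ≤ (D.r + D.ε * D.γ₂) + (1 - (D.r + D.ε * D.γ₂)) * ℓ := by
  have e1 := mul_le_mul_of_nonneg_left h2 (sub_nonneg.2 hB.gain_le)
  set g := D.ε * D.γ₂
  have e6 : (1 - D.r) * (P ^ 2 - P * (2 * (E₁ + 2 * E₂)) - 2 * P * Λ) =
      P - D.r - 2 * D.r * (E₁ + 2 * E₂) - 2 * D.r * Λ := by
    linear_combination hB.fixed - (2 * (E₁ + 2 * E₂) + 2 * Λ) * hB.P_eq
  have e7 := hB.gain
  have e8 : 0 ≤ g * (P * (2 * (E₁ + 2 * E₂)) + 2 * P * Λ) := mul_nonneg hB.gain_nonneg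
    (add_nonneg (mul_nonneg hB.P_pos.le (by linarith [hB.total_nonneg]))
      (mul_nonneg (by linarith [hB.P_pos]) hΛ))
  have e9 : 2 * D.r ≤ ρ := by
    have := mul_nonneg (by linarith [hB.pairLoss_nonneg, hB.rootLoss_nonneg] :
      0 ≤ 2 * D.pairLoss + D.rootLoss) hB.P_pos.le
    linarith [hB.rate]
  have e10 := mul_le_mul_of_nonneg_right e9 hΛ
  nlinarith

theorem Slice.Budget.prod_ge (hB : D.Budget P E₁ E₂ ρ) {s : Finset (List V)} (hs : s.card ≤ 2)
    {L e : List V → ℝ} {E Λ : ℝ} (hΛ : 0 ≤ Λ) (hE : E ≤ E₁ + 2 * E₂)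
    (hL : ∀ i ∈ s, 0 ≤ L i) (h : ∀ i ∈ s, P - E - Λ ≤ L i) (he : ∀ i ∈ s, 0 ≤ e i)
    (h' : ∀ i ∈ s, P - e i - Λ ≤ L i) :
    P ^ 2 - P * ∑ i ∈ s, e i - 2 * P * Λ ≤ ∏ i ∈ s, L i := by
  rcases Nat.lt_or_ge 1 s.card with h1 | h1
  · exact prod_ge_of_card_eq_two (le_antisymm hs h1) hB.P_pos.le hΛ he hL h'
  · have := prod_ge_of_card_le_one h1 hB.P_pos.le hB.P_le hΛ
      (by linarith [hB.small]) (by linarith [hB.small']) hL h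
    have h3 := mul_nonneg hB.P_pos.le (Finset.sum_nonneg he)
    linarith

theorem Slice.Budget.prod_ge_const (hB : D.Budget P E₁ E₂ ρ) {s : Finset (List V)} (hs : s.card ≤ 2)
    {L : List V → ℝ} {E Λ : ℝ} (hΛ : 0 ≤ Λ) (hE : E ≤ E₁ + 2 * E₂) (hE0 : 0 ≤ E)
    (hL : ∀ i ∈ s, 0 ≤ L i) (h : ∀ i ∈ s, P - E - Λ ≤ L i) :
    P ^ 2 - P * (2 * E) - 2 * P * Λ ≤ ∏ i ∈ s, L i := by
  have := hB.prod_ge hs hΛ hE hL h (fun _ _ => hE0) h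
  refine le_trans ?_ this
  rw [Finset.sum_const, nsmul_eq_mul]
  have h2 : (s.card : ℝ) * E ≤ 2 * E := mul_le_mul_of_nonneg_right (by exact_mod_cast hs) hE0
  have := mul_le_mul_of_nonneg_left h2 hB.P_pos.le
  linarith

theorem Slice.Budget.rho_nonneg (hB : D.Budget P E₁ E₂ ρ) : 0 ≤ ρ := by
  have := mul_nonneg (by linarith [hB.pairLoss_nonneg, hB.rootLoss_nonneg] :
      0 ≤ 2 * D.pairLoss + D.rootLoss) hB.P_pos.le
  linarith [hB.rate, hB.r_pos]

end

namespace Slice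

variable {V : Type} [Fintype V] {D : Slice V} {P E₁ E₂ ρ : ℝ} {ch : List V → Finset (List V)}
  {T : List V → Prop}

theorem card_nbr_le (hdeg : ∀ v, (D.H.neighborSet v).ncard ≤ 2) (a : V) (s : Finset V)
    (hs : ∀ u ∈ s, D.H.Adj a u) : (s.card : ℝ) ≤ 2 := by
  have h : s.card ≤ (D.H.neighborSet a).ncard := by
    rw [← Set.ncard_coe_finset]
    exact Set.ncard_le_ncard fun u hu => hs u hu
  exact_mod_cast h.trans (hdeg a)

theorem Budget.loss_mem (hB : D.Budget P E₁ E₂ ρ) (hdeg : ∀ v, (D.H.neighborSet v).ncard ≤ 2)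
    (a : V) (q : List V) : 0 ≤ D.loss a q ∧ D.loss a q ≤ 2 * D.pairLoss +
      if D.H.Adj a D.x then D.rootLoss else 0 := by
  rw [loss_eq]
  have h1 := card_nbr_le hdeg a (q.toFinset.filter fun u => u ≠ D.x ∧ D.H.Adj a u)
    fun u hu => (Finset.mem_filter.1 hu).2.2
  have h2 := mul_le_mul_of_nonneg_right h1 hB.pairLoss_nonneg
  have h3 : 0 ≤ if D.H.Adj a D.x then D.rootLoss else 0 := by
    split_ifs
    · exact hB.rootLoss_nonneg
    · exact le_rfl
  refine ⟨add_nonneg (mul_nonneg (Nat.cast_nonneg _) hB.pairLoss_nonneg) h3, by linarith⟩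

theorem Budget.loss_le_total (hB : D.Budget P E₁ E₂ ρ)
    (hdeg : ∀ v, (D.H.neighborSet v).ncard ≤ 2)
    (a : V) (q : List V) : D.loss a q ≤ 2 * D.pairLoss + D.rootLoss := by
  refine (hB.loss_mem hdeg a q).2.trans ?_
  have := hB.rootLoss_nonneg
  split_ifs <;> linarith

theorem Budget.pr_mem (hB : D.Budget P E₁ E₂ ρ) (hdeg : ∀ v, (D.H.neighborSet v).ncard ≤ 2)
    (p : List V) : 0 ≤ D.pr p ∧ D.pr p ≤ 1 := by
  cases p with
  | nil => simp [pr]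
  | cons a q =>
    simp only [pr]
    split_ifs
    · exact ⟨by linarith [hB.r_pos, hB.gain_nonneg], hB.gain_le⟩
    · have h1 := (hB.loss_mem hdeg a q).1
      have h2 := hB.loss_le_total hdeg a q
      exact ⟨by linarith [hB.loss_le], by linarith [hB.two_r_le, hB.r_pos]⟩

/-- The number of neighbours of the root that do not occur on a path. -/
noncomputable def freeNbrs (D : Slice V) (q : List V) : ℝ :=
  (Finset.univ.filter fun u => D.H.Adj D.x u ∧ u ∉ q).card

theorem freeNbrs_mem (hdeg : ∀ v, (D.H.neighborSet v).ncard ≤ 2) (q : List V) :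
    0 ≤ D.freeNbrs q ∧ D.freeNbrs q ≤ 2 :=
  ⟨Nat.cast_nonneg _, card_nbr_le hdeg D.x _ fun _ hu => (Finset.mem_filter.1 hu).2.1⟩

theorem freeNbrs_cons {a : V} {q : List V} (haq : a ∉ q) :
    D.freeNbrs (a :: q) + (if D.H.Adj a D.x then 1 else 0) = D.freeNbrs q := by
  unfold freeNbrs
  by_cases h : D.H.Adj a D.x
  · have e : (Finset.univ.filter fun u => D.H.Adj D.x u ∧ u ∉ q) =
        insert a (Finset.univ.filter fun u => D.H.Adj D.x u ∧ u ∉ a :: q) := by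
      ext u
      simp only [Finset.mem_filter, Finset.mem_univ, true_and, Finset.mem_insert, List.mem_cons,
        not_or]
      constructor
      · rintro ⟨h1, h2⟩
        by_cases hu : u = a
        · exact Or.inl hu
        · exact Or.inr ⟨h1, hu, h2⟩
      · rintro (rfl | ⟨h1, -, h2⟩)
        · exact ⟨h.symm, haq⟩
        · exact ⟨h1, h2⟩
    rw [e, Finset.card_insert_of_notMem (by simp), if_pos h]
    push_cast
    ring
  · rw [if_neg h, add_zero]
    congr 2
    ext u
    simp only [Finset.mem_filter, Finset.mem_univ, true_and, List.mem_cons, not_or]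
    constructor
    · rintro ⟨h1, -, h2⟩
      exact ⟨h1, h2⟩
    · rintro ⟨h1, h2⟩
      refine ⟨h1, ?_, h2⟩
      rintro rfl
      exact h h1.symm

/-- The bound on the losses below an arbitrary node. -/
theorem Budget.cutBound_ge (hB : D.Budget P E₁ E₂ ρ) (hdeg : ∀ v, (D.H.neighborSet v).ncard ≤ 2)
    (hT : ∀ p, T p → ∀ w ∈ ch p, T w)
    (hT1 : ∀ p, T p → ∃ a q, p = a :: q ∧ a ∉ q ∧ a ≠ D.x)
    (hch : ∀ p, T p → ∀ w ∈ ch p, ∃ y, w = y :: p) (hcard : ∀ p, T p → (ch p).card ≤ 2)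
    (k : ℕ) {a : V} {q : List V} (hp : T (a :: q)) :
    P - (E₁ + E₂ * D.freeNbrs q) - ρ ^ k ≤ D.cutBound ch k (a :: q) ∧
      (a ∈ D.W → P - ρ ^ k ≤ D.cutBound ch k (a :: q)) := by
  have hpr : ∀ p, T p → 0 ≤ D.pr p ∧ D.pr p ≤ 1 := fun p _ => hB.pr_mem hdeg p
  induction k generalizing a q with
  | zero =>
    have h0 := (cutBound_mem hT hpr 0 hp).1
    have h1 := mul_nonneg hB.E₂_nonneg (freeNbrs_mem hdeg q).1
    have h2 := hB.P_le
    have h3 := hB.E₁_nonneg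
    constructor
    · rw [pow_zero]
      linarith
    · intro _
      rw [pow_zero]
      linarith
  | succ k ih =>
    obtain ⟨a', q', he, haq, hax⟩ := hT1 _ hp
    cases he
    have hΛ : 0 ≤ ρ ^ k := pow_nonneg hB.rho_nonneg k
    have hE : E₁ + E₂ * D.freeNbrs (a :: q) ≤ E₁ + 2 * E₂ := by
      have := mul_le_mul_of_nonneg_left (freeNbrs_mem hdeg (a :: q)).2 hB.E₂_nonneg
      linarith
    have hE0 : 0 ≤ E₁ + E₂ * D.freeNbrs (a :: q) :=
      add_nonneg hB.E₁_nonneg (mul_nonneg hB.E₂_nonneg (freeNbrs_mem hdeg (a :: q)).1)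
    have hL : ∀ w ∈ ch (a :: q), 0 ≤ D.cutBound ch k w := fun w hw =>
      (cutBound_mem hT hpr k (hT _ hp w hw)).1
    have hL' : ∀ w ∈ ch (a :: q), P - (E₁ + E₂ * D.freeNbrs (a :: q)) - ρ ^ k ≤
        D.cutBound ch k w := by
      intro w hw
      obtain ⟨y, rfl⟩ := hch _ hp w hw
      exact (ih (hT _ hp _ hw)).1
    have hℓ := hB.prod_ge_const (hcard _ hp) hΛ hE hE0 hL hL'
    have hℓ' : P ^ 2 - P * (2 * (E₁ + 2 * E₂)) - 2 * P * ρ ^ k ≤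
        ∏ w ∈ ch (a :: q), D.cutBound ch k w := by
      have := mul_le_mul_of_nonneg_left hE hB.P_pos.le
      linarith
    have e3 : D.cutBound ch (k + 1) (a :: q) = D.pr (a :: q) + (1 - D.pr (a :: q)) *
      ∏ w ∈ ch (a :: q), D.cutBound ch k w := rfl
    rw [e3, pow_succ']
    by_cases ha : a ∈ D.W
    · have hpr' : D.pr (a :: q) = D.r + D.ε * D.γ₂ := by simp [pr, ha]
      have := hB.node_gain hΛ hℓ'
      rw [hpr']
      refine ⟨?_, fun _ => this⟩
      have h1 := mul_nonneg hB.E₂_nonneg (freeNbrs_mem hdeg q).1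
      have h3 := hB.E₁_nonneg
      linarith
    · have hpr' : D.pr (a :: q) = D.r - D.loss a q := by simp [pr, ha]
      rw [hpr']
      refine ⟨?_, fun h => absurd h ha⟩
      have hl := hB.loss_mem hdeg a q
      refine le_trans ?_ (hB.node_loss hl.1 (hB.loss_le_total hdeg a q) hΛ hℓ hℓ')
      have hfree := freeNbrs_cons (D := D) haq
      have h1 := mul_le_mul_of_nonneg_right hl.2
        (mul_nonneg hB.one_sub_nonneg (by norm_num : (0 : ℝ) ≤ 51 / 50))
      have h2 := hB.pair_le
      have h3 := hB.root_le
      have h4 := mul_le_mul_of_nonneg_right hB.two_r_le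
        (mul_nonneg hB.E₂_nonneg (freeNbrs_mem hdeg (a :: q)).1)
      rw [← hfree]
      split_ifs at h1 ⊢ <;> nlinarith

end Slice

/-! ### Losses at canonical nodes -/

/-- The loss at a node, counted at canonical nodes only. -/
noncomputable def Slice.canonLoss {V : Type} (D : Slice V) (canon : V → Clause V)
    (pick : List V → Clause V) : List V → ℝ
  | [] => 0
  | a :: q => if IsCanonical canon pick D.W (a :: q) then D.loss a q else 0

/-- The losses at the canonical nodes up to `k` levels below a node, where a node `j` levels
below counts with the factor `r ^ j`; all of them are multiplied by `c`. -/
noncomputable def Slice.canonTotal {V : Type} (D : Slice V) (canon : V → Clause V)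
    (pick : List V → Clause V) (c : ℝ) : ℕ → List V → ℝ
  | 0, p => D.canonLoss canon pick p * c
  | k + 1, p => D.canonLoss canon pick p * c +
      D.r * ∑ w ∈ children canon pick p, D.canonTotal canon pick c k w

section

variable {V : Type}

theorem Slice.sum_canonTotal (D : Slice V) (canon : V → Clause V) (pick : List V → Clause V)
    (c : ℝ) (x : V) (k d : ℕ) :
    ∑ w ∈ level canon pick x d, D.canonTotal canon pick c k w =
      (∑ j ∈ Finset.range (k + 1), D.r ^ j *
        ∑ p ∈ level canon pick x (d + j), D.canonLoss canon pick p) * c := by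
  induction k generalizing d with
  | zero => simp [canonTotal, Finset.sum_mul]
  | succ k ih =>
    simp only [canonTotal, Finset.sum_add_distrib, ← Finset.mul_sum]
    rw [← sum_level_succ, ih, Finset.sum_range_succ' _ (k + 1), ← Finset.sum_mul]
    have : ∀ j, D.r ^ (j + 1) * ∑ p ∈ level canon pick x (d + (j + 1)),
        D.canonLoss canon pick p =
        D.r * (D.r ^ j * ∑ p ∈ level canon pick x (d + 1 + j), D.canonLoss canon pick p) := by
      intro j
      rw [show d + (j + 1) = d + 1 + j by omega, pow_succ']
      ring
    simp only [this, ← Finset.mul_sum, pow_zero, add_zero]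
    ring

end

section

variable {V : Type} {F : Finset (Clause V)} {canon : V → Clause V} {pick : List V → Clause V}

theorem level_node {x : V} (hcanon : IsCanonicalChoice F canon) (hpick : IsClauseChoice F pick)
    {d : ℕ} {p : List V} (hp : p ∈ level canon pick x (d + 1)) :
    ∃ a q, p = a :: q ∧ a ∉ q ∧ a ≠ x := by
  have h1 := nodup_of_mem_level hcanon hpick hp
  have h2 := root_notMem_dropLast hcanon hpick hp
  have h3 := length_of_mem_level hp
  rcases p with _ | ⟨a, _ | ⟨b, t⟩⟩
  · simp at h3
  · simp at h3
  · refine ⟨a, b :: t, rfl, (List.nodup_cons.1 h1).1, ?_⟩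
    rintro rfl
    simp at h2

theorem mem_level_child {x : V} {d : ℕ} {p w : List V} (hp : p ∈ level canon pick x d)
    (hw : w ∈ children canon pick p) : w ∈ level canon pick x (d + 1) := by
  rw [level_succ, Finset.mem_biUnion]
  exact ⟨p, hp, hw⟩

theorem isCanonical_root {W : Set V} {x : V} (hx : x ∉ W) : IsCanonical canon pick W [x] := by
  refine ⟨by simpa using hx, fun a q hq hne => ?_⟩
  rcases List.suffix_cons_iff.1 hq with h | h
  · exact absurd h hne
  · simp at h

theorem children_root (x : V) : level canon pick x 1 = children canon pick [x] := by
  rw [level_succ, level, Finset.singleton_biUnion]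

/-- A list is a node, other than the root, of the critical clause tree of `x`. -/
def IsNode (canon : V → Clause V) (pick : List V → Clause V) (x : V) (p : List V) : Prop :=
  ∃ d, p ∈ level canon pick x (d + 1)

theorem IsNode.child {x : V} (p : List V) (hp : IsNode canon pick x p) :
    ∀ w ∈ children canon pick p, IsNode canon pick x w := by
  obtain ⟨d, hp⟩ := hp
  exact fun w hw => ⟨d + 1, mem_level_child hp hw⟩

theorem IsNode.eq_cons (hcanon : IsCanonicalChoice F canon) (hpick : IsClauseChoice F pick)
    {x : V} (p : List V) (hp : IsNode canon pick x p) : ∃ a q, p = a :: q ∧ a ∉ q ∧ a ≠ x := by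
  obtain ⟨d, hp⟩ := hp
  exact level_node hcanon hpick hp

theorem eq_cons_of_mem_children (p : List V) :
    ∀ w ∈ children canon pick p, ∃ y, w = y :: p := fun w hw => by
  obtain ⟨y, -, h⟩ := mem_children.1 hw
  exact ⟨y, h⟩

theorem IsNode.card_children_le (h3 : IsThreeCNF F) (hF : UniquelySat F)
    (hcanon : IsCanonicalChoice F canon) (hpick : IsClauseChoice F pick)
    {x : V} (p : List V) (hp : IsNode canon pick x p) : (children canon pick p).card ≤ 2 := by
  obtain ⟨a, q, rfl, -⟩ := hp.eq_cons hcanon hpick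
  exact card_children_le_two h3 hF hcanon hpick (by simp)

/-- The number of ancestors of a node, other than the root, whose labels are adjacent to its own. -/
theorem card_adjacent_le {H : SimpleGraph V} {x a : V} {q : List V} {d : ℕ}
    (hp : a :: q ∈ level canon pick x d) :
    (q.toFinset.filter fun u => u ≠ x ∧ H.Adj a u).card ≤
      ((Finset.Ico 1 d).filter fun i => H.Adj ((a :: q).getD 0 x)
        (((a :: q).drop i).getD 0 x)).card := by
  have hlen := length_of_mem_level hp
  have hlast := getLast?_of_mem_level hp
  refine le_trans (Finset.card_le_card (t := Finset.image (fun i => ((a :: q).drop i).getD 0 x)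
    ((Finset.Ico 1 d).filter fun i => H.Adj ((a :: q).getD 0 x)
        (((a :: q).drop i).getD 0 x))) ?_) Finset.card_image_le
  intro u hu
  simp only [Finset.mem_filter, List.mem_toFinset] at hu
  obtain ⟨hu, hux, hadj⟩ := hu
  obtain ⟨i, hi, hui⟩ := List.getElem_of_mem hu
  have hget : ((a :: q).drop (i + 1)).getD 0 x = u := by
    rw [List.drop_succ_cons, List.getD_eq_getElem?_getD, List.getElem?_drop]
    simp [hi, hui]
  simp only [Finset.mem_image, Finset.mem_filter, Finset.mem_Ico]
  refine ⟨i + 1, ⟨⟨by omega, ?_⟩, ?_⟩, hget⟩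
  · simp only [List.length_cons] at hlen
    by_contra! hcon
    have hid : i = q.length - 1 := by omega
    apply hux
    have hq : q ≠ [] := List.ne_nil_of_mem hu
    rw [List.getLast?_cons, List.getLast?_eq_some_getLast hq] at hlast
    simp only [Option.getD_some, Option.some.injEq] at hlast
    rw [← hlast, List.getLast_eq_getElem, ← hui]
    congr 1
  · rw [hget]
    simpa using hadj

end

section

variable {V : Type} [Fintype V] {F : Finset (Clause V)} {G : Set (Clause V)}
  {canon : V → Clause V} {pick : List V → Clause V} {D : Slice V} {P E₁ E₂ ρ : ℝ}

theorem Slice.Budget.canonLoss_nonneg (hB : D.Budget P E₁ E₂ ρ)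
    (hdeg : ∀ v, (D.H.neighborSet v).ncard ≤ 2) (p : List V) :
    0 ≤ D.canonLoss canon pick p := by
  cases p with
  | nil => exact le_rfl
  | cons a q =>
    simp only [canonLoss]
    split_ifs
    · exact (hB.loss_mem hdeg a q).1
    · exact le_rfl

theorem Slice.Budget.canonTotal_nonneg (hB : D.Budget P E₁ E₂ ρ)
    (hdeg : ∀ v, (D.H.neighborSet v).ncard ≤ 2) {c : ℝ} (hc : 0 ≤ c) (k : ℕ) (p : List V) :
    0 ≤ D.canonTotal canon pick c k p := by
  induction k generalizing p with
  | zero => exact mul_nonneg (hB.canonLoss_nonneg hdeg p) hc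
  | succ k ih =>
    exact add_nonneg (mul_nonneg (hB.canonLoss_nonneg hdeg p) hc)
      (mul_nonneg hB.r_pos.le (Finset.sum_nonneg fun w _ => ih w))

/-- The product of the cut bounds of the children of a canonical node. -/
theorem Slice.Budget.prod_children_ge (hB : D.Budget P E₁ E₂ ρ)
    (hdeg : ∀ v, (D.H.neighborSet v).ncard ≤ 2)
    (h3 : IsThreeCNF F) (hF : UniquelySat F) (hG : IsDerivedSet F G)
    (hcanon : IsCanonicalChoice F canon) (hpick : IsClauseChoice F pick) (hW : D.W = TwoCC G)
    {c : ℝ} (hc : 0 ≤ c) (k d : ℕ) {a : V} {q : List V}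
    (hp : a :: q ∈ level canon pick D.x d) (hcan : IsCanonical canon pick D.W (a :: q))
    (ih : ∀ y, y :: a :: q ∈ level canon pick D.x (d + 1) →
      (IsCanonical canon pick D.W (y :: a :: q) ∨ y ∈ D.W) →
      P - D.canonTotal canon pick c k (y :: a :: q) - ρ ^ k ≤
        D.cutBound (children canon pick) k (y :: a :: q)) :
    P ^ 2 - P * ∑ w ∈ children canon pick (a :: q), D.canonTotal canon pick c k w -
        2 * P * ρ ^ k ≤
      ∏ w ∈ children canon pick (a :: q), D.cutBound (children canon pick) k w ∧
    P ^ 2 - P * (2 * (E₁ + 2 * E₂)) - 2 * P * ρ ^ k ≤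
      ∏ w ∈ children canon pick (a :: q), D.cutBound (children canon pick) k w := by
  have hT := IsNode.child (canon := canon) (pick := pick) (x := D.x)
  have hT1 := IsNode.eq_cons hcanon hpick (x := D.x)
  have hch := fun p (_ : IsNode canon pick D.x p) =>
    eq_cons_of_mem_children (canon := canon) (pick := pick) p
  have hcard := IsNode.card_children_le h3 hF hcanon hpick (x := D.x)
  have hpr : ∀ p, IsNode canon pick D.x p → 0 ≤ D.pr p ∧ D.pr p ≤ 1 := fun p _ => hB.pr_mem hdeg p
  have hΛ : 0 ≤ ρ ^ k := pow_nonneg hB.rho_nonneg k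
  have hTw : ∀ w ∈ children canon pick (a :: q), IsNode canon pick D.x w :=
    fun w hw => ⟨d, mem_level_child hp hw⟩
  have hL : ∀ w ∈ children canon pick (a :: q), 0 ≤ D.cutBound (children canon pick) k w :=
    fun w hw => (cutBound_mem hT hpr k (hTw w hw)).1
  have hA : ∀ w ∈ children canon pick (a :: q),
      P - (E₁ + 2 * E₂) - ρ ^ k ≤ D.cutBound (children canon pick) k w := by
    intro w hw
    obtain ⟨y, -, rfl⟩ := mem_children.1 hw
    refine le_trans ?_ (hB.cutBound_ge hdeg hT hT1 hch hcard k (hTw _ hw)).1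
    have := mul_le_mul_of_nonneg_left (freeNbrs_mem hdeg (a :: q)).2 hB.E₂_nonneg
    linarith
  have hcard2 : (children canon pick (a :: q)).card ≤ 2 :=
    card_children_le_two h3 hF hcanon hpick (by simp)
  have he := fun w (_ : w ∈ children canon pick (a :: q)) =>
    hB.canonTotal_nonneg (canon := canon) (pick := pick) hdeg hc k w
  refine ⟨?_, hB.prod_ge_const hcard2 hΛ le_rfl hB.total_nonneg hL hA⟩
  by_cases hlab : clauseLabel canon pick (a :: q) = canon a
  · refine hB.prod_ge hcard2 hΛ le_rfl hL hA he fun w hw => ?_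
    have hlev := mem_level_child hp hw
    obtain ⟨y, -, rfl⟩ := mem_children.1 hw
    refine ih y hlev ?_
    by_cases hy : y ∈ D.W
    · exact Or.inr hy
    · exact Or.inl (isCanonical_cons hcan hlab hy)
  · have hle := card_children_le_one h3 hF hG hcanon hpick hp (hW ▸ hcan) hlab
    have := prod_ge_of_card_le_one hle hB.P_pos.le hB.P_le hΛ hB.small hB.small' hL hA
    have h4 := mul_nonneg hB.P_pos.le (Finset.sum_nonneg he)
    linarith

/-- Below a canonical node, only the losses at canonical nodes count: the others are made up for by
the variables of `TwoCC` and by the nodes with at most one child. -/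
theorem Slice.Budget.cutBound_canonical_ge (hB : D.Budget P E₁ E₂ ρ)
    (hdeg : ∀ v, (D.H.neighborSet v).ncard ≤ 2)
    (h3 : IsThreeCNF F) (hF : UniquelySat F) (hG : IsDerivedSet F G)
    (hcanon : IsCanonicalChoice F canon) (hpick : IsClauseChoice F pick) (hW : D.W = TwoCC G)
    (k d : ℕ) {a : V} {q : List V} (hp : a :: q ∈ level canon pick D.x (d + 1))
    (hcan : IsCanonical canon pick D.W (a :: q) ∨ a ∈ D.W) :
    P - D.canonTotal canon pick ((1 - P ^ 2) * (51 / 50)) k (a :: q) - ρ ^ k ≤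
      D.cutBound (children canon pick) k (a :: q) := by
  have hc : 0 ≤ (1 - P ^ 2) * (51 / 50) := mul_nonneg hB.one_sub_nonneg (by norm_num)
  have hT := IsNode.child (canon := canon) (pick := pick) (x := D.x)
  have hT1 := IsNode.eq_cons hcanon hpick (x := D.x)
  have hch := fun p (_ : IsNode canon pick D.x p) =>
    eq_cons_of_mem_children (canon := canon) (pick := pick) p
  have hcard := IsNode.card_children_le h3 hF hcanon hpick (x := D.x)
  have hpr : ∀ p, IsNode canon pick D.x p → 0 ≤ D.pr p ∧ D.pr p ≤ 1 := fun p _ => hB.pr_mem hdeg p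
  induction k generalizing a q d with
  | zero =>
    have h0 := (cutBound_mem hT hpr 0 ⟨d, hp⟩).1
    have h1 := hB.canonTotal_nonneg (canon := canon) (pick := pick) hdeg hc 0 (a :: q)
    have h2 := hB.P_le
    rw [pow_zero]
    linarith
  | succ k ih =>
    by_cases ha : a ∈ D.W
    · have h1 := hB.canonTotal_nonneg (canon := canon) (pick := pick) hdeg hc (k + 1) (a :: q)
      have := (hB.cutBound_ge hdeg hT hT1 hch hcard (k + 1) ⟨d, hp⟩).2 ha
      linarith
    · have hcan' : IsCanonical canon pick D.W (a :: q) := hcan.resolve_right ha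
      have hΛ : 0 ≤ ρ ^ k := pow_nonneg hB.rho_nonneg k
      obtain ⟨h1, h2⟩ := hB.prod_children_ge hdeg h3 hF hG hcanon hpick hW hc k (d + 1) hp hcan'
        fun y hy hyc => ih (d + 1) hy hyc
      have hl := hB.loss_mem hdeg a q
      have := hB.node_loss hl.1 (hB.loss_le_total hdeg a q) hΛ h1 h2
      have e1 : D.cutBound (children canon pick) (k + 1) (a :: q) =
          D.pr (a :: q) + (1 - D.pr (a :: q)) *
          ∏ w ∈ children canon pick (a :: q), D.cutBound (children canon pick) k w := rfl
      have e2 : D.pr (a :: q) = D.r - D.loss a q := by simp [pr, ha]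
      have e3 : D.canonTotal canon pick ((1 - P ^ 2) * (51 / 50)) (k + 1) (a :: q) =
          D.loss a q * ((1 - P ^ 2) * (51 / 50)) + D.r * ∑ w ∈ children canon pick (a :: q),
            D.canonTotal canon pick ((1 - P ^ 2) * (51 / 50)) k w := by
        rw [canonTotal, canonLoss, if_pos hcan']
      rw [e1, e2, e3, pow_succ' ρ]
      exact this

/-- The bound at the root of a critical clause tree. -/
theorem Slice.Budget.root_ge (hB : D.Budget P E₁ E₂ ρ)
    (hdeg : ∀ v, (D.H.neighborSet v).ncard ≤ 2)
    (h3 : IsThreeCNF F) (hF : UniquelySat F) (hG : IsDerivedSet F G)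
    (hcanon : IsCanonicalChoice F canon) (hpick : IsClauseChoice F pick) (hW : D.W = TwoCC G)
    (hx : D.x ∉ D.W) (k : ℕ) :
    P ^ 2 - P * ((∑ j ∈ Finset.range (k + 1), D.r ^ j *
        ∑ p ∈ level canon pick D.x (j + 1), D.canonLoss canon pick p) *
        ((1 - P ^ 2) * (51 / 50))) - 2 * P * ρ ^ k ≤
      ∏ w ∈ children canon pick [D.x], D.cutBound (children canon pick) k w := by
  have hc : 0 ≤ (1 - P ^ 2) * (51 / 50) := mul_nonneg hB.one_sub_nonneg (by norm_num)
  have h := (hB.prod_children_ge hdeg h3 hF hG hcanon hpick hW hc k 0 (a := D.x) (q := [])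
    (by simp [level]) (isCanonical_root hx) fun y hy hyc =>
      hB.cutBound_canonical_ge hdeg h3 hF hG hcanon hpick hW k 0 hy hyc).1
  rw [← children_root, Slice.sum_canonTotal] at h
  simpa only [children_root, add_comm 1] using h

end

/-- The canonical nodes with label `y` in the tree of `x`, a node of depth `d` counting with the
factor `r ^ d`. -/
noncomputable def canonSum {V : Type} (canon : V → Clause V) (pick : List V → Clause V)
    (W : Set V) (h : ℕ) (r : ℝ) (y x : V) : ℝ :=
  ∑ d ∈ Finset.range (h + 1), r ^ d * (canonicalNodes canon pick W x y d).card

theorem labelDensityAt_eq {V : Type} (canon : V → Clause V) (pick : List V → Clause V)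
    (W : Set V) (h : ℕ) (r : ℝ) (y x : V) :
    labelDensityAt canon pick W h y x r =
      (1 - 2 * r) ^ 2 / (1 - r) ^ 3 * (r * canonSum canon pick W h r y x) := by
  unfold labelDensityAt canonSum
  congr 1
  rw [Finset.mul_sum]
  refine Finset.sum_congr rfl fun d _ => ?_
  rw [Finset.sum_const, nsmul_eq_mul]
  ring

section

variable {V : Type} [Fintype V] {F : Finset (Clause V)}
  {canon : V → Clause V} {pick : List V → Clause V}

/-- The canonical descendants of a node `t`, `i` levels below it, whose label is adjacent to that
of `t`, correspond to canonical nodes in the critical clause tree of the label of `t`. -/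
theorem card_descendants_le (hcanon : IsCanonicalChoice F canon) (hpick : IsClauseChoice F pick)
    {W : Set V} {H : SimpleGraph V} {x : V} {d i : ℕ} (hi : 1 ≤ i) {t : List V}
    (ht : t ∈ level canon pick x d) :
    ((level canon pick x (d + i)).filter fun p => p.drop i = t ∧ IsCanonical canon pick W p ∧
        H.Adj (p.getD 0 x) (t.getD 0 x)).card ≤
      ∑ b ∈ Finset.univ.filter (H.Adj (t.getD 0 x)),
        (canonicalNodes canon pick W (t.getD 0 x) b i).card := by
  obtain ⟨a, q, rfl⟩ : ∃ a q, t = a :: q := by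
    have := length_of_mem_level ht
    cases t with
    | nil => simp at this
    | cons a q => exact ⟨a, q, rfl⟩
  refine le_trans ?_ Finset.card_biUnion_le
  refine Finset.card_le_card_of_injOn (fun p => p.take i ++ [a]) ?_ ?_
  · intro p hp
    simp only [Finset.coe_filter, Set.mem_ofPred_eq] at hp
    obtain ⟨hp, hd, hcan, hadj⟩ := hp
    have hlen := length_of_mem_level hp
    have hps : p = p.take i ++ a :: q := by rw [← hd, List.take_append_drop]
    have hti : (p.take i).length = i := by simp; omega
    have htr := canonical_transplant hcanon hpick (p.take i) (hps ▸ hp) (hps ▸ hcan)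
    rw [hti] at htr
    obtain ⟨b, s, hbs⟩ : ∃ b s, p = b :: s := by
      cases p with
      | nil => simp at hlen
      | cons b s => exact ⟨b, s, rfl⟩
    simp only [Finset.coe_biUnion, Set.mem_iUnion, Finset.mem_coe]
    refine ⟨b, ?_, ?_⟩
    · subst hbs
      simpa using hadj.symm
    · rw [canonicalNodes, Finset.mem_filter]
      refine ⟨htr.1, htr.2, ?_⟩
      obtain ⟨j, rfl⟩ : ∃ j, i = j + 1 := ⟨i - 1, by omega⟩
      subst hbs
      simp
  · intro p hp p' hp' h
    simp only [Finset.coe_filter, Set.mem_ofPred_eq] at hp hp'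
    have h' := List.append_cancel_right h
    rw [← List.take_append_drop i p, ← List.take_append_drop i p', h', hp.2.1, hp'.2.1]

end

section

variable {V : Type} [Fintype V] {F : Finset (Clause V)}
  {canon : V → Clause V} {pick : List V → Clause V} {D : Slice V} {P E₁ E₂ ρ : ℝ}

theorem card_adjacent_root_le (W : Set V) (H : SimpleGraph V) (x : V) (d : ℕ) :
    ((level canon pick x d).filter fun p => IsCanonical canon pick W p ∧
        H.Adj (p.getD 0 x) x).card ≤
      ∑ b ∈ Finset.univ.filter (H.Adj x), (canonicalNodes canon pick W x b d).card := by
  refine le_trans (Finset.card_le_card ?_) Finset.card_biUnion_le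
  intro p hp
  obtain ⟨hp, hcan, hadj⟩ := Finset.mem_filter.1 hp
  have hlen := length_of_mem_level hp
  cases p with
  | nil => simp at hlen
  | cons b s =>
    simp only [Finset.mem_biUnion, canonicalNodes, Finset.mem_filter, Finset.mem_univ, true_and]
    exact ⟨b, by simpa using hadj.symm, hp, hcan, rfl⟩

theorem Slice.Budget.sum_level_canonLoss_le (hB : D.Budget P E₁ E₂ ρ)
    (hcanon : IsCanonicalChoice F canon) (hpick : IsClauseChoice F pick) (d : ℕ) :
    ∑ p ∈ level canon pick D.x d, D.canonLoss canon pick p ≤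
      D.pairLoss * (∑ i ∈ Finset.Ico 1 d, ∑ t ∈ level canon pick D.x (d - i),
        ∑ b ∈ Finset.univ.filter (D.H.Adj (t.getD 0 D.x)),
          ((canonicalNodes canon pick D.W (t.getD 0 D.x) b i).card : ℝ)) +
      D.rootLoss * ∑ b ∈ Finset.univ.filter (D.H.Adj D.x),
        ((canonicalNodes canon pick D.W D.x b d).card : ℝ) := by
  set x := D.x with hx
  have h1 : ∀ p ∈ level canon pick x d, D.canonLoss canon pick p ≤
      D.pairLoss * (∑ i ∈ Finset.Ico 1 d, if IsCanonical canon pick D.W p ∧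
        D.H.Adj (p.getD 0 x) ((p.drop i).getD 0 x) then (1 : ℝ) else 0) +
      D.rootLoss *
        (if IsCanonical canon pick D.W p ∧ D.H.Adj (p.getD 0 x) x then (1 : ℝ) else 0) := by
    intro p hp
    have hlen := length_of_mem_level hp
    cases p with
    | nil => simp at hlen
    | cons a q =>
      simp only [canonLoss]
      by_cases hcan : IsCanonical canon pick D.W (a :: q)
      · rw [if_pos hcan, loss_eq]
        simp only [hcan, true_and]
        have h2 := card_adjacent_le (H := D.H) hp
        rw [← Finset.sum_filter, Finset.sum_const, nsmul_eq_mul, mul_one]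
        have h3 := mul_le_mul_of_nonneg_left (Nat.cast_le (α := ℝ).2 h2) hB.pairLoss_nonneg
        have h4 : (if D.H.Adj a D.x then D.rootLoss else 0) =
            D.rootLoss * (if D.H.Adj ((a :: q).getD 0 x) x then (1 : ℝ) else 0) := by
          rw [List.getD_cons_zero]
          split_ifs <;> simp
        rw [h4]
        linarith
      · rw [if_neg hcan]
        simp [hcan]
  refine (Finset.sum_le_sum h1).trans ?_
  rw [Finset.sum_add_distrib, ← Finset.mul_sum, ← Finset.mul_sum]
  refine add_le_add (mul_le_mul_of_nonneg_left ?_ hB.pairLoss_nonneg)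
    (mul_le_mul_of_nonneg_left ?_ hB.rootLoss_nonneg)
  · rw [Finset.sum_comm]
    refine Finset.sum_le_sum fun i hi => ?_
    obtain ⟨hi1, hid⟩ := Finset.mem_Ico.1 hi
    have hdi : d - i + i = d := by omega
    rw [← Finset.sum_filter, Finset.sum_const, nsmul_eq_mul, mul_one]
    rw [Finset.card_eq_sum_card_fiberwise (f := fun p => p.drop i)
      (t := level canon pick x (d - i))]
    · push_cast
      refine Finset.sum_le_sum fun t ht => ?_
      have h5 := card_descendants_le hcanon hpick (W := D.W) (H := D.H) hi1 ht
      rw [hdi] at h5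
      have h6 : (((level canon pick x d).filter fun p => IsCanonical canon pick D.W p ∧
          D.H.Adj (p.getD 0 x) ((p.drop i).getD 0 x)).filter fun p => p.drop i = t) =
          (level canon pick x d).filter fun p => p.drop i = t ∧ IsCanonical canon pick D.W p ∧
            D.H.Adj (p.getD 0 x) (t.getD 0 x) := by
        ext p
        simp only [Finset.mem_filter]
        constructor
        · rintro ⟨⟨a, b, c⟩, rfl⟩
          exact ⟨a, rfl, b, c⟩
        · rintro ⟨a, rfl, b, c⟩
          exact ⟨⟨a, b, c⟩, rfl⟩
      rw [h6]
      exact_mod_cast h5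
    · intro p hp
      have hp := (Finset.mem_filter.1 hp).1
      rw [← hdi] at hp
      exact drop_mem_level hp
  · rw [← Finset.sum_filter, Finset.sum_const, nsmul_eq_mul, mul_one]
    exact_mod_cast card_adjacent_root_le D.W D.H x d

theorem sum_Ico_pairs_le {f : ℕ → ℕ → ℝ} (hf : ∀ i j, 0 ≤ f i j) {r : ℝ} (hr : 0 ≤ r) (h : ℕ) :
    ∑ d ∈ Finset.Ico 1 (h + 1), r ^ d * ∑ i ∈ Finset.Ico 1 d, f (d - i) i ≤
      ∑ d ∈ Finset.Ico 1 (h + 1), r ^ d * ∑ i ∈ Finset.range (h + 1), r ^ i * f d i := by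
  simp only [Finset.mul_sum]
  rw [Finset.sum_sigma', Finset.sum_sigma']
  have h1 : ∑ s ∈ (Finset.Ico 1 (h + 1)).sigma (fun d => Finset.Ico 1 d),
      r ^ s.1 * f (s.1 - s.2) s.2 =
      ∑ s ∈ ((Finset.Ico 1 (h + 1)).sigma (fun d => Finset.Ico 1 d)).image
        (fun s => (⟨s.1 - s.2, s.2⟩ : Σ _ : ℕ, ℕ)), r ^ s.1 * (r ^ s.2 * f s.1 s.2) := by
    rw [Finset.sum_image]
    · refine Finset.sum_congr rfl fun s hs => ?_
      simp only [Finset.mem_sigma, Finset.mem_Ico] at hs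
      rw [← mul_assoc, ← pow_add, show s.1 - s.2 + s.2 = s.1 by omega]
    · rintro ⟨a, b⟩ hs ⟨a', b'⟩ hs' h
      simp only [Finset.coe_sigma, Set.mem_sigma_iff, Finset.coe_Ico, Set.mem_Ico] at hs hs'
      simp only [Sigma.mk.injEq, heq_eq_eq] at h ⊢
      omega
  rw [h1]
  refine Finset.sum_le_sum_of_subset_of_nonneg ?_ fun s _ _ =>
    mul_nonneg (pow_nonneg hr _) (mul_nonneg (pow_nonneg hr _) (hf _ _))
  intro s hs
  simp only [Finset.mem_image, Finset.mem_sigma, Finset.mem_Ico, Finset.mem_range] at hs ⊢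
  obtain ⟨s', hs', rfl⟩ := hs
  simp only
  omega

theorem sum_mul_sum_comm {α β : Type*} (s : Finset ℕ) (t : Finset α) (u : α → Finset β)
    (f : ℕ → ℝ) (c : ℕ → α → β → ℝ) :
    ∑ i ∈ s, f i * ∑ a ∈ t, ∑ b ∈ u a, c i a b = ∑ a ∈ t, ∑ b ∈ u a, ∑ i ∈ s, f i * c i a b := by
  simp only [Finset.mul_sum]
  rw [Finset.sum_comm]
  exact Finset.sum_congr rfl fun a _ => Finset.sum_comm

theorem sum_mul_sum_le {β : Type*} {s t : Finset ℕ} (hst : s ⊆ t) (u : Finset β)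
    {f : ℕ → ℝ} (hf : ∀ i, 0 ≤ f i) {c : ℕ → β → ℝ} (hc : ∀ i b, 0 ≤ c i b) :
    ∑ i ∈ s, f i * ∑ b ∈ u, c i b ≤ ∑ b ∈ u, ∑ i ∈ t, f i * c i b := by
  simp only [Finset.mul_sum]
  rw [Finset.sum_comm]
  exact Finset.sum_le_sum fun b _ => Finset.sum_le_sum_of_subset_of_nonneg hst
    fun i _ _ => mul_nonneg (hf i) (hc i b)

/-- The total loss at the canonical nodes, sorted by the upper one of the two adjacent labels. -/
theorem Slice.Budget.sum_canonLoss_le (hB : D.Budget P E₁ E₂ ρ)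
    (hcanon : IsCanonicalChoice F canon) (hpick : IsClauseChoice F pick) (h : ℕ) :
    ∑ d ∈ Finset.Ico 1 (h + 1), D.r ^ d * ∑ p ∈ level canon pick D.x d,
        D.canonLoss canon pick p ≤
      D.pairLoss * (∑ d ∈ Finset.Ico 1 (h + 1), D.r ^ d * ∑ t ∈ level canon pick D.x d,
        ∑ b ∈ Finset.univ.filter (D.H.Adj (t.getD 0 D.x)),
          canonSum canon pick D.W h D.r b (t.getD 0 D.x)) +
      D.rootLoss * ∑ b ∈ Finset.univ.filter (D.H.Adj D.x),
        canonSum canon pick D.W h D.r b D.x := by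
  have hr := hB.r_pos.le
  have h1 := Finset.sum_le_sum fun d (_ : d ∈ Finset.Ico 1 (h + 1)) =>
    mul_le_mul_of_nonneg_left (hB.sum_level_canonLoss_le hcanon hpick d) (pow_nonneg hr d)
  refine h1.trans ?_
  have e1 : ∀ (d : ℕ) (A B : ℝ), D.r ^ d * (D.pairLoss * A + D.rootLoss * B) =
      D.pairLoss * (D.r ^ d * A) + D.rootLoss * (D.r ^ d * B) := by
    intros; ring
  rw [Finset.sum_congr rfl fun d _ => e1 d _ _, Finset.sum_add_distrib, ← Finset.mul_sum,
    ← Finset.mul_sum]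
  refine add_le_add (mul_le_mul_of_nonneg_left ?_ hB.pairLoss_nonneg)
    (mul_le_mul_of_nonneg_left ?_ hB.rootLoss_nonneg)
  · refine (sum_Ico_pairs_le (f := fun d i => ∑ t ∈ level canon pick D.x d,
        ∑ b ∈ Finset.univ.filter (D.H.Adj (t.getD 0 D.x)),
          ((canonicalNodes canon pick D.W (t.getD 0 D.x) b i).card : ℝ)) ?_ hr h).trans
      (le_of_eq ?_)
    · exact fun i j => Finset.sum_nonneg fun t _ => Finset.sum_nonneg fun b _ => Nat.cast_nonneg _
    · refine Finset.sum_congr rfl fun d _ => ?_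
      congr 1
      exact sum_mul_sum_comm _ _ _ _ _
  · refine sum_mul_sum_le (fun d hd => ?_) _ (fun d => pow_nonneg hr d)
      (fun d b => Nat.cast_nonneg _)
    have := (Finset.mem_Ico.1 hd).2
    exact Finset.mem_range.2 this

end

/-! ### The slices of the distribution `D` -/

theorem gam_eq (r : ℝ) : gam r = r * √(1 - 2 * r) ^ 3 := by
  unfold gam
  split_ifs with h
  · have h0 : 0 ≤ 1 - 2 * r := by linarith
    rw [Real.sqrt_eq_rpow, ← Real.rpow_mul_natCast h0]
    norm_num
  · rw [Real.sqrt_eq_zero_of_nonpos (by linarith)]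
    ring

theorem phi_eq (r : ℝ) : phi r = √(1 - 2 * r) * (1 - 5 * r) := by
  unfold phi
  split_ifs with h
  · rfl
  · rw [Real.sqrt_eq_zero_of_nonpos (by linarith), zero_mul]

theorem phiTwo_eq (r : ℝ) : phiTwo r = 25 * r ^ 2 * max (1 - 2 * r) 0 * (3 - 10 * r) := by
  unfold phiTwo
  split_ifs with h
  · rw [max_eq_left (by linarith)]
  · rw [max_eq_right (by linarith)]
    ring

theorem continuous_phi : Continuous phi := by
  rw [funext phi_eq]
  fun_prop

theorem continuous_phiTwo : Continuous phiTwo := by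
  rw [funext phiTwo_eq]
  fun_prop

theorem gam_of_ge {r : ℝ} (h : 1 / 2 ≤ r) : gam r = 0 := if_neg (not_lt.2 h)

theorem gamTwo_of_ge {r : ℝ} (h : 1 / 2 ≤ r) : gamTwo r = 0 := if_neg (not_lt.2 h)

theorem gam_nonneg {r : ℝ} (h : 0 ≤ r) : 0 ≤ gam r := by
  rw [gam_eq]
  positivity

theorem gamTwo_nonneg {r : ℝ} (h : 0 ≤ r) : 0 ≤ gamTwo r := by
  unfold gamTwo
  split_ifs <;> positivity

theorem gam_sq {r : ℝ} (h : r ≤ 1 / 2) : gam r * gam r = r ^ 2 * (1 - 2 * r) ^ 3 := by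
  have h0 : √(1 - 2 * r) ^ 2 = 1 - 2 * r := Real.sq_sqrt (by linarith)
  rw [gam_eq]
  linear_combination (r ^ 2 * (√(1 - 2 * r) ^ 4 + √(1 - 2 * r) ^ 2 * (1 - 2 * r) +
    (1 - 2 * r) ^ 2)) * h0

theorem gam_mul_sqrt {r : ℝ} (h : r ≤ 1 / 2) : gam r * √(1 - 2 * r) = r * (1 - 2 * r) ^ 2 := by
  have h0 : √(1 - 2 * r) ^ 2 = 1 - 2 * r := Real.sq_sqrt (by linarith)
  rw [gam_eq]
  linear_combination (r * (√(1 - 2 * r) ^ 2 + (1 - 2 * r))) * h0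

theorem gamTwo_eq {r : ℝ} (h : r ≤ 1 / 2) : gamTwo r = 25 * r ^ 3 * (1 - 2 * r) ^ 2 := by
  unfold gamTwo
  split_ifs with h1
  · rfl
  · have : r = 1 / 2 := by linarith
    subst this
    norm_num

theorem integral_phi (a b : ℝ) : ∫ t in a..b, phi t = gam b - gam a :=
  intervalIntegral.integral_eq_sub_of_hasDerivAt (fun t _ => hasDerivAt_gam t)
    (continuous_phi.intervalIntegrable a b)

theorem integral_phiTwo (a b : ℝ) : ∫ t in a..b, phiTwo t = gamTwo b - gamTwo a :=
  intervalIntegral.integral_eq_sub_of_hasDerivAt (fun t _ => hasDerivAt_gamTwo t)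
    (continuous_phiTwo.intervalIntegrable a b)

section

variable {r : ℝ}

theorem mul_cube_le (h0 : 0 ≤ r) (h1 : r ≤ 1 / 2) : r * (1 - 2 * r) ^ 3 ≤ 1 / 16 * (1 - r) := by
  nlinarith [sq_nonneg (r ^ 2 - 7 / 8 * r + 13 / 125), sq_nonneg (r - 7 / 50),
    mul_nonneg h0 (sub_nonneg.2 h1), sq_nonneg (r * (r - 7 / 50)),
    mul_nonneg h0 (sq_nonneg (r - 7 / 50))]

theorem mul_sq_le (h0 : 0 ≤ r) (h1 : r ≤ 1 / 2) :
    (5 * r - 1) * (1 - 2 * r) ^ 2 ≤ 81 / 1000 := by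
  nlinarith [mul_nonneg h0 (sq_nonneg (r - 3 / 10)),
    mul_nonneg (sub_nonneg.2 h1) (sq_nonneg (r - 3 / 10)), sq_nonneg (r - 3 / 10)]

theorem mul_sq_mul_le (h0 : 0 ≤ r) (h1 : r ≤ 1 / 2) :
    (1 - 5 * r) * (1 - 2 * r) ^ 2 * r ≤ 81 / 1000 * (1 - r) := by
  nlinarith [sq_nonneg (r * (r - 1 / 10)), mul_nonneg h0 (sub_nonneg.2 h1),
    sq_nonneg (r - 2 / 25), mul_nonneg h0 (sq_nonneg (r - 1 / 10)), sq_nonneg (1 - 2 * r),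
    sq_nonneg (r * (1 - 2 * r))]

theorem cube_mul_sq_le (h0 : 0 ≤ r) (h1 : r ≤ 1 / 2) :
    125 * r ^ 3 * (1 - 2 * r) ^ 2 ≤ 1 - r := by
  nlinarith [mul_nonneg h0 (sq_nonneg (r - 3 / 10)),
    mul_nonneg (mul_nonneg h0 h0) (sub_nonneg.2 h1), sq_nonneg (r * (r - 3 / 10)),
    mul_nonneg h0 (sq_nonneg (r * (r - 3 / 10))), mul_nonneg h0 (sub_nonneg.2 h1)]

theorem gam_div_mul_le (h0 : 0 < r) (h1 : r < 1) : gam r / r * (gam r / (1 - r)) ≤ 1 / 16 := by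
  rcases le_total r (1 / 2) with h | h
  · have h2 : 0 < 1 - r := by linarith
    rw [div_mul_div_comm, gam_sq h, div_le_iff₀ (mul_pos h0 h2)]
    have := mul_le_mul_of_nonneg_left (mul_cube_le h0.le h) h0.le
    linarith
  · rw [gam_of_ge h]
    norm_num

theorem le_phi_mul_gam_div (h0 : 0 < r) : -(81 / 1000) ≤ phi r * (gam r / r) := by
  rcases le_total r (1 / 2) with h | h
  · have e : phi r * (gam r / r) = -((5 * r - 1) * (1 - 2 * r) ^ 2) := by
      rw [phi_eq, mul_div_assoc', div_eq_iff h0.ne']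
      linear_combination (1 - 5 * r) * gam_mul_sqrt h
    rw [e]
    linarith [mul_sq_le h0.le h]
  · rw [gam_of_ge h]
    norm_num

theorem le_phi_mul_neg_gam_div (h0 : 0 < r) (h1 : r < 1) :
    -(81 / 1000) ≤ phi r * -(gam r / (1 - r)) := by
  have h2 : 0 < 1 - r := by linarith
  rcases le_total r (1 / 2) with h | h
  · have e : phi r * -(gam r / (1 - r)) = -((1 - 5 * r) * (1 - 2 * r) ^ 2 * r / (1 - r)) := by
      rw [phi_eq, ← neg_div, mul_div_assoc', ← neg_div]
      congr 1
      linear_combination -(1 - 5 * r) * gam_mul_sqrt h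
    rw [e, neg_le_neg_iff, div_le_iff₀ h2]
    exact mul_sq_mul_le h0.le h
  · rw [gam_of_ge h]
    norm_num

end

/-- The slice of `D` in which `x` is placed at `r`. -/
noncomputable def sliceAt {V : Type} (ε : ℝ) (W : Set V) (H : SimpleGraph V) (x : V) (r : ℝ) :
    Slice V where
  ε := ε
  r := r
  φx := phi r
  γ := gam r
  γ₂ := gamTwo r
  -- the density of a component is at least `1 - 1/10 * (23 * (1/16) + 2 * (81/1000))`
  w := 21 / 25
  W := W
  H := H
  x := x

theorem sliceAt_pairLoss {V : Type} {ε r : ℝ} {W : Set V} {H : SimpleGraph V} {x : V}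
    (hr : r ≤ 1 / 2) :
    (sliceAt ε W H x r).pairLoss = 25 / 21 * ε * (r ^ 2 * (1 - 2 * r) ^ 3 / (1 - r)) := by
  have : (sliceAt ε W H x r).pairLoss = ε * gam r * (gam r / (1 - r)) / (21 / 25) := rfl
  rw [this, ← gam_sq hr]
  ring

theorem sliceAt_rootLoss {V : Type} {ε r : ℝ} {W : Set V} {H : SimpleGraph V} {x : V}
    (hr : r ≤ 1 / 2) :
    (sliceAt ε W H x r).rootLoss =
      25 / 21 * ε * (r * (1 - 2 * r) ^ 2 * max 0 (5 * r - 1)) := by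
  have h1 : (sliceAt ε W H x r).rootLoss = ε * gam r * max 0 (-phi r) / (21 / 25) := rfl
  have h2 : max 0 (-phi r) = √(1 - 2 * r) * max 0 (5 * r - 1) := by
    rw [mul_max_of_nonneg _ _ (Real.sqrt_nonneg _), mul_zero, phi_eq]
    congr 1
    ring
  rw [h1, h2, ← gam_mul_sqrt hr]
  ring

theorem total_loss_le {ε r m : ℝ} (hε : 0 ≤ ε) (hr0 : 0 < r) (hr : r < 1 / 2)
    (hm : m ≤ 3 * r) :
    17 / 7 * ε * (r ^ 2 * (1 - 2 * r) ^ 3 / (1 - r) ^ 3) +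
        2 * (17 / 14 * ε * (r * (1 - 2 * r) ^ 3 * m / (1 - r) ^ 2)) ≤
      85 / 7 * ε * (r ^ 2 * (1 - 2 * r) ^ 3 / (1 - r) ^ 2) := by
  have h1 : 0 < 1 - r := by linarith
  have hu : 0 < 1 - 2 * r := by linarith
  have hPr : r / (1 - r) ≤ 2 * r := by
    rw [div_le_iff₀ h1]
    nlinarith
  have h2 := mul_le_mul_of_nonneg_left (show r / (1 - r) + m ≤ 5 * r by linarith)
    (show 0 ≤ 17 / 7 * ε * (r * (1 - 2 * r) ^ 3 / (1 - r) ^ 2) by positivity)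
  generalize 1 - r = s at *
  calc _ = 17 / 7 * ε * (r * (1 - 2 * r) ^ 3 / s ^ 2) * (r / s + m) := by ring
    _ ≤ _ := h2
    _ = _ := by ring

theorem node_loss_le {ε r m : ℝ} (hε : 0 ≤ ε) (hε' : ε ≤ 1 / 10) (hr0 : 0 < r) (hr : r < 1 / 2)
    (hm : m ≤ 3 * r) :
    2 * (25 / 21 * ε * (r ^ 2 * (1 - 2 * r) ^ 3 / (1 - r))) +
        25 / 21 * ε * (r * (1 - 2 * r) ^ 2 * m) ≤ 1 / 4 * (r * (1 - 2 * r)) := by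
  have h1 : 0 < 1 - r := by linarith
  have hu : 0 < 1 - 2 * r := by linarith
  have hPr : r / (1 - r) ≤ 1 := by
    rw [div_le_iff₀ h1]
    linarith
  have i1 : 2 * (r / (1 - r)) * (1 - 2 * r) + m ≤ 2 := by nlinarith
  have i2 : 25 / 21 * ε * (r * (1 - 2 * r) ^ 2) ≤ 1 / 8 * (r * (1 - 2 * r)) := by
    have : (1 - 2 * r) ^ 2 ≤ 1 - 2 * r := by nlinarith
    have h3 : r * (1 - 2 * r) ^ 2 ≤ r * (1 - 2 * r) := mul_le_mul_of_nonneg_left this hr0.le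
    exact mul_le_mul (by linarith) h3 (by positivity) (by norm_num)
  have i3 := mul_le_mul_of_nonneg_left i1
    (show 0 ≤ 25 / 21 * ε * (r * (1 - 2 * r) ^ 2) by positivity)
  calc _ = 25 / 21 * ε * (r * (1 - 2 * r) ^ 2) * (2 * (r / (1 - r)) * (1 - 2 * r) + m) := by
        generalize 1 - r = s
        ring
    _ ≤ _ := i3
    _ ≤ _ := by linarith

section

variable {V : Type} [Fintype V] {ε r : ℝ} {W : Set V} {H : SimpleGraph V} {x : V}

theorem le_one_add_mul_compSum (hε : 0 ≤ ε) (hε' : ε ≤ 1 / 10) (hr0 : 0 < r) (hr1 : r < 1)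
    (hdeg : ∀ v, (H.neighborSet v).ncard ≤ 2) {c : H.ConnectedComponent}
    (hc : c.supp.ncard ≤ 23) {z : V → ℝ}
    (hz : ∀ u y, H.Adj u y → u ≠ x → z u = gam r / r ∨ z u = -(gam r / (1 - r)) ∨ z u = 0)
    (hzx : z x = phi r ∨ z x = 0) : 21 / 25 ≤ 1 + ε * compSum H c z := by
  have hg := gam_nonneg hr0.le
  have h2 : 0 < 1 - r := by linarith
  have hp : 0 ≤ gam r / r := div_nonneg hg hr0.le
  have hq : 0 ≤ gam r / (1 - r) := div_nonneg hg h2.le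
  have hpq := gam_div_mul_le hr0 hr1
  have hx1 := le_phi_mul_gam_div hr0
  have hx2 := le_phi_mul_neg_gam_div hr0 hr1
  set p := gam r / r
  set q := gam r / (1 - r)
  have key := compSum_ge (z := z) (x := x) (B₁ := 1 / 16) (B₂ := 81 / 1000) hdeg hc (by norm_num)
    (by norm_num) (fun u y huy hu hy => ?_) (fun y hy => ?_)
  · nlinarith
  · rcases hz u y huy hu with h | h | h <;> rcases hz y u huy.symm hy with h' | h' | h' <;>
      rw [h, h'] <;> nlinarith
  · rcases hzx with h | h <;> rcases hz y x hy.symm hy.ne' with h' | h' | h' <;> rw [h, h'] <;>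
      first | exact hx1 | exact hx2 | norm_num

theorem sliceAt_valid (hε : 0 ≤ ε) (hε' : ε ≤ 1 / 10) (hr0 : 0 < r) (hr1 : r < 1)
    (hdeg : ∀ v, (H.neighborSet v).ncard ≤ 2) (hc : ∀ c : H.ConnectedComponent, c.supp.ncard ≤ 23)
    (hW : ∀ u y, H.Adj u y → u ∉ W) (hx : x ∉ W) : (sliceAt ε W H x r).Valid where
  r_pos := hr0
  r_lt_one := hr1
  ε_nonneg := hε
  γ_nonneg := gam_nonneg hr0.le
  γ₂_nonneg := gamTwo_nonneg hr0.le
  w_pos := by norm_num [sliceAt]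
  root_notMem := hx
  notMem_of_adj := hW
  γ₂_le := by
    change ε * gamTwo r ≤ 1 - r
    rcases le_total r (1 / 2) with h | h
    · rw [gamTwo_eq h]
      have h1 := cube_mul_sq_le hr0.le h
      have h2 : 0 ≤ r ^ 3 * (1 - 2 * r) ^ 2 := by positivity
      nlinarith
    · rw [gamTwo_of_ge h]
      linarith
  le_comp c A := by
    refine le_one_add_mul_compSum (x := x) hε hε' hr0 hr1 hdeg (hc c) (fun u y huy hu => ?_) ?_
    · have := hW u y huy
      cases h : A u <;> simp [Slice.z, Slice.val, sliceAt, hu, this, h]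
    · simp [Slice.z, Slice.val, sliceAt]
  le_comp_update c A a := by
    refine le_one_add_mul_compSum (x := x) hε hε' hr0 hr1 hdeg (hc c) (fun u y huy hu => ?_) ?_
    · by_cases hua : u = a
      · subst hua
        simp
      · have := hW u y huy
        cases h : A u <;> simp [Slice.z, Slice.val, sliceAt, hu, this, h, hua]
    · by_cases hxa : x = a
      · subst hxa
        simp
      · simp [Slice.z, Slice.val, sliceAt, hxa]

end

/-- The slices with `r < 1/2` satisfy the estimates of `Slice.Budget`; the factor `17/14` is
`51/50` divided by `21/25`. -/
theorem sliceAt_budget {V : Type} {ε r : ℝ} {W : Set V} {H : SimpleGraph V} {x : V}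
    (hε : 0 ≤ ε) (hε' : ε ≤ 1 / 10) (hr0 : 0 < r) (hr : r < 1 / 2) :
    (sliceAt ε W H x r).Budget (r / (1 - r))
      (17 / 7 * ε * (r ^ 2 * (1 - 2 * r) ^ 3 / (1 - r) ^ 3))
      (17 / 14 * ε * (r * (1 - 2 * r) ^ 3 * max 0 (5 * r - 1) / (1 - r) ^ 2))
      ((1 + 2 * r) / 2) := by
  have h1 : 0 < 1 - r := by linarith
  have hu : 0 < 1 - 2 * r := by linarith
  have hm0 : 0 ≤ max 0 (5 * r - 1) := le_max_left _ _
  have hm1 : max 0 (5 * r - 1) ≤ 3 * r := max_le (by linarith) (by linarith)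
  have hP2 : 1 - (r / (1 - r)) ^ 2 = (1 - 2 * r) / (1 - r) ^ 2 := by field_simp; ring
  have hP1 : 1 - r / (1 - r) = (1 - 2 * r) / (1 - r) := by field_simp; ring
  have hP0 : 0 < r / (1 - r) := div_pos hr0 h1
  have hPr : r / (1 - r) ≤ 1 := by
    rw [div_le_iff₀ h1]
    linarith
  have hPl := sliceAt_pairLoss (ε := ε) (W := W) (H := H) (x := x) hr.le
  have hRl := sliceAt_rootLoss (ε := ε) (W := W) (H := H) (x := x) hr.le
  set m := max 0 (5 * r - 1)
  set E₁ := 17 / 7 * ε * (r ^ 2 * (1 - 2 * r) ^ 3 / (1 - r) ^ 3) with hE₁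
  set E₂ := 17 / 14 * ε * (r * (1 - 2 * r) ^ 3 * m / (1 - r) ^ 2) with hE₂
  have hPl0 : 0 ≤ (sliceAt ε W H x r).pairLoss := by rw [hPl]; positivity
  have hRl0 : 0 ≤ (sliceAt ε W H x r).rootLoss := by rw [hRl]; positivity
  have hg2 : gamTwo r = 25 * r ^ 3 * (1 - 2 * r) ^ 2 := gamTwo_eq hr.le
  have hg0 : 0 ≤ ε * gamTwo r := mul_nonneg hε (gamTwo_nonneg hr0.le)
  have h125 := cube_mul_sq_le hr0.le hr.le
  -- all estimates follow from a common bound on the total loss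
  set B := r ^ 2 * (1 - 2 * r) ^ 3 / (1 - r) ^ 2 with hB
  have hB0 : 0 ≤ B := by positivity
  have hT : E₁ + 2 * E₂ ≤ 85 / 7 * ε * B := total_loss_le hε hr0 hr hm1
  have hT' : E₁ + 2 * E₂ ≤ 17 / 14 * B := by
    refine hT.trans (mul_le_mul_of_nonneg_right (by linarith) hB0)
  have hℓ : 2 * (sliceAt ε W H x r).pairLoss + (sliceAt ε W H x r).rootLoss ≤
      1 / 4 * (r * (1 - 2 * r)) := by
    rw [hPl, hRl]
    exact node_loss_le hε hε' hr0 hr hm1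
  have hru : 0 < r * (1 - 2 * r) := mul_pos hr0 hu
  refine
    { P_eq := mul_div_cancel₀ _ h1.ne'
      P_pos := hP0
      P_le := hPr
      r_pos := hr0
      E₁_nonneg := by positivity
      E₂_nonneg := by positivity
      pairLoss_nonneg := hPl0
      rootLoss_nonneg := hRl0
      two_r_le := by change 2 * r ≤ 1; linarith
      pair_le := ?_
      root_le := ?_
      gain := ?_
      gain_nonneg := hg0
      gain_le := ?_
      second_order := ?_
      small := ?_
      small' := ?_
      rate := ?_
      loss_le := ?_ }
  · change _ + 2 * r * E₁ ≤ E₁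
    rw [hP2, hPl, hE₁]
    apply le_of_eq
    field_simp
    ring
  · rw [hP2, hRl, hE₂]
    apply le_of_eq
    field_simp
    ring
  · change 2 * r * (E₁ + 2 * E₂) ≤ ε * gamTwo r * _
    have e : ε * gamTwo r * (1 - (r / (1 - r)) ^ 2) = 25 * ε * r * B := by
      rw [hP2, hg2, hB]
      generalize 1 - r = s
      ring
    rw [e]
    have h0 := mul_le_mul_of_nonneg_left hT hr0.le
    have h2 : 0 ≤ ε * r * B := by positivity
    linarith
  · change r + ε * gamTwo r ≤ 1
    rw [hg2]
    have h2 : 0 ≤ r ^ 3 * (1 - 2 * r) ^ 2 := by positivity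
    nlinarith
  · have e : 1 / 50 * (1 - (r / (1 - r)) ^ 2) =
        1 / 50 * ((1 - 2 * r) / (1 - r) ^ 3) * (1 - r) := by
      rw [hP2]
      field_simp
    have e' : 2 * (r / (1 - r)) * (17 / 14 * B) =
        17 / 7 * ((1 - 2 * r) / (1 - r) ^ 3) * (r ^ 3 * (1 - 2 * r) ^ 2) := by
      rw [hB]
      generalize 1 - r = s
      ring
    have h0 := mul_le_mul_of_nonneg_left hT' (mul_nonneg zero_le_two hP0.le)
    have h2 : 0 ≤ (1 - 2 * r) / (1 - r) ^ 3 := by positivity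
    have h3 := mul_le_mul_of_nonneg_left h125 h2
    have h4 : 0 ≤ r ^ 3 * (1 - 2 * r) ^ 2 := by positivity
    have h5 := mul_nonneg h2 h4
    linarith
  · have h0 := mul_cube_le hr0.le hr.le
    have e : B = r / (1 - r) * (r * (1 - 2 * r) ^ 3 / (1 - r)) := by
      rw [hB]
      generalize 1 - r = s
      ring
    have h2 : r * (1 - 2 * r) ^ 3 / (1 - r) ≤ 1 / 16 := by
      rwa [div_le_iff₀ h1]
    have h3 := mul_le_mul_of_nonneg_left h2 hP0.le
    linarith
  · rw [hP1]
    have e : B = (1 - 2 * r) / (1 - r) * (r / (1 - r) * (r * (1 - 2 * r) ^ 2)) := by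
      rw [hB]
      generalize 1 - r = s
      ring
    have h2 : r / (1 - r) * (r * (1 - 2 * r) ^ 2) ≤ 1 / 4 := by
      have h3 : r * (1 - 2 * r) ^ 2 ≤ 1 / 4 := by nlinarith
      have h4 : 0 ≤ r * (1 - 2 * r) ^ 2 := by positivity
      nlinarith
    have h3 : 0 ≤ (1 - 2 * r) / (1 - r) := by positivity
    have h4 := mul_le_mul_of_nonneg_left h2 h3
    linarith
  · change 2 * (r + _) ≤ _
    have h6 := mul_le_mul hℓ hPr hP0.le (by positivity)
    have h7 := mul_nonneg hu.le h1.le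
    linarith
  · change _ ≤ r
    have h7 := mul_pos hr0 hr0
    linarith

/-! ### The probability of a cut as an integral over the place of the root variable -/

/-- The event `Cut(T_x)` as a function of the pattern of the placement. -/
def CutPattern {V : Type} (canon : V → Clause V) (pick : List V → Clause V) (x : V) (h : ℕ)
    (A : V → Bool) : Prop :=
  ∀ p ∈ level canon pick x h, ∃ v ∈ p.dropLast, A v = true

theorem sliceAt_val_true {V : Type} (ε : ℝ) (W : Set V) (H : SimpleGraph V) (x : V) (r : ℝ)
    (y : V) : (sliceAt ε W H x r).val y true =
      if y = x then phi r else (if y ∈ W then gamTwo r else gam r) / r := rfl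

theorem sliceAt_val_false {V : Type} (ε : ℝ) (W : Set V) (H : SimpleGraph V) (x : V) (r : ℝ)
    (y : V) : (sliceAt ε W H x r).val y false =
      if y = x then phi r else -((if y ∈ W then gamTwo r else gam r) / (1 - r)) := rfl

theorem one_sub_mul_le_prod {ι : Type*} {s : Finset ι} (hs : s.card ≤ 2) {L : ι → ℝ} {Λ : ℝ}
    (hΛ : 0 ≤ Λ) (h0 : ∀ i ∈ s, 0 ≤ L i) (h1 : ∀ i ∈ s, L i ≤ 1) (h : ∀ i ∈ s, 1 - Λ ≤ L i) :
    1 - 2 * Λ ≤ ∏ i ∈ s, L i := by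
  have key : 1 - ∑ i ∈ s, (1 - L i) ≤ ∏ i ∈ s, L i := by
    clear hs h
    induction s using Finset.induction_on with
    | empty => simp
    | insert i s hi ih =>
      have ih := ih (fun j hj => h0 j (Finset.mem_insert_of_mem hj))
        fun j hj => h1 j (Finset.mem_insert_of_mem hj)
      have hs1 : ∏ j ∈ s, L j ≤ 1 := Finset.prod_le_one
        (fun j hj => h0 j (Finset.mem_insert_of_mem hj))
        fun j hj => h1 j (Finset.mem_insert_of_mem hj)
      have hi1 := h1 i (Finset.mem_insert_self i s)
      rw [Finset.sum_insert hi, Finset.prod_insert hi]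
      nlinarith [mul_nonneg (sub_nonneg.2 hi1) (sub_nonneg.2 hs1)]
  have h2 : ∑ i ∈ s, (1 - L i) ≤ s.card • Λ :=
    Finset.sum_le_card_nsmul _ _ _ fun i hi => by linarith [h i hi]
  have h3 : (s.card : ℝ) ≤ 2 := by exact_mod_cast hs
  rw [nsmul_eq_mul] at h2
  nlinarith

section

variable {V : Type} {F : Finset (Clause V)} {canon : V → Clause V} {pick : List V → Clause V}
  {x : V} {h : ℕ}

theorem cut_update_iff (hcanon : IsCanonicalChoice F canon) (hpick : IsClauseChoice F pick)
    (π : V → ℝ) (r : ℝ) :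
    Cut canon pick x h (Function.update π x r) ↔ CutPattern canon pick x h (pat r π) := by
  refine forall₂_congr fun p hp => exists_congr fun v => and_congr_right fun hv => ?_
  have hvx : v ≠ x := by
    rintro rfl
    exact root_notMem_dropLast hcanon hpick hp hv
  simp [pat, hvx]

theorem measurableSet_cut : MeasurableSet {π | Cut canon pick x h π} := by
  have : {π | Cut canon pick x h π} =
      ⋂ p ∈ level canon pick x h, ⋃ v ∈ p.dropLast.toFinset, {π : V → ℝ | π v < π x} := by
    ext π
    simp [Cut]
  rw [this]
  exact Finset.measurableSet_biInter _ fun p _ => Finset.measurableSet_biUnion _ fun v _ =>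
    measurableSet_lt (measurable_pi_apply v) (measurable_pi_apply x)

/-- The indicator function of a cut dominates the product of those of its parts. -/
theorem prod_cutInd_le (k : ℕ) (A : V → Bool) :
    ∏ w ∈ children canon pick [x], cutInd (children canon pick) k w A ≤
      if CutPattern canon pick x (k + 1) A then 1 else 0 := by
  split_ifs with hA
  · exact Finset.prod_le_one (fun w _ => (cutInd_mem _ _ _ _).1) fun w _ => (cutInd_mem _ _ _ _).2
  · unfold CutPattern at hA
    push Not at hA
    obtain ⟨p, hp, hA⟩ := hA
    have hA' : ∀ v ∈ p.dropLast, A v = false := fun v hv => by simpa using hA v hv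
    have h0 : cutInd (children canon pick) 0 p A = 0 := by
      have hlen := length_of_mem_level hp
      match p, hlen with
      | a :: b :: q, _ =>
        have := hA' a (by simp)
        simp [cutInd, headPlaced, placed, this]
    have := prod_cutInd_eq_zero hp hA' h0
    rw [zero_add] at this
    exact this.le

/-- For a slice without correlations, the probability that a node is not cut shrinks by the
factor `2 (1 - r)` with every level. -/
theorem cutBound_ge_of_ge_half (h3 : IsThreeCNF F) (hF : UniquelySat F)
    (hcanon : IsCanonicalChoice F canon) (hpick : IsClauseChoice F pick) {D : Slice V}
    (hr0 : 0 ≤ D.r) (hr1 : D.r ≤ 1) (hpr : ∀ p, p ≠ [] → D.pr p = D.r) (k : ℕ) {p : List V}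
    (hp : IsNode canon pick D.x p) :
    1 - (2 * (1 - D.r)) ^ k ≤ D.cutBound (children canon pick) k p := by
  have hne : ∀ p, IsNode canon pick D.x p → p ≠ [] := by
    intro p hp
    obtain ⟨a, q, rfl, -⟩ := IsNode.eq_cons hcanon hpick p hp
    simp
  have hpr' : ∀ p, IsNode canon pick D.x p → 0 ≤ D.pr p ∧ D.pr p ≤ 1 := fun p hp => by
    rw [hpr p (hne p hp)]
    exact ⟨hr0, hr1⟩
  induction k generalizing p with
  | zero => simpa using (Slice.cutBound_mem IsNode.child hpr' 0 hp).1
  | succ k ih =>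
    have hΛ : 0 ≤ (2 * (1 - D.r)) ^ k := pow_nonneg (by linarith) k
    have hc := fun w hw => Slice.cutBound_mem IsNode.child hpr' k (IsNode.child p hp w hw)
    have hprod := one_sub_mul_le_prod (IsNode.card_children_le h3 hF hcanon hpick p hp) hΛ
      (fun w hw => (hc w hw).1) (fun w hw => (hc w hw).2)
      fun w hw => ih (IsNode.child p hp w hw)
    have e : D.cutBound (children canon pick) (k + 1) p = D.pr p + (1 - D.pr p) *
      ∏ w ∈ children canon pick p, D.cutBound (children canon pick) k w := rfl
    rw [e, hpr p (hne p hp), pow_succ']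
    have := mul_le_mul_of_nonneg_left hprod (sub_nonneg.2 hr1)
    linarith

variable [Fintype V] {ε : ℝ} {W : Set V} {H : SimpleGraph V}

theorem continuous_densityD (hW : ∀ u y, H.Adj u y → u ∉ W) : Continuous (densityD ε W H) := by
  rw [funext (densityD_eq hW)]
  refine (continuous_densPoly ε W H).comp (continuous_pi fun v => ?_)
  split_ifs
  · exact continuous_phiTwo.comp (continuous_apply v)
  · exact continuous_phi.comp (continuous_apply v)

theorem integrable_densityD (hW : ∀ u y, H.Adj u y → u ∉ W) :
    Integrable (densityD ε W H) (cube V) := by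
  have hc : IsCompact (Set.univ.pi fun _ : V => Set.Icc (0 : ℝ) 1) :=
    isCompact_univ_pi fun _ => isCompact_Icc
  obtain ⟨C, hC⟩ := hc.exists_bound_of_continuousOn (continuous_densityD (ε := ε) hW).continuousOn
  exact integrable_cube (continuous_densityD hW).measurable C fun π hπ =>
    hC π fun v _ => hπ v

/-- Conditional on the place `r` of a variable outside `TwoCC`, the pattern of the other variables
has the density `Slice.wt`. -/
theorem integral_densityD_update (hW : ∀ u y, H.Adj u y → u ∉ W) (hx : x ∉ W) {r : ℝ}
    (h0 : 0 < r) (h1 : r < 1) (Φ : (V → Bool) → ℝ) :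
    ∫ π, densityD ε W H (Function.update π x r) * Φ (pat r π) ∂cube V =
      expect r fun A => (sliceAt ε W H x r).wt A * Φ A := by
  have h2 : 0 < 1 - r := by linarith
  have key := integral_multiAffine h0.le h1.le (multiAffine_densPoly (ε := ε) hW)
    (continuous_densPoly ε W H)
    (fun y => if y = x then fun _ => phi r else if y ∈ W then phiTwo else phi)
    (fun y => by
      split_ifs
      · exact continuous_const
      · exact continuous_phiTwo
      · exact continuous_phi)
    (sliceAt ε W H x r).val
    (fun y => by
      rw [sliceAt_val_true]
      split_ifs with hy hyW
      · simp
      · rw [integral_phiTwo, mul_div_cancel₀ _ h0.ne']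
        simp [gamTwo]
      · rw [integral_phi, mul_div_cancel₀ _ h0.ne']
        simp [gam])
    (fun y => by
      rw [sliceAt_val_false]
      split_ifs with hy hyW
      · simp
      · rw [integral_phiTwo, mul_neg, mul_div_cancel₀ _ h2.ne', gamTwo_of_ge (r := 1) (by norm_num),
          zero_sub]
      · rw [integral_phi, mul_neg, mul_div_cancel₀ _ h2.ne', gam_of_ge (r := 1) (by norm_num),
          zero_sub])
    Φ
  refine Eq.trans ?_ key
  refine integral_congr_ae (Filter.Eventually.of_forall fun π => ?_)
  simp only
  rw [densityD_eq hW]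
  congr 2
  ext y
  by_cases hy : y = x
  · subst hy
    simp [hx]
  · simp only [Function.update_of_ne hy, if_neg hy]
    split_ifs <;> rfl

/-- The probability of a cut is at least the integral, over the place `r` of the root, of the
expectation of the cut pattern under the law given by the slice at `r`. -/
theorem exists_integral_le_distD (hcanon : IsCanonicalChoice F canon)
    (hpick : IsClauseChoice F pick) (hW : ∀ u y, H.Adj u y → u ∉ W) (hx : x ∉ W) :
    ∃ J : ℝ → ℝ, IntervalIntegrable J volume 0 1 ∧
      ∫ r in (0 : ℝ)..1, J r ≤ (distD ε W H).real {π | Cut canon pick x h π} ∧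
      ∀ r, 0 < r → r < 1 → J r = expect r fun A => (sliceAt ε W H x r).wt A *
        if CutPattern canon pick x h A then 1 else 0 := by
  set s := {π | Cut canon pick x h π} with hs
  set f : (V → ℝ) → ℝ := s.indicator (densityD ε W H) with hf
  have hi := integrable_densityD (ε := ε) hW
  have hfi : Integrable f (cube V) := hi.indicator measurableSet_cut
  obtain ⟨h1, h2⟩ := integral_resample' x hfi
  refine ⟨fun t => ∫ π, f (Function.update π x t) ∂cube V, ?_, ?_, ?_⟩
  · rw [intervalIntegrable_iff_integrableOn_Icc_of_le zero_le_one]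
    exact h1
  · rw [intervalIntegral.integral_of_le zero_le_one, ← integral_Icc_eq_integral_Ioc]
    refine le_trans (le_of_eq h2.symm) ?_
    rw [hf, integral_indicator measurableSet_cut,
      integral_eq_lintegral_pos_part_sub_lintegral_neg_part hi.integrableOn]
    have : (distD ε W H).real s =
        (∫⁻ π in s, ENNReal.ofReal (densityD ε W H π) ∂cube V).toReal := by
      rw [Measure.real, distD, withDensity_apply _ measurableSet_cut]
      rfl
    rw [this]
    -- the measure is built from the positive part of the density only
    exact sub_le_self _ ENNReal.toReal_nonneg
  · intro r h0 h1
    rw [← integral_densityD_update hW hx h0 h1]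
    refine integral_congr_ae (Filter.Eventually.of_forall fun π => ?_)
    simp only [hf, Set.indicator, hs, Set.mem_ofPred_eq, cut_update_iff hcanon hpick]
    split_ifs <;> simp

/-- A lower bound on the conditional probability of a cut, given that the root is placed at `r`. -/
theorem expect_cutPattern_ge (hcanon : IsCanonicalChoice F canon) (hpick : IsClauseChoice F pick)
    {D : Slice V} (hD : D.Valid)
    (hpr : ∀ p, IsNode canon pick D.x p → 0 ≤ D.pr p ∧ D.pr p ≤ 1) (k : ℕ) :
    ∏ w ∈ children canon pick [D.x], D.cutBound (children canon pick) k w ≤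
      expect D.r fun A => D.wt A * if CutPattern canon pick D.x (k + 1) A then 1 else 0 := by
  refine (Slice.expect_root_ge hD IsNode.child hpr (IsNode.eq_cons hcanon hpick)
    (fun p _ => eq_cons_of_mem_children p) (fun w hw => ?_) k).trans (expect_mono _ fun A =>
      mul_le_mul_of_nonneg_left (prod_cutInd_le k A) (hD.wt_nonneg A))
  refine ⟨⟨0, by rwa [children_root]⟩, ?_⟩
  obtain ⟨y, -, rfl⟩ := mem_children.1 hw
  exact ⟨y, rfl⟩

end

/-! ### The loss in terms of label densities -/

/-- Bounds on the coefficients with which the label densities at the nodes of depth `d` enter the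
loss, multiplied by `2 ^ d`. The numerator `2707/5000` is an upper bound on `4 * exp (-2)`. -/
noncomputable def lossCoeff : ℕ → ℝ
  | 0 => 9 / 40
  | 1 => 43 / 1000
  | d + 2 => 2707 / 5000 / ((d + 7 / 2) * (d + 9 / 2))

theorem lossCoeff_nonneg (d : ℕ) : 0 ≤ lossCoeff d := by
  match d with
  | 0 => norm_num [lossCoeff]
  | 1 => norm_num [lossCoeff]
  | d + 2 =>
    unfold lossCoeff
    positivity

theorem sum_lossCoeff_le (n : ℕ) : ∑ d ∈ Finset.range n, lossCoeff d ≤ 4227 / 10000 := by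
  have key : ∀ n : ℕ, ∑ d ∈ Finset.range (n + 2), lossCoeff d =
      9 / 40 + 43 / 1000 + 2707 / 5000 * (2 / 7 - 1 / (n + 7 / 2)) := by
    intro n
    induction n with
    | zero =>
      rw [Finset.sum_range_succ, Finset.sum_range_one]
      norm_num [lossCoeff]
    | succ n ih =>
      rw [Finset.sum_range_succ, ih, lossCoeff]
      push_cast
      have h1 : (n : ℝ) + 7 / 2 ≠ 0 := by positivity
      have h2 : (n : ℝ) + 9 / 2 ≠ 0 := by positivity
      have h3 : (n : ℝ) + 1 + 7 / 2 ≠ 0 := by positivity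
      field_simp
      ring
  have h1 : ∑ d ∈ Finset.range n, lossCoeff d ≤ ∑ d ∈ Finset.range (n + 2), lossCoeff d :=
    Finset.sum_le_sum_of_subset_of_nonneg (Finset.range_subset_range.2 (by omega))
      fun d _ _ => lossCoeff_nonneg d
  rw [key] at h1
  have : (0 : ℝ) ≤ 1 / (n + 7 / 2) := by positivity
  linarith

theorem sq_mul_exp_neg_le {x : ℝ} (hx : 0 ≤ x) : x ^ 2 * Real.exp (-x) ≤ 2707 / 5000 := by
  have h1 : x / 2 ≤ Real.exp (x / 2 - 1) := by
    have := Real.add_one_le_exp (x / 2 - 1)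
    linarith
  have h2 : (x / 2) ^ 2 ≤ Real.exp (x / 2 - 1) ^ 2 := pow_le_pow_left₀ (by linarith) h1 2
  have h3 : Real.exp (x / 2 - 1) ^ 2 * Real.exp (-x) * Real.exp 1 ^ 2 = 1 := by
    rw [← Real.exp_nat_mul, ← Real.exp_nat_mul, ← Real.exp_add, ← Real.exp_add, Real.exp_eq_one_iff]
    push_cast
    ring
  have h4 := Real.exp_one_gt_d9
  have h5 : (7389 / 1000 : ℝ) ≤ Real.exp 1 ^ 2 := by nlinarith
  have h6 := Real.exp_pos (-x)
  have h7 := mul_le_mul_of_nonneg_right h2 h6.le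
  have h8 : 0 ≤ Real.exp (x / 2 - 1) ^ 2 * Real.exp (-x) := by positivity
  nlinarith

theorem one_sub_le_mul_exp {u : ℝ} (h0 : 0 ≤ u) (h1 : u ≤ 1) :
    1 - u ≤ (1 + u) * Real.exp (-(2 * u)) := by
  rcases h1.eq_or_lt with rfl | h1
  · norm_num
    positivity
  have hu : 0 < 1 - u := by linarith
  have h2 := Real.le_log_one_add_of_nonneg (x := 2 * u / (1 - u)) (by positivity)
  have e1 : 2 * (2 * u / (1 - u)) / (2 * u / (1 - u) + 2) = 2 * u := by
    field_simp
    ring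
  have e2 : 1 + 2 * u / (1 - u) = (1 + u) / (1 - u) := by
    field_simp
    ring
  rw [e1, e2, Real.le_log_iff_exp_le (by positivity), le_div_iff₀ hu] at h2
  have h3 := mul_le_mul_of_nonneg_right h2 (Real.exp_pos (-(2 * u))).le
  have e3 : Real.exp (2 * u) * Real.exp (-(2 * u)) = 1 := by rw [← Real.exp_add]; simp
  linear_combination h3 - (1 - u) * e3

/-- The weight of the pairs at depth `e = d + 1`, for `s = 2 r`. If `e ≥ 2`, the weight
`s ^ (e + 1) * (1 - s) ^ 2 / (2 - s)` is at most `u ^ 2 * exp (-(e + 2) * u)` with `u = 1 - s`. -/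
theorem weight_le {s : ℝ} (h0 : 0 ≤ s) (h1 : s ≤ 1) (d : ℕ) :
    s ^ (d + 2) * (1 - s) ^ 2 ≤ lossCoeff (d + 1) * (2 - s) := by
  match d with
  | 0 =>
    rw [lossCoeff]
    nlinarith [sq_nonneg (s - 11 / 20), sq_nonneg (s * (s - 11 / 20)),
      mul_nonneg h0 (sub_nonneg.2 h1), mul_nonneg h0 (sq_nonneg (s - 11 / 20)),
      sq_nonneg (s ^ 2 - s + 1 / 4)]
  | d + 1 =>
    rw [lossCoeff]
    obtain ⟨u, rfl⟩ : ∃ u, s = 1 - u := ⟨1 - s, by ring⟩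
    have hu0 : 0 ≤ u := by linarith
    have e1 := one_sub_le_mul_exp hu0 (by linarith)
    have e2 : (1 - u) ^ (d + 2) ≤ Real.exp (-((d + 2) * u)) := by
      have := pow_le_pow_left₀ h0 (Real.one_sub_le_exp_neg u) (d + 2)
      refine this.trans (le_of_eq ?_)
      rw [← Real.exp_nat_mul]
      push_cast
      ring_nf
    have e3 : (1 - u) ^ (d + 3) ≤ (1 + u) * Real.exp (-((d + 4) * u)) := by
      have := mul_le_mul e1 e2 (pow_nonneg h0 _) (by positivity)
      rw [mul_assoc (1 + u), ← Real.exp_add] at this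
      refine (le_of_eq (by ring)).trans (this.trans (le_of_eq ?_))
      ring_nf
    have e4 := sq_mul_exp_neg_le (x := (d + 4) * u) (by positivity)
    have hd : (0 : ℝ) < (d + 7 / 2) * (d + 9 / 2) := by positivity
    have e5 : ((d : ℝ) + 7 / 2) * (d + 9 / 2) ≤ (d + 4) ^ 2 := by nlinarith
    rw [div_mul_eq_mul_div, le_div_iff₀ hd]
    have e6 := mul_le_mul_of_nonneg_right e3 (sq_nonneg ((d + 4) * u))
    have e7 := mul_le_mul_of_nonneg_left e4 (show 0 ≤ 1 + u by linarith)
    have e8 := mul_le_mul_of_nonneg_left e5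
      (show 0 ≤ (1 - u) ^ (d + 3) * u ^ 2 from mul_nonneg (pow_nonneg h0 _) (sq_nonneg u))
    have e9 : (1 - u) ^ (d + 1 + 2) = (1 - u) ^ (d + 3) := rfl
    rw [e9]
    linarith

theorem pair_weight_le {r : ℝ} (h0 : 0 ≤ r) (h1 : r ≤ 1 / 2) (d : ℕ) :
    r ^ (d + 1) * (r * (1 - 2 * r) ^ 2 / (1 - r)) ≤ (1 / 2) ^ (d + 1) * lossCoeff (d + 1) := by
  have h := weight_le (s := 2 * r) (by linarith) (by linarith) d
  have h2 : 0 < 1 - r := by linarith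
  have h3 : (0 : ℝ) < 2 ^ (d + 1) := by positivity
  rw [mul_div_assoc', div_le_iff₀ h2, one_div_pow, ← mul_le_mul_iff_right₀ h3]
  have e : (2 * r) ^ (d + 2) = 2 * (2 ^ (d + 1) * r ^ (d + 1) * r) := by
    rw [mul_pow]
    ring
  rw [e] at h
  have e' : (2 : ℝ) ^ (d + 1) * (1 / 2 ^ (d + 1) * lossCoeff (d + 1) * (1 - r)) =
      lossCoeff (d + 1) * (1 - r) := by
    field_simp
  rw [e']
  linarith

theorem root_weight_le (r : ℝ) :
    max 0 (5 * r - 1) * (1 - 2 * r) ≤ lossCoeff 0 := by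
  rw [lossCoeff]
  rcases max_cases 0 (5 * r - 1) with ⟨h, -⟩ | ⟨h, -⟩ <;> rw [h]
  · norm_num
  · nlinarith [sq_nonneg (r - 7 / 20)]

section

variable {V : Type} {canon : V → Clause V} {pick : List V → Clause V} {W : Set V}
  {H : SimpleGraph V} {x : V} {h : ℕ}

theorem continuousOn_labelDensityAt (a b : V) :
    ContinuousOn (labelDensityAt canon pick W h b a) (Set.Icc 0 (1 / 2)) := by
  unfold labelDensityAt
  refine ContinuousOn.mul (ContinuousOn.div (by fun_prop) (by fun_prop) fun r hr => ?_)
    (by fun_prop)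
  have : 0 < 1 - r := by linarith [hr.2]
  positivity

theorem labelDensityAt_nonneg (a b : V) {r : ℝ} (h0 : 0 ≤ r) (h1 : r ≤ 1 / 2) :
    0 ≤ labelDensityAt canon pick W h b a r := by
  have : 0 < 1 - r := by linarith
  exact mul_nonneg (by positivity) (Finset.sum_nonneg fun d _ => Finset.sum_nonneg fun p _ =>
    pow_nonneg h0 _)

variable [Fintype V]

/-- The label densities of the neighbours of the labels of depth `d`, each in the tree of that
label. -/
noncomputable def adjDensity (canon : V → Clause V) (pick : List V → Clause V) (W : Set V)
    (H : SimpleGraph V) (h : ℕ) (x : V) (d : ℕ) (r : ℝ) : ℝ :=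
  ∑ t ∈ level canon pick x d, ∑ b ∈ Finset.univ.filter (H.Adj (t.getD 0 x)),
    labelDensityAt canon pick W h b (t.getD 0 x) r

theorem continuousOn_adjDensity (d : ℕ) :
    ContinuousOn (adjDensity canon pick W H h x d) (Set.Icc 0 (1 / 2)) :=
  continuousOn_finsetSum _ fun _ _ => continuousOn_finsetSum _ fun _ _ =>
    continuousOn_labelDensityAt _ _

theorem adjDensity_nonneg (d : ℕ) {r : ℝ} (h0 : 0 ≤ r) (h1 : r ≤ 1 / 2) :
    0 ≤ adjDensity canon pick W H h x d r :=
  Finset.sum_nonneg fun _ _ => Finset.sum_nonneg fun _ _ => labelDensityAt_nonneg _ _ h0 h1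

theorem adjDensity_eq (d : ℕ) (r : ℝ) :
    adjDensity canon pick W H h x d r = (1 - 2 * r) ^ 2 / (1 - r) ^ 3 * r *
      ∑ t ∈ level canon pick x d, ∑ b ∈ Finset.univ.filter (H.Adj (t.getD 0 x)),
        canonSum canon pick W h r b (t.getD 0 x) := by
  rw [adjDensity, Finset.mul_sum]
  refine Finset.sum_congr rfl fun t _ => ?_
  rw [Finset.mul_sum]
  refine Finset.sum_congr rfl fun b _ => ?_
  rw [labelDensityAt_eq]
  ring

theorem adjDensity_zero (r : ℝ) :
    adjDensity canon pick W H h x 0 r = (1 - 2 * r) ^ 2 / (1 - r) ^ 3 * r *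
      ∑ b ∈ Finset.univ.filter (H.Adj x), canonSum canon pick W h r b x := by
  rw [adjDensity_eq, level, Finset.sum_singleton]
  rfl

theorem integral_adjDensity_le {F : Finset (Clause V)} {Thr : ℝ} (h3 : IsThreeCNF F)
    (hF : UniquelySat F) (hcanon : IsCanonicalChoice F canon) (hpick : IsClauseChoice F pick)
    (hThr : 0 ≤ Thr) (hH : IsLowGraph canon pick W h Thr H) (d : ℕ) :
    ∫ r in (0 : ℝ)..(1 / 2), adjDensity canon pick W H h x d r ≤ 2 ^ d * (2 * Thr) := by
  have hint : ∀ a b, IntervalIntegrable (labelDensityAt canon pick W h b a) volume 0 (1 / 2) :=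
    fun a b => ContinuousOn.intervalIntegrable (by
      rw [Set.uIcc_of_le (by norm_num)]
      exact continuousOn_labelDensityAt a b)
  unfold adjDensity
  rw [intervalIntegral.integral_finsetSum fun t _ => ContinuousOn.intervalIntegrable (by
    rw [Set.uIcc_of_le (by norm_num)]
    exact continuousOn_finsetSum _ fun _ _ => continuousOn_labelDensityAt _ _)]
  have h1 : ∀ t ∈ level canon pick x d, ∫ r in (0 : ℝ)..(1 / 2),
      ∑ b ∈ Finset.univ.filter (H.Adj (t.getD 0 x)),
        labelDensityAt canon pick W h b (t.getD 0 x) r ≤ 2 * Thr := by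
    intro t _
    rw [intervalIntegral.integral_finsetSum fun b _ => hint _ b]
    refine le_trans (Finset.sum_le_sum (g := fun _ => Thr) fun b hb => ?_) ?_
    · exact hH.density_le _ b (Finset.mem_filter.1 hb).2
    · rw [Finset.sum_filter]
      exact sum_adj_le hH.degree_le _ hThr
  refine (Finset.sum_le_card_nsmul _ _ _ h1).trans ?_
  rw [nsmul_eq_mul]
  refine mul_le_mul_of_nonneg_right ?_ (by positivity)
  exact_mod_cast card_level_le h3 hF hcanon hpick x d

/-- The loss at the place `r` of the root, as a function of the label densities. -/
noncomputable def totalLoss (canon : V → Clause V) (pick : List V → Clause V) (W : Set V)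
    (H : SimpleGraph V) (h : ℕ) (x : V) (r : ℝ) : ℝ :=
  ∑ d ∈ Finset.range (h + 1), (1 / 2) ^ d * lossCoeff d * adjDensity canon pick W H h x d r

theorem continuousOn_totalLoss :
    ContinuousOn (totalLoss canon pick W H h x) (Set.Icc 0 (1 / 2)) :=
  continuousOn_finsetSum _ fun d _ => continuousOn_const.mul (continuousOn_adjDensity d)

theorem integral_totalLoss_le {F : Finset (Clause V)} {Thr : ℝ} (h3 : IsThreeCNF F)
    (hF : UniquelySat F) (hcanon : IsCanonicalChoice F canon) (hpick : IsClauseChoice F pick)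
    (hThr : 0 ≤ Thr) (hH : IsLowGraph canon pick W h Thr H) :
    ∫ r in (0 : ℝ)..(1 / 2), totalLoss canon pick W H h x r ≤ 4227 / 5000 * Thr := by
  unfold totalLoss
  rw [intervalIntegral.integral_finsetSum fun d _ => ContinuousOn.intervalIntegrable (by
    rw [Set.uIcc_of_le (by norm_num)]
    exact continuousOn_const.mul (continuousOn_adjDensity d))]
  have h1 : ∀ d ∈ Finset.range (h + 1), ∫ r in (0 : ℝ)..(1 / 2),
      (1 / 2) ^ d * lossCoeff d * adjDensity canon pick W H h x d r ≤
      lossCoeff d * (2 * Thr) := by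
    intro d _
    rw [intervalIntegral.integral_const_mul]
    have := mul_le_mul_of_nonneg_left (integral_adjDensity_le (x := x) h3 hF hcanon hpick hThr hH d)
      (mul_nonneg (by positivity : (0 : ℝ) ≤ (1 / 2) ^ d) (lossCoeff_nonneg d))
    refine this.trans (le_of_eq ?_)
    have e : (1 / 2 : ℝ) ^ d * 2 ^ d = 1 := by rw [← mul_pow]; norm_num
    linear_combination lossCoeff d * (2 * Thr) * e
  refine (Finset.sum_le_sum h1).trans ?_
  rw [← Finset.sum_mul]
  have := mul_le_mul_of_nonneg_right (sum_lossCoeff_le (h + 1)) (mul_nonneg zero_le_two hThr)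
  linarith

/-- The bound on the probability of a cut for `r < 1/2`. -/
theorem prod_cutBound_ge_of_lt_half {F : Finset (Clause V)} {G : Set (Clause V)} {ε r : ℝ}
    (hε : 0 ≤ ε) (hε' : ε ≤ 1 / 10) (h0 : 0 < r) (hr : r < 1 / 2)
    (hdeg : ∀ v, (H.neighborSet v).ncard ≤ 2) (h3 : IsThreeCNF F) (hF : UniquelySat F)
    (hG : IsDerivedSet F G) (hcanon : IsCanonicalChoice F canon) (hpick : IsClauseChoice F pick)
    (hx : x ∉ TwoCC G) (k : ℕ) :
    (r / (1 - r)) ^ 2 - 17 / 14 * ε * totalLoss canon pick (TwoCC G) H (k + 1) x r -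
        2 * ((1 + 2 * r) / 2) ^ k ≤
      ∏ w ∈ children canon pick [x],
        (sliceAt ε (TwoCC G) H x r).cutBound (children canon pick) k w := by
  have hB := sliceAt_budget (W := TwoCC G) (H := H) (x := x) hε hε' h0 hr
  have h1 : 0 < 1 - r := by linarith
  have hu : 0 < 1 - 2 * r := by linarith
  refine le_trans ?_ (hB.root_ge hdeg h3 hF hG hcanon hpick rfl hx k)
  have hS := hB.sum_canonLoss_le hcanon hpick (k + 1)
  rw [sliceAt_pairLoss hr.le, sliceAt_rootLoss hr.le] at hS
  set S := ∑ d ∈ Finset.Ico 1 (k + 1 + 1), (sliceAt ε (TwoCC G) H x r).r ^ d *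
    ∑ p ∈ level canon pick (sliceAt ε (TwoCC G) H x r).x d,
      (sliceAt ε (TwoCC G) H x r).canonLoss canon pick p with hSdef
  set X := ∑ j ∈ Finset.range (k + 1), (sliceAt ε (TwoCC G) H x r).r ^ j *
    ∑ p ∈ level canon pick (sliceAt ε (TwoCC G) H x r).x (j + 1),
      (sliceAt ε (TwoCC G) H x r).canonLoss canon pick p with hXdef
  have hSX : S = r * X := by
    rw [hSdef, hXdef, Finset.sum_Ico_eq_sum_range, Finset.mul_sum]
    refine Finset.sum_congr rfl fun j _ => ?_
    rw [add_comm 1 j, pow_succ']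
    exact mul_assoc _ _ _
  change S ≤ 25 / 21 * ε * (r ^ 2 * (1 - 2 * r) ^ 3 / (1 - r)) *
    (∑ d ∈ Finset.Ico 1 (k + 1 + 1), r ^ d * ∑ t ∈ level canon pick x d,
        ∑ b ∈ Finset.univ.filter (H.Adj (t.getD 0 x)),
          canonSum canon pick (TwoCC G) (k + 1) r b (t.getD 0 x)) +
      25 / 21 * ε * (r * (1 - 2 * r) ^ 2 * max 0 (5 * r - 1)) *
        ∑ b ∈ Finset.univ.filter (H.Adj x), canonSum canon pick (TwoCC G) (k + 1) r b x at hS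
  set A := ∑ d ∈ Finset.Ico 1 (k + 1 + 1), r ^ d * ∑ t ∈ level canon pick x d,
        ∑ b ∈ Finset.univ.filter (H.Adj (t.getD 0 x)),
          canonSum canon pick (TwoCC G) (k + 1) r b (t.getD 0 x) with hA
  set B := ∑ b ∈ Finset.univ.filter (H.Adj x), canonSum canon pick (TwoCC G) (k + 1) r b x
    with hBdef
  set T := adjDensity canon pick (TwoCC G) H (k + 1) x with hT
  set q := (1 - 2 * r) ^ 2 / (1 - r) ^ 3 * r with hq
  have hA' : q * A = ∑ d ∈ Finset.Ico 1 (k + 1 + 1), r ^ d * T d r := by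
    rw [hA, Finset.mul_sum]
    refine Finset.sum_congr rfl fun d _ => ?_
    rw [hT, adjDensity_eq]
    ring
  have hB' : q * B = T 0 r := (adjDensity_zero r).symm
  have hloss : r * (1 - 2 * r) ^ 2 / (1 - r) * (q * A) +
      max 0 (5 * r - 1) * (1 - 2 * r) * (q * B) ≤
      totalLoss canon pick (TwoCC G) H (k + 1) x r := by
    rw [totalLoss, Finset.range_eq_Ico, Finset.sum_eq_sum_Ico_succ_bot (Nat.succ_pos _), hA', hB',
      Finset.mul_sum, add_comm]
    refine add_le_add ?_ (Finset.sum_le_sum fun d hd => ?_)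
    · rw [pow_zero, one_mul]
      exact mul_le_mul_of_nonneg_right (root_weight_le r) (adjDensity_nonneg 0 h0.le hr.le)
    · obtain ⟨j, rfl⟩ : ∃ j, d = j + 1 := ⟨d - 1, by have := (Finset.mem_Ico.1 hd).1; omega⟩
      have := mul_le_mul_of_nonneg_right (pair_weight_le h0.le hr.le j)
        (adjDensity_nonneg (canon := canon) (pick := pick) (W := TwoCC G) (H := H) (x := x)
          (h := k + 1) (j + 1) h0.le hr.le)
      refine le_trans (le_of_eq ?_) this
      ring
  have hP : r / (1 - r) * (X * ((1 - (r / (1 - r)) ^ 2) * (51 / 50))) =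
      (1 - 2 * r) / (1 - r) ^ 3 * (51 / 50) * S := by
    rw [hSX]
    field_simp
    ring
  have hP1 : r / (1 - r) ≤ 1 := by
    rw [div_le_iff₀ h1]
    linarith
  have hS' := mul_le_mul_of_nonneg_left hS
    (show 0 ≤ (1 - 2 * r) / (1 - r) ^ 3 * (51 / 50) by positivity)
  have e : (1 - 2 * r) / (1 - r) ^ 3 * (51 / 50) *
      (25 / 21 * ε * (r ^ 2 * (1 - 2 * r) ^ 3 / (1 - r)) * A +
        25 / 21 * ε * (r * (1 - 2 * r) ^ 2 * max 0 (5 * r - 1)) * B) =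
      17 / 14 * ε * (r * (1 - 2 * r) ^ 2 / (1 - r) * (q * A) +
        max 0 (5 * r - 1) * (1 - 2 * r) * (q * B)) := by
    rw [hq]
    generalize 1 - r = s
    ring
  have hl := mul_le_mul_of_nonneg_left hloss (show 0 ≤ 17 / 14 * ε by positivity)
  have hρ : 0 ≤ ((1 + 2 * r) / 2) ^ k := by positivity
  rw [hP]
  have hρ' := mul_le_mul_of_nonneg_right hP1 hρ
  linarith

end

/-! ### Integration over the place of the root variable -/

theorem continuous_cutProb : Continuous cutProb := by
  have h : cutProb = fun r => (min r (1 / 2) / (1 - min r (1 / 2))) ^ 2 := by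
    ext r
    unfold cutProb
    split_ifs with h
    · rw [min_eq_left h.le]
    · rw [min_eq_right (not_lt.1 h)]
      norm_num
  rw [h]
  refine Continuous.pow (Continuous.div (by fun_prop) (by fun_prop) fun r => ?_) 2
  have := min_le_right r (1 / 2 : ℝ)
  linarith

theorem integral_pow_left_le (k : ℕ) :
    ∫ r in (0 : ℝ)..(1 / 2), 2 * ((1 + 2 * r) / 2) ^ k ≤ 2 / (k + 1) := by
  have hk : (k : ℝ) + 1 ≠ 0 := by positivity
  have hd : ∀ r ∈ Set.uIcc (0 : ℝ) (1 / 2), HasDerivAt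
      (fun r : ℝ => 2 / (k + 1) * ((1 + 2 * r) / 2) ^ (k + 1)) (2 * ((1 + 2 * r) / 2) ^ k) r := by
    intro r _
    have h1 : HasDerivAt (fun r : ℝ => (1 + 2 * r) / 2) 1 r := by
      simpa using (((hasDerivAt_id r).const_mul 2).const_add 1).div_const 2
    refine ((h1.pow (k + 1)).const_mul (2 / ((k : ℝ) + 1))).congr_deriv ?_
    push_cast
    field_simp
  rw [intervalIntegral.integral_eq_sub_of_hasDerivAt hd
    (Continuous.intervalIntegrable (by fun_prop) _ _)]
  have h2 : (0 : ℝ) ≤ 2 / (k + 1) * ((1 + 2 * 0) / 2) ^ (k + 1) := by positivity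
  norm_num at h2 ⊢
  linarith

theorem integral_pow_right_le (k : ℕ) :
    ∫ r in (1 / 2 : ℝ)..1, 2 * (2 * (1 - r)) ^ k ≤ 1 / (k + 1) := by
  have hk : (k : ℝ) + 1 ≠ 0 := by positivity
  have hd : ∀ r ∈ Set.uIcc (1 / 2 : ℝ) 1, HasDerivAt
      (fun r : ℝ => -(1 / (k + 1)) * (2 * (1 - r)) ^ (k + 1)) (2 * (2 * (1 - r)) ^ k) r := by
    intro r _
    have h1 : HasDerivAt (fun r : ℝ => 2 * (1 - r)) (-2) r := by
      simpa using ((hasDerivAt_id r).const_sub 1).const_mul 2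
    refine ((h1.pow (k + 1)).const_mul (-(1 / ((k : ℝ) + 1)))).congr_deriv ?_
    push_cast
    field_simp
  rw [intervalIntegral.integral_eq_sub_of_hasDerivAt hd
    (Continuous.intervalIntegrable (by fun_prop) _ _)]
  norm_num

section

variable {V : Type} {F : Finset (Clause V)} {G : Set (Clause V)}
  {canon : V → Clause V} {pick : List V → Clause V} {x : V} {H : SimpleGraph V} {ε r Thr : ℝ}

/-- The bound on the probability of a cut for `r > 1/2`: there are no correlations at such `r`. -/
theorem prod_cutBound_ge_of_half_lt (hr : 1 / 2 < r) (hr1 : r < 1)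
    (h3 : IsThreeCNF F) (hF : UniquelySat F)
    (hcanon : IsCanonicalChoice F canon) (hpick : IsClauseChoice F pick) (k : ℕ) :
    (∀ p, IsNode canon pick x p → 0 ≤ (sliceAt ε (TwoCC G) H x r).pr p ∧
      (sliceAt ε (TwoCC G) H x r).pr p ≤ 1) ∧
    1 - 2 * (2 * (1 - r)) ^ k ≤
      ∏ w ∈ children canon pick [x],
        (sliceAt ε (TwoCC G) H x r).cutBound (children canon pick) k w := by
  have hpr : ∀ p, p ≠ [] → (sliceAt ε (TwoCC G) H x r).pr p = r := by
    intro p hp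
    match p with
    | a :: q => simp [Slice.pr, Slice.loss, sliceAt, gam_of_ge hr.le, gamTwo_of_ge hr.le]
  have hpr' : ∀ p, IsNode canon pick x p → 0 ≤ (sliceAt ε (TwoCC G) H x r).pr p ∧
      (sliceAt ε (TwoCC G) H x r).pr p ≤ 1 := by
    intro p hp
    obtain ⟨a, q, rfl, -⟩ := IsNode.eq_cons hcanon hpick p hp
    rw [hpr _ (by simp)]
    constructor <;> linarith
  refine ⟨hpr', ?_⟩
  have hnode : ∀ w ∈ children canon pick [x], IsNode canon pick x w := fun w hw =>
    ⟨0, by rwa [children_root]⟩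
  refine one_sub_mul_le_prod (card_children_le_two h3 hF hcanon hpick (by simp))
    (pow_nonneg (by linarith) k) (fun w hw => ?_) (fun w hw => ?_) fun w hw => ?_
  · exact (Slice.cutBound_mem IsNode.child hpr' k (hnode w hw)).1
  · exact (Slice.cutBound_mem IsNode.child hpr' k (hnode w hw)).2
  · exact cutBound_ge_of_ge_half (D := sliceAt ε (TwoCC G) H x r) h3 hF hcanon hpick
      (by change 0 ≤ r; linarith) hr1.le hpr k (hnode w hw)

/-- The bound for trees of height `k + 1`, with an explicit error term and a constant slightly
better than `1.0302`. -/
theorem distD_cut_ge [Fintype V] (h3 : IsThreeCNF F) (hF : UniquelySat F) (hG : IsDerivedSet F G)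
    (hcanon : IsCanonicalChoice F canon) (hpick : IsClauseChoice F pick)
    (hε : 0 ≤ ε) (hε' : ε ≤ 1 / 10) (hThr : 0 ≤ Thr) (k : ℕ)
    (hH : IsLowGraph canon pick (TwoCC G) (k + 1) Thr H) (hx : x ∉ TwoCC G) :
    sThree - 3 / (k + 1) - 17 / 14 * (4227 / 5000) * ε * Thr ≤
      (distD ε (TwoCC G) H).real {π | Cut canon pick x (k + 1) π} := by
  have hW : ∀ u y, H.Adj u y → u ∉ TwoCC G := fun u y h => (hH.le_free h).2.1
  obtain ⟨J, hJi, hJ, hJr⟩ := exists_integral_le_distD (h := k + 1) (ε := ε) hcanon hpick hW hx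
  refine le_trans ?_ hJ
  have hvalid := fun r (h0 : 0 < r) (h1 : r < 1) =>
    sliceAt_valid hε hε' h0 h1 hH.degree_le hH.component_le hW hx
  have hJ1 : IntervalIntegrable J volume 0 (1 / 2) :=
    hJi.mono_set (Set.uIcc_subset_uIcc (by simp) (by simp; norm_num))
  have hJ2 : IntervalIntegrable J volume (1 / 2) 1 :=
    hJi.mono_set (Set.uIcc_subset_uIcc (by simp; norm_num) (by simp))
  have hc := fun a b : ℝ => continuous_cutProb.intervalIntegrable (μ := volume) a b
  have hL : IntervalIntegrable (totalLoss canon pick (TwoCC G) H (k + 1) x) volume 0 (1 / 2) :=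
    ContinuousOn.intervalIntegrable (by
      rw [Set.uIcc_of_le (by norm_num)]
      exact continuousOn_totalLoss)
  have hp1 : IntervalIntegrable (fun r : ℝ => 2 * ((1 + 2 * r) / 2) ^ k) volume 0 (1 / 2) :=
    Continuous.intervalIntegrable (by fun_prop) _ _
  have hp2 : IntervalIntegrable (fun r : ℝ => 2 * (2 * (1 - r)) ^ k) volume (1 / 2) 1 :=
    Continuous.intervalIntegrable (by fun_prop) _ _
  have i1 : ∫ r in (0 : ℝ)..(1 / 2), (cutProb r - 17 / 14 * ε *
      totalLoss canon pick (TwoCC G) H (k + 1) x r - 2 * ((1 + 2 * r) / 2) ^ k) ≤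
      ∫ r in (0 : ℝ)..(1 / 2), J r := by
    refine intervalIntegral.integral_mono_on_of_le_Ioo (by norm_num)
      (((hc _ _).sub (hL.const_mul _)).sub hp1) hJ1 fun r hr => ?_
    have hr1 : r < 1 := by linarith [hr.2]
    rw [hJr r hr.1 hr1]
    refine le_trans ?_ (expect_cutPattern_ge hcanon hpick (hvalid r hr.1 hr1) (fun p _ =>
      (sliceAt_budget hε hε' hr.1 hr.2).pr_mem hH.degree_le p) k)
    rw [cutProb, if_pos hr.2]
    exact prod_cutBound_ge_of_lt_half hε hε' hr.1 hr.2 hH.degree_le h3 hF hG hcanon hpick hx k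
  have i2 : ∫ r in (1 / 2 : ℝ)..1, (cutProb r - 2 * (2 * (1 - r)) ^ k) ≤
      ∫ r in (1 / 2 : ℝ)..1, J r := by
    refine intervalIntegral.integral_mono_on_of_le_Ioo (by norm_num)
      ((hc _ _).sub hp2) hJ2 fun r hr => ?_
    have hr0 : 0 < r := by linarith [hr.1]
    obtain ⟨h1, h2⟩ := prod_cutBound_ge_of_half_lt (ε := ε) (G := G) (H := H) (x := x) hr.1 hr.2
      h3 hF hcanon hpick k
    rw [hJr r hr0 hr.2, cutProb, if_neg (not_lt.2 hr.1.le)]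
    exact h2.trans (expect_cutPattern_ge hcanon hpick (hvalid r hr0 hr.2) h1 k)
  rw [intervalIntegral.integral_sub ((hc _ _).sub (hL.const_mul _)) hp1,
    intervalIntegral.integral_sub (hc _ _) (hL.const_mul _),
    intervalIntegral.integral_const_mul] at i1
  rw [intervalIntegral.integral_sub (hc _ _) hp2] at i2
  rw [← intervalIntegral.integral_add_adjacent_intervals hJ1 hJ2, sThree,
    ← intervalIntegral.integral_add_adjacent_intervals (hc 0 (1 / 2)) (hc (1 / 2) 1)]
  have hloss := mul_le_mul_of_nonneg_left
    (integral_totalLoss_le (x := x) h3 hF hcanon hpick hThr hH)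
    (show 0 ≤ 17 / 14 * ε by positivity)
  have e1 := integral_pow_left_le k
  have e2 := integral_pow_right_le k
  have e3 : (3 : ℝ) / (k + 1) = 2 / (k + 1) + 1 / (k + 1) := by ring
  linarith

end

end PPSZ

theorem mainTheorem4 :
    ∃ err : ℕ → ℝ, Filter.Tendsto err Filter.atTop (nhds 0) ∧
      ∀ (V : Type) [Fintype V] (F : Finset (PPSZ.Clause V)) (G : Set (PPSZ.Clause V))
        (canon : V → PPSZ.Clause V) (pick : List V → PPSZ.Clause V)
        (h : ℕ) (ε Thr : ℝ) (Hlow : SimpleGraph V),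
        PPSZ.IsThreeCNF F → PPSZ.UniquelySat F → PPSZ.IsDerivedSet F G →
        PPSZ.IsCanonicalChoice F canon → PPSZ.IsClauseChoice F pick →
        0 ≤ ε → ε ≤ 1 / 10 → 0 ≤ Thr →
        PPSZ.IsLowGraph canon pick (PPSZ.TwoCC G) h Thr Hlow →
        ∀ x : V, x ∉ PPSZ.TwoCC G →
          (PPSZ.distD ε (PPSZ.TwoCC G) Hlow).real {π | PPSZ.Cut canon pick x h π} ≥
            PPSZ.sThree - err h - 1.0302 * ε * Thr := by
  -- the error term is `3 / h` for `h ≥ 1`, and `6 / (h + 1)` also covers `h = 0`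
  refine ⟨fun h => 6 * (1 / ((h : ℝ) + 1)), ?_, ?_⟩
  · simpa using (tendsto_one_div_add_atTop_nhds_zero_nat (𝕜 := ℝ)).const_mul 6
  · intro V _ F G canon pick h ε Thr H h3 hF hG hcanon hpick hε hε' hThr hH x hx
    have hεT : 0 ≤ ε * Thr := mul_nonneg hε hThr
    match h, hH with
    | 0, _ =>
      -- the bound is trivial, since `sThree ≤ 2`
      have h1 : PPSZ.sThree ≤ 2 := by
        rw [PPSZ.sThree_eq]
        linarith [Real.log_nonneg (show (1 : ℝ) ≤ 2 by norm_num)]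
      have h2 : 0 ≤ (PPSZ.distD ε (PPSZ.TwoCC G) H).real {π | PPSZ.Cut canon pick x 0 π} :=
        MeasureTheory.measureReal_nonneg
      norm_num
      linarith
    | k + 1, hH =>
      refine le_trans ?_ (PPSZ.distD_cut_ge h3 hF hG hcanon hpick hε hε' hThr k hH hx)
      have h1 : (3 : ℝ) / (k + 1) ≤ 6 * (1 / (((k + 1 : ℕ) : ℝ) + 1)) := by
        push_cast
        rw [mul_one_div, div_le_div_iff₀ (by positivity) (by positivity)]
        linarith [Nat.cast_nonneg (α := ℝ) k]
      norm_num at h1 ⊢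
      linarith
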